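/- For $t>0$ let $\gamma_t$ denote a gamma random variable with density $x^{t-1}e^{-x}/\Gamma(t)$ on $(0,\infty)$; in a product $\gamma_t\gamma_s$ the two factors are independent. Let $Z_{1/3}$ be the positive $\tfrac13$-stable random variable, normalized by $\mathbb E[e^{-\lambda Z_{1/3}}]=e^{-\lambda^{1/3}}$ for $\lambda\ge 0$. For $a\in\mathbb R$ and $x>0$ let $K_a(x)=\int_0^\infty \cosh(ay)\,e^{-x\cosh y}\,dy$ be the modified Bessel function. A function $f:(0,\infty)\to(0,\infty)$ is called hyperbolically completely monotone (HCM) if for every $u>0$ the quantity $f(uv)f(u/v)$, $v>0$, is a completely monotone function of $w=v+v^{-1}\in[2,\infty)$, that is, a function of $w$ which is continuous on $[2,\infty)$, smooth on $(2,\infty)$, and whose $n$-th derivative there has the sign $(-1)^n$ (or vanishes) for every $n\ge0$. A positive random variable is called HCM if it has an HCM density on $(0,\infty)$. Then: 1. For all $t,s>0$, $\sqrt{\gamma_t\gamma_s}$ has on $(0,\infty)$ the density $$\frac{4x^{t+s-1}}{\Gamma(t)\Gamma(s)}K_{t-s}(2x).$$ 2. For all $t,s>0$ with $|t-s|\le \tfrac12$,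 $\sqrt{\gamma_t\gamma_s}$ is HCM, and it is infinitely divisible. 3. $\dfrac1{\sqrt{Z_{1/3}}}$ has the same distribution as $3\sqrt{3\,\gamma_{1/3}\gamma_{2/3}}$. 4. $\sqrt{Z_{1/3}}$ is HCM. 5. The function $f_{1/3}(x)=\dfrac1{x^{4/3}+x^{2/3}+1}$, $x>0$, is HCM. 6. The square root of the product of two independent unit exponential random variables is infinitely divisible. -/

import Mathlib

open MeasureTheory ProbabilityTheory
open scoped ContDiff

/-- Complete monotonicity on the half-line `[a, ∞)`: the function is continuous on `[a, ∞)`,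
smooth on `(a, ∞)`, and its derivatives alternate in sign there. -/
def IsCompletelyMonotoneOnIci (a : ℝ) (h : ℝ → ℝ) : Prop :=
  ContinuousOn h (Set.Ici a) ∧ ContDiffOn ℝ ∞ h (Set.Ioi a) ∧
    ∀ n : ℕ, ∀ w : ℝ, a < w → 0 ≤ (-1 : ℝ) ^ n * iteratedDeriv n h w

/-- `f : (0, ∞) → (0, ∞)` is hyperbolically completely monotone: for every `u > 0`, the quantity
`f (u v) * f (u / v)`, `v > 0`, is a completely monotone function of `w = v + v⁻¹ ∈ [2, ∞)`.
Only the values of `f` on `(0, ∞)` matter. -/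
def IsHCM (f : ℝ → ℝ) : Prop :=
  (∀ x : ℝ, 0 < x → 0 < f x) ∧
    ∀ u : ℝ, 0 < u → ∃ h : ℝ → ℝ, IsCompletelyMonotoneOnIci 2 h ∧
      ∀ v : ℝ, 0 < v → f (u * v) * f (u / v) = h (v + v⁻¹)

/-- The measure on `ℝ` with density `f` on `(0, ∞)` (and no mass on `(-∞, 0]`). -/
noncomputable def measureWithDensityOnPos (f : ℝ → ℝ) : Measure ℝ :=
  (volume.restrict (Set.Ioi (0 : ℝ))).withDensity (fun x => ENNReal.ofReal (f x))

/-- The law of a positive random variable having a hyperbolically completely monotone density. -/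
def HasHCMDensity (μ : Measure ℝ) : Prop :=
  ∃ f : ℝ → ℝ, Measurable f ∧ IsHCM f ∧ μ = measureWithDensityOnPos f

/-- The `n`-fold convolution power of a measure on `ℝ`. -/
noncomputable def convPower (ν : Measure ℝ) : ℕ → Measure ℝ
  | 0 => Measure.dirac 0
  | n + 1 => Measure.conv (convPower ν n) ν

/-- Infinite divisibility of a law on `ℝ`. -/
def IsInfinitelyDivisibleLaw (μ : Measure ℝ) : Prop :=
  IsProbabilityMeasure μ ∧
    ∀ n : ℕ, 0 < n → ∃ ν : Measure ℝ, IsProbabilityMeasure ν ∧ convPower ν n = μ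

/-- The law of the positive `α`-stable variable, normalized by `E[exp (-l Z)] = exp (-l ^ α)`. -/
def IsPositiveStableLaw (α : ℝ) (μ : Measure ℝ) : Prop :=
  IsProbabilityMeasure μ ∧ (∀ᵐ x ∂μ, 0 < x) ∧
    ∀ l : ℝ, 0 ≤ l → ∫ x, Real.exp (-(l * x)) ∂μ = Real.exp (-(l ^ α))

/-- The modified Bessel function `K_a`, evaluated at `x > 0`. -/
noncomputable def besselK (a x : ℝ) : ℝ :=
  ∫ y in Set.Ioi (0 : ℝ), Real.cosh (a * y) * Real.exp (-(x * Real.cosh y))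

/-- `f_{α,t}(x) = 1 / (x^{2t} + 2 cos(πα) x^t + 1)`, for `x > 0`. -/
noncomputable def cauchyTypeFun (α t x : ℝ) : ℝ :=
  1 / (x ^ (2 * t) + 2 * Real.cos (Real.pi * α) * x ^ t + 1)

/-! Everything rests on one kind of representation: `f (r v) f (r / v)` is a mixture of the
exponentials `exp (-κ (v + v⁻¹))`, with weights and exponents depending measurably on `r`
(`HypMixture`). Such a function is HCM, since a mixture of decreasing exponentials in `w = v + v⁻¹`
is completely monotone. Powers, exponentials and negative powers of `1 + c x` have such a
representation. Products, dilations and inversions preserve it, and so do multiplicative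
convolutions `x ↦ ∫ A h B (x h) dh / h`: after the substitution `h = r x`, `k = r / x`, the integral
over `x` of two hyperbolic kernels is again a mixture of exponentials in `w`
(`lintegral_hyperbolic_kernel`).

For `|a| ≤ 1/2`, `K_a (2x)` is a power times an exponential times the convolution of `h^(|a|+1/2) (1
+ h/2)^(-(1/2-|a|))` with an exponential (`besselK_eq_lintegral`). This makes the density of `√(γ_t
γ_s)` HCM. The function `1 / (x^(4/3) + x^(2/3) + 1)` is a power times the convolution of `r²
K_{1/3} (2r)` with `K_{1/3} (2r)`. The factorization of the stable variable compares Mellin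
transforms: `E[Z^(-σ)] = 3 Γ(3σ) / Γ(σ)`, and Gauss's triplication formula splits this into two
gamma factors. Inversion and scaling then show that `√Z` is HCM.

For infinite divisibility, the Laplace transform of the density is a constant times `Φ (2 + z)`,
where `Φ x = ∫ (1 + x h)^(-m) dρ(h)` is again such a convolution. The growth estimate
(`lintegral_convW_le`) shows that the mixture for `Φ (u v) Φ (u / v)` converges for all `w > -2`.
Continuing to `v = e^(iθ)` gives `|Φ (u e^(iθ))|² = ∫ exp (-2 x cos θ) dν(x)`, which is positive and
increases with `|θ|`. So `Φ` has no zero off the cut, and `-ζ Φ'/Φ` is a Pick function, nonnegative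
on `(0, ∞)`. Hence `-(log Φ)'` is a limit of positive mixtures of functions `1 / (a + k ζ)`.
Integrated, these are the Laplace exponents of gamma laws and drifts, so the law is a limit of
convolutions of gamma laws, and so are its convolution roots. -/

section

open scoped ENNReal NNReal Topology
open Filter

/-! ### The measure `dx / x` on `(0, ∞)` and its substitutions. -/

/-- The multiplicative Haar measure `dx / x` on `(0, ∞)`, as a measure on `ℝ`. -/
noncomputable def mulHaar : Measure ℝ := Measure.map Real.exp volume

instance : SFinite mulHaar := by unfold mulHaar; infer_instance

theorem measurableEmbedding_exp : MeasurableEmbedding Real.exp :=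
  Real.continuous_exp.measurableEmbedding Real.exp_injective

theorem lintegral_mulHaar (f : ℝ → ℝ≥0∞) : ∫⁻ x, f x ∂mulHaar = ∫⁻ y, f (Real.exp y) :=
  measurableEmbedding_exp.lintegral_map f

theorem ae_mulHaar_pos : ∀ᵐ x ∂mulHaar, 0 < x := by
  rw [mulHaar, measurableEmbedding_exp.ae_map_iff]
  exact Eventually.of_forall Real.exp_pos

theorem lintegral_mulHaar_congr {f g : ℝ → ℝ≥0∞} (h : ∀ x, 0 < x → f x = g x) :
    ∫⁻ x, f x ∂mulHaar = ∫⁻ x, g x ∂mulHaar := by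
  refine lintegral_congr_ae ?_
  filter_upwards [ae_mulHaar_pos] with x hx using h x hx

theorem lintegral_mulHaar_mono {f g : ℝ → ℝ≥0∞} (h : ∀ x, 0 < x → f x ≤ g x) :
    ∫⁻ x, f x ∂mulHaar ≤ ∫⁻ x, g x ∂mulHaar := by
  refine lintegral_mono_ae ?_
  filter_upwards [ae_mulHaar_pos] with x hx using h x hx

theorem setLIntegral_Ioi_eq_mulHaar (f : ℝ → ℝ≥0∞) :
    ∫⁻ x in Set.Ioi (0 : ℝ), f x = ∫⁻ x, ENNReal.ofReal x * f x ∂mulHaar := by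
  rw [lintegral_mulHaar, ← Real.range_exp, ← Set.image_univ,
    lintegral_image_eq_lintegral_abs_deriv_mul MeasurableSet.univ
      (fun x _ => (Real.hasDerivAt_exp x).hasDerivWithinAt) Real.exp_injective.injOn]
  simp [abs_of_pos (Real.exp_pos _)]

theorem lintegral_mulHaar_mul_left (f : ℝ → ℝ≥0∞) {c : ℝ} (hc : 0 < c) :
    ∫⁻ x, f (c * x) ∂mulHaar = ∫⁻ x, f x ∂mulHaar := by
  rw [lintegral_mulHaar, lintegral_mulHaar, ← lintegral_add_left_eq_self (fun y => f (Real.exp y))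
    (Real.log c)]
  simp [Real.exp_add, Real.exp_log hc]

theorem lintegral_mulHaar_inv (f : ℝ → ℝ≥0∞) :
    ∫⁻ x, f x⁻¹ ∂mulHaar = ∫⁻ x, f x ∂mulHaar := by
  rw [lintegral_mulHaar, lintegral_mulHaar, ← lintegral_neg_eq_self (fun y => f (Real.exp y))]
  simp [Real.exp_neg]

theorem lintegral_mulHaar_const_div (f : ℝ → ℝ≥0∞) {c : ℝ} (hc : 0 < c) :
    ∫⁻ x, f (c / x) ∂mulHaar = ∫⁻ x, f x ∂mulHaar := by
  rw [← lintegral_mulHaar_mul_left f hc, ← lintegral_mulHaar_inv fun x => f (c * x)]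
  simp [div_eq_mul_inv]

theorem lintegral_mulHaar_rpow (f : ℝ → ℝ≥0∞) {c : ℝ} (hc : 0 < c) :
    ENNReal.ofReal c * ∫⁻ x, f (x ^ c) ∂mulHaar = ∫⁻ x, f x ∂mulHaar := by
  rw [lintegral_mulHaar, lintegral_mulHaar]
  have h := lintegral_image_eq_lintegral_abs_deriv_mul (s := Set.univ) (f := fun y => c * y)
    (f' := fun _ => c) MeasurableSet.univ
    (fun x _ => by simpa using ((hasDerivAt_id x).const_mul c))
    (mul_right_injective₀ hc.ne').injOn (fun y => f (Real.exp y))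
  rw [Set.image_univ, (mul_left_surjective₀ hc.ne').range_eq] at h
  simp only [Measure.restrict_univ, abs_of_pos hc] at h
  rw [h, lintegral_const_mul' _ _ ENNReal.ofReal_ne_top]
  congr 1
  refine lintegral_congr fun y => ?_
  rw [← Real.exp_mul, mul_comm]

/-- In logarithmic coordinates `(r, x) ↦ (r x, r / x)` is linear with determinant `-2`, whence the
factor 2. It is carried out as `h = k x²` followed by `k = r / x`. -/
theorem lintegral_mulHaar_hyperbolic {F : ℝ → ℝ → ℝ≥0∞} (hF : Measurable (Function.uncurry F)) :
    ∫⁻ h, ∫⁻ k, F h k ∂mulHaar ∂mulHaar =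
      2 * ∫⁻ r, ∫⁻ x, F (r * x) (r / x) ∂mulHaar ∂mulHaar := by
  have hF' : ∀ {α : Type} [MeasurableSpace α] {a b : α → ℝ}, Measurable a → Measurable b →
      Measurable fun p => F (a p) (b p) := fun ha hb => hF.comp (ha.prodMk hb)
  calc ∫⁻ h, ∫⁻ k, F h k ∂mulHaar ∂mulHaar
      = ∫⁻ k, ∫⁻ h, F h k ∂mulHaar ∂mulHaar :=
        lintegral_lintegral_swap (hF' measurable_fst measurable_snd).aemeasurable
    _ = ∫⁻ k, 2 * ∫⁻ x, F (k * x ^ (2 : ℝ)) k ∂mulHaar ∂mulHaar := by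
        refine lintegral_mulHaar_congr fun k hk => ?_
        rw [← lintegral_mulHaar_mul_left (fun h => F h k) hk,
          ← lintegral_mulHaar_rpow (fun h => F (k * h) k) two_pos]
        simp
    _ = 2 * ∫⁻ k, ∫⁻ x, F (k * x ^ (2 : ℝ)) k ∂mulHaar ∂mulHaar :=
        lintegral_const_mul' _ _ (by simp)
    _ = 2 * ∫⁻ x, ∫⁻ k, F (k * x ^ (2 : ℝ)) k ∂mulHaar ∂mulHaar := by
        congr 1
        exact lintegral_lintegral_swap (hF' (a := fun p : ℝ × ℝ => p.1 * p.2 ^ (2 : ℝ))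
          (b := fun p => p.1) (by fun_prop) (by fun_prop)).aemeasurable
    _ = 2 * ∫⁻ x, ∫⁻ r, F (r * x) (r / x) ∂mulHaar ∂mulHaar := by
        congr 1
        refine lintegral_mulHaar_congr fun x hx => ?_
        rw [← lintegral_mulHaar_mul_left _ (inv_pos.2 hx)]
        refine lintegral_congr fun r => ?_
        congr 1
        · rw [Real.rpow_two]; field_simp
        · field_simp
    _ = _ := by
        congr 1
        exact lintegral_lintegral_swap (hF' (a := fun p : ℝ × ℝ => p.2 * p.1)
          (b := fun p => p.2 / p.1) (by fun_prop) (by fun_prop)).aemeasurable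

theorem lintegral_mulHaar_rpow_mul_exp {p b : ℝ} (hp : 0 < p) (hb : 0 < b) :
    ∫⁻ x, ENNReal.ofReal (x ^ p * Real.exp (-(b * x))) ∂mulHaar =
      ENNReal.ofReal (Real.Gamma p * b ^ (-p)) := by
  have h1 : ∫⁻ x in Set.Ioi (0 : ℝ), ENNReal.ofReal (x ^ (p - 1) * Real.exp (-(b * x))) =
      ENNReal.ofReal (Real.Gamma p * b ^ (-p)) := by
    have h2 := Real.integral_rpow_mul_exp_neg_mul_Ioi hp hb
    rw [← ofReal_integral_eq_lintegral_ofReal, h2]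
    · rw [one_div, Real.inv_rpow hb.le, Real.rpow_neg hb.le, mul_comm]
    · have h3 := Real.GammaIntegral_convergent hp
      by_contra h
      rw [integral_undef h] at h2
      have := mul_pos (Real.rpow_pos_of_pos (one_div_pos.2 hb) p) (Real.Gamma_pos_of_pos hp)
      linarith
    · filter_upwards [ae_restrict_mem measurableSet_Ioi] with x hx
      have : 0 < x := hx
      positivity
  rw [← h1, setLIntegral_Ioi_eq_mulHaar]
  refine lintegral_mulHaar_congr fun x hx => ?_
  rw [← ENNReal.ofReal_mul hx.le, ← mul_assoc, ← Real.rpow_one_add' hx.le (by linarith)]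
  congr 3; ring

theorem lintegral_mulHaar_one_Ioo : ∫⁻ _ in Set.Ioo (0 : ℝ) 1, 1 ∂mulHaar = ⊤ := by
  rw [setLIntegral_one, mulHaar, Measure.map_apply Real.measurable_exp measurableSet_Ioo]
  have : Real.exp ⁻¹' Set.Ioo 0 1 = Set.Iio 0 := by
    ext x; simp [Real.exp_pos]
  rw [this, Real.volume_Iio]

/-- Needed for the degenerate kernel `α = β = 0`, where both sides of `lintegral_hyperbolic_kernel`
are infinite. -/
theorem lintegral_mulHaar_exp_neg_eq_top : ∫⁻ x, ENNReal.ofReal (Real.exp (-x)) ∂mulHaar = ⊤ := by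
  rw [eq_top_iff]
  calc ⊤ = ENNReal.ofReal (Real.exp (-1)) * ∫⁻ _ in Set.Ioo (0 : ℝ) 1, 1 ∂mulHaar := by
        rw [lintegral_mulHaar_one_Ioo, ENNReal.mul_top (by simp [Real.exp_pos])]
    _ = ∫⁻ _ in Set.Ioo (0 : ℝ) 1, ENNReal.ofReal (Real.exp (-1)) ∂mulHaar := by
        rw [← lintegral_const_mul' _ _ ENNReal.ofReal_ne_top]; simp
    _ ≤ ∫⁻ x in Set.Ioo (0 : ℝ) 1, ENNReal.ofReal (Real.exp (-x)) ∂mulHaar :=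
        setLIntegral_mono' measurableSet_Ioo fun _ hx =>
          ENNReal.ofReal_le_ofReal (Real.exp_le_exp.2 (by linarith [hx.2]))
    _ ≤ _ := setLIntegral_le_lintegral _ _

/-! ### Mixtures of hyperbolic kernels and their elementary operations. -/

/-- The convolution of two kernels `exp (-α (x + x⁻¹))` on the multiplicative group is a mixture
of such kernels. -/
theorem lintegral_hyperbolic_kernel {α β v : ℝ} (hα : 0 ≤ α) (hβ : 0 ≤ β) (hv : 0 < v) :
    ∫⁻ x, ENNReal.ofReal (Real.exp (-(β * (x + x⁻¹)))) *
        ENNReal.ofReal (Real.exp (-(α * (v * x + (v * x)⁻¹)))) ∂mulHaar =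
      ∫⁻ y, ENNReal.ofReal (Real.exp (-y - (α ^ 2 + β ^ 2) / y)) *
        ENNReal.ofReal (Real.exp (-(α * β / y * (v + v⁻¹)))) ∂mulHaar := by
  rcases (add_nonneg (mul_nonneg hα hv.le) hβ).eq_or_lt with h | h
  · have hβ0 : β = 0 := by nlinarith [mul_nonneg hα hv.le]
    have hα0 : α = 0 := by
      have : α * v = 0 := by rw [hβ0] at h; linarith
      exact (mul_eq_zero.1 this).resolve_right hv.ne'
    subst hβ0 hα0
    have h1 : ∫⁻ y : ℝ, ENNReal.ofReal (Real.exp (-y)) ∂mulHaar ≤ ∫⁻ y : ℝ, 1 ∂mulHaar :=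
      lintegral_mulHaar_mono fun y hy => by simp [hy.le]
    simp [lintegral_mulHaar_exp_neg_eq_top] at h1 ⊢
    exact h1
  · symm
    -- Put `y = (α v + β) x`. The total exponent is `y + (α v + β)(α / v + β) / y`, and the product
    -- equals `α² + β² + α β (v + v⁻¹)`.
    rw [← lintegral_mulHaar_mul_left _ h]
    refine lintegral_mulHaar_congr fun x hx => ?_
    rw [← ENNReal.ofReal_mul (Real.exp_pos _).le, ← ENNReal.ofReal_mul (Real.exp_pos _).le,
      ← Real.exp_add, ← Real.exp_add]
    congr 2
    field_simp
    ring

/-- A representation of `f (ρ v) * f (ρ / v)` as a mixture of exponentials of `v + v⁻¹`, depending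
measurably on `ρ`. -/
structure HypMixture (f : ℝ → ℝ≥0∞) where
  Y : Type
  [mY : MeasurableSpace Y]
  μ : Measure Y
  [sfinite : SFinite μ]
  W : ℝ × Y → ℝ≥0∞
  κ : ℝ × Y → ℝ
  measurable_W : Measurable W
  measurable_κ : Measurable κ
  nonneg_κ : ∀ p, 0 ≤ κ p
  eq_lintegral : ∀ r v, 0 < r → 0 < v → f (r * v) * f (r / v) =
    ∫⁻ y, W (r, y) * ENNReal.ofReal (Real.exp (-(κ (r, y) * (v + v⁻¹)))) ∂μ

namespace HypMixture

attribute [instance] HypMixture.mY HypMixture.sfinite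

variable {f g A B : ℝ → ℝ≥0∞}

/-- Shrinking the exponents by `δ` increases the mixture at most by the factor `δ ^ (-q)`. -/
def Growth (H : HypMixture f) (q : ℝ) : Prop :=
  ∀ d r v, 0 < d → d ≤ 1 → 0 < r → 0 < v →
    ∫⁻ y, H.W (r, y) * ENNReal.ofReal (Real.exp (-(d * H.κ (r, y) * (v + v⁻¹)))) ∂H.μ ≤
      ENNReal.ofReal (d ^ (-q)) * (f (r * v) * f (r / v))

/-- A representation carries over to a function which agrees on `(0, ∞)`. -/
def congr (H : HypMixture f) (h : ∀ x, 0 < x → f x = g x) : HypMixture g :=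
  { H with
    eq_lintegral := fun r v hr hv => by
      rw [← h _ (mul_pos hr hv), ← h _ (div_pos hr hv), H.eq_lintegral r v hr hv] }

/-- Powers. -/
noncomputable def rpow (c : ℝ) : HypMixture fun x => ENNReal.ofReal (x ^ c) where
  Y := Unit
  μ := Measure.dirac ()
  W p := ENNReal.ofReal (p.1 ^ c * p.1 ^ c)
  κ _ := 0
  measurable_W := by fun_prop
  measurable_κ := measurable_const
  nonneg_κ _ := le_rfl
  eq_lintegral r v hr hv := by
    rw [← ENNReal.ofReal_mul (by positivity), ← Real.mul_rpow (by positivity) (by positivity),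
      lintegral_dirac, ← Real.mul_rpow hr.le hr.le]
    simp only [zero_mul, neg_zero, Real.exp_zero, ENNReal.ofReal_one, mul_one]
    congr 2
    field_simp

theorem rpow_growth (c : ℝ) : (rpow c).Growth 0 := by
  intro d r v _ _ hr hv
  rw [(rpow c).eq_lintegral r v hr hv]
  simp [rpow]

/-- Exponentials. -/
noncomputable def expNeg {c : ℝ} (hc : 0 ≤ c) :
    HypMixture fun x => ENNReal.ofReal (Real.exp (-(c * x))) where
  Y := Unit
  μ := Measure.dirac ()
  W _ := 1
  κ p := c * |p.1|
  measurable_W := by fun_prop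
  measurable_κ := by fun_prop
  nonneg_κ _ := by positivity
  eq_lintegral r v hr hv := by
    rw [← ENNReal.ofReal_mul (by positivity), ← Real.exp_add, lintegral_dirac, one_mul,
      abs_of_pos hr]
    congr 2
    field_simp
    ring

theorem lintegral_gamma_mixture {p S : ℝ} (hp : 0 < p) (hS : 0 < S) :
    ∫⁻ b, ENNReal.ofReal (b ^ p * Real.exp (-(S * b)) / Real.Gamma p) ∂mulHaar =
      ENNReal.ofReal (S ^ (-p)) := by
  have hG := Real.Gamma_pos_of_pos hp
  simp_rw [div_eq_mul_inv, mul_comm _ (Real.Gamma p)⁻¹, ENNReal.ofReal_mul (inv_pos.2 hG).le]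
  rw [lintegral_const_mul' _ _ ENNReal.ofReal_ne_top, lintegral_mulHaar_rpow_mul_exp hp hS,
    ← ENNReal.ofReal_mul (inv_pos.2 hG).le]
  congr 1
  field_simp

/-- `(1 + c r v)(1 + c r / v)` is affine in `w = v + v⁻¹`, and a negative power of it is a gamma
mixture of exponentials. -/
theorem lintegral_onePlus {c p r w : ℝ} (hc : 0 < c) (hp : 0 < p) (hr : 0 < r) (hw : 0 ≤ w) :
    ∫⁻ b, ENNReal.ofReal (b ^ p * Real.exp (-((1 + (c * r) ^ 2) * b)) / Real.Gamma p) *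
      ENNReal.ofReal (Real.exp (-(|b * (c * r)| * w))) ∂mulHaar =
      ENNReal.ofReal ((1 + (c * r) ^ 2 + c * r * w) ^ (-p)) := by
  rw [← lintegral_gamma_mixture hp (by positivity)]
  refine lintegral_mulHaar_congr fun b hb => ?_
  have hG := Real.Gamma_pos_of_pos hp
  rw [← ENNReal.ofReal_mul (by positivity), abs_of_pos (by positivity), div_mul_eq_mul_div,
    mul_assoc, ← Real.exp_add]
  congr 4
  ring

theorem onePlus_mul {c p r v : ℝ} (hc : 0 < c) (hr : 0 < r) (hv : 0 < v) :
    ENNReal.ofReal ((1 + c * (r * v)) ^ (-p)) * ENNReal.ofReal ((1 + c * (r / v)) ^ (-p)) =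
      ENNReal.ofReal ((1 + (c * r) ^ 2 + c * r * (v + v⁻¹)) ^ (-p)) := by
  rw [← ENNReal.ofReal_mul (by positivity), ← Real.mul_rpow (by positivity) (by positivity)]
  congr 2
  field_simp
  ring

/-- Negative powers of affine functions. -/
noncomputable def onePlus {c p : ℝ} (hc : 0 < c) (hp : 0 < p) :
    HypMixture fun x => ENNReal.ofReal ((1 + c * x) ^ (-p)) where
  Y := ℝ
  μ := mulHaar
  W q := ENNReal.ofReal (q.2 ^ p * Real.exp (-((1 + (c * q.1) ^ 2) * q.2)) / Real.Gamma p)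
  -- The absolute value only serves to make the exponent nonnegative everywhere; `mulHaar` charges
  -- only `q.2 > 0`, and the representation is required only for `q.1 > 0`.
  κ q := |q.2 * (c * q.1)|
  measurable_W := by fun_prop
  measurable_κ := by fun_prop
  nonneg_κ _ := by positivity
  eq_lintegral r v hr hv := by
    rw [lintegral_onePlus hc hp hr (by positivity), onePlus_mul hc hr hv]

/-- Replacing `w` by `d w` in `1 + (c r)² + c r w` shrinks this quantity at most by the factor `d`,
because `d ≤ 1`. -/
theorem onePlus_growth {c p : ℝ} (hc : 0 < c) (hp : 0 < p) : (onePlus hc hp).Growth p := by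
  intro d r v hd hd1 hr hv
  rw [onePlus_mul hc hr hv, ← ENNReal.ofReal_mul (by positivity),
    ← Real.mul_rpow (by positivity) (by positivity)]
  have h := lintegral_onePlus (w := d * (v + v⁻¹)) hc hp hr (by positivity)
  calc _ = _ := by
        refine Eq.trans (lintegral_congr fun b => ?_) h
        simp only [onePlus]
        congr 3
        ring
    _ ≤ _ := by
        refine ENNReal.ofReal_le_ofReal (Real.rpow_le_rpow_of_nonpos (by positivity) ?_
          (by linarith))
        have : d * (1 + (c * r) ^ 2) ≤ 1 * (1 + (c * r) ^ 2) := by gcongr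
        linarith

/-- The case `p = 0`, reached when `|t - s| = 1/2`, is the constant function; the gamma mixture
requires `p > 0`. -/
theorem exists_onePlus_growth {c p : ℝ} (hc : 0 < c) (hp : 0 ≤ p) :
    ∃ H : HypMixture fun x => ENNReal.ofReal ((1 + c * x) ^ (-p)), H.Growth p := by
  rcases hp.eq_or_lt with rfl | hp
  · have h : (fun x => ENNReal.ofReal ((1 + c * x) ^ (-0 : ℝ))) =
        fun x : ℝ => ENNReal.ofReal (x ^ (0 : ℝ)) := by simp
    rw [h]
    exact ⟨rpow 0, rpow_growth 0⟩
  · exact ⟨_, onePlus_growth hc hp⟩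

/-- Products. -/
noncomputable def mul (F : HypMixture f) (G : HypMixture g) : HypMixture fun x => f x * g x where
  Y := F.Y × G.Y
  μ := F.μ.prod G.μ
  W p := F.W (p.1, p.2.1) * G.W (p.1, p.2.2)
  κ p := F.κ (p.1, p.2.1) + G.κ (p.1, p.2.2)
  measurable_W := (F.measurable_W.comp (by fun_prop)).mul (G.measurable_W.comp (by fun_prop))
  measurable_κ := (F.measurable_κ.comp (by fun_prop)).add (G.measurable_κ.comp (by fun_prop))
  nonneg_κ p := add_nonneg (F.nonneg_κ _) (G.nonneg_κ _)
  eq_lintegral r v hr hv := by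
    have hF := F.measurable_W
    have hF' := F.measurable_κ
    have hG := G.measurable_W
    have hG' := G.measurable_κ
    rw [mul_mul_mul_comm, F.eq_lintegral r v hr hv, G.eq_lintegral r v hr hv,
      ← lintegral_prod_mul (by fun_prop) (by fun_prop)]
    refine lintegral_congr fun y => ?_
    rw [mul_mul_mul_comm, ← ENNReal.ofReal_mul (Real.exp_pos _).le, ← Real.exp_add]
    congr 3
    ring

theorem mul_growth {F : HypMixture f} {G : HypMixture g} {a b : ℝ} (hF : F.Growth a)
    (hG : G.Growth b) : (F.mul G).Growth (a + b) := by
  intro d r v hd hd1 hr hv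
  have hFm := F.measurable_W
  have hF' := F.measurable_κ
  have hGm := G.measurable_W
  have hG' := G.measurable_κ
  calc _ = (∫⁻ y, F.W (r, y) * ENNReal.ofReal (Real.exp (-(d * F.κ (r, y) * (v + v⁻¹)))) ∂F.μ) *
        ∫⁻ y, G.W (r, y) * ENNReal.ofReal (Real.exp (-(d * G.κ (r, y) * (v + v⁻¹)))) ∂G.μ := by
        rw [← lintegral_prod_mul (by fun_prop) (by fun_prop)]
        refine lintegral_congr fun y => ?_
        rw [mul_mul_mul_comm, ← ENNReal.ofReal_mul (Real.exp_pos _).le, ← Real.exp_add]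
        simp only [mul]
        congr 3
        ring
    _ ≤ _ := mul_le_mul' (hF d r v hd hd1 hr hv) (hG d r v hd hd1 hr hv)
    _ = _ := by
        rw [neg_add, Real.rpow_add hd, ENNReal.ofReal_mul (by positivity)]
        ring

/-- Dilations. -/
def dilate (F : HypMixture f) {c : ℝ} (hc : 0 < c) : HypMixture fun x => f (c * x) where
  Y := F.Y
  μ := F.μ
  W p := F.W (c * p.1, p.2)
  κ p := F.κ (c * p.1, p.2)
  measurable_W := F.measurable_W.comp (by fun_prop)
  measurable_κ := F.measurable_κ.comp (by fun_prop)
  nonneg_κ p := F.nonneg_κ _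
  eq_lintegral r v hr hv := by
    rw [← F.eq_lintegral (c * r) v (mul_pos hc hr) hv, mul_assoc, mul_div_assoc]

/-- Inversions. -/
noncomputable def invert (F : HypMixture f) : HypMixture fun x => f x⁻¹ where
  Y := F.Y
  μ := F.μ
  W p := F.W (p.1⁻¹, p.2)
  κ p := F.κ (p.1⁻¹, p.2)
  measurable_W := F.measurable_W.comp (by fun_prop)
  measurable_κ := F.measurable_κ.comp (by fun_prop)
  nonneg_κ p := F.nonneg_κ _
  eq_lintegral r v hr hv := by
    rw [← F.eq_lintegral r⁻¹ v (inv_pos.2 hr) hv, mul_comm]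
    congr 2
    · field_simp
    · field_simp

/-- Multiplication by a nonnegative constant. -/
noncomputable def constMul (F : HypMixture f) (c : ℝ≥0∞) : HypMixture fun x => c * f x where
  Y := F.Y
  μ := F.μ
  W p := c * c * F.W p
  κ := F.κ
  measurable_W := F.measurable_W.const_mul _
  measurable_κ := F.measurable_κ
  nonneg_κ := F.nonneg_κ
  eq_lintegral r v hr hv := by
    have hF := F.measurable_W
    have hF' := F.measurable_κ
    simp_rw [mul_assoc (c * c)]
    rw [lintegral_const_mul _ (by fun_prop), ← F.eq_lintegral r v hr hv]
    ring

/-! ### Multiplicative convolutions of mixtures. -/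

/-- The multiplicative convolution `x ↦ ∫ A h * B (x h) dh / h`. -/
noncomputable def mellinConv (A B : ℝ → ℝ≥0∞) (x : ℝ) : ℝ≥0∞ :=
  ∫⁻ h, A h * B (x * h) ∂mulHaar

/-- Tonelli brings the integral over `x` innermost, where the two kernels meet. The value `d = 1`
serves the representation of the convolution, and general `d` its growth estimate. -/
theorem lintegral_conv_swap (F : HypMixture A) (G : HypMixture B) (d u v r : ℝ) :
    ∫⁻ x, (∫⁻ a, F.W (r, a) * ENNReal.ofReal (Real.exp (-(d * F.κ (r, a) * (x + x⁻¹)))) ∂F.μ) *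
      (∫⁻ b, G.W (u * r, b) *
        ENNReal.ofReal (Real.exp (-(d * G.κ (u * r, b) * (v * x + (v * x)⁻¹)))) ∂G.μ) ∂mulHaar =
    ∫⁻ a, ∫⁻ b, F.W (r, a) * G.W (u * r, b) *
      ∫⁻ x, ENNReal.ofReal (Real.exp (-(d * F.κ (r, a) * (x + x⁻¹)))) *
        ENNReal.ofReal (Real.exp (-(d * G.κ (u * r, b) * (v * x + (v * x)⁻¹)))) ∂mulHaar
        ∂G.μ ∂F.μ := by
  have hF := F.measurable_W
  have hF' := F.measurable_κ
  have hG := G.measurable_W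
  have hG' := G.measurable_κ
  have h1 : ∀ x : ℝ, (∫⁻ a, F.W (r, a) *
      ENNReal.ofReal (Real.exp (-(d * F.κ (r, a) * (x + x⁻¹)))) ∂F.μ) *
      (∫⁻ b, G.W (u * r, b) *
        ENNReal.ofReal (Real.exp (-(d * G.κ (u * r, b) * (v * x + (v * x)⁻¹)))) ∂G.μ) =
      ∫⁻ a, ∫⁻ b, F.W (r, a) * G.W (u * r, b) *
        (ENNReal.ofReal (Real.exp (-(d * F.κ (r, a) * (x + x⁻¹)))) *
        ENNReal.ofReal (Real.exp (-(d * G.κ (u * r, b) * (v * x + (v * x)⁻¹))))) ∂G.μ ∂F.μ := by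
    intro x
    rw [← lintegral_mul_const _ (by fun_prop)]
    refine lintegral_congr fun a => ?_
    rw [← lintegral_const_mul _ (by fun_prop)]
    refine lintegral_congr fun b => ?_
    ring
  simp_rw [h1]
  rw [lintegral_lintegral_swap (by fun_prop)]
  refine lintegral_congr fun a => ?_
  rw [lintegral_lintegral_swap (by fun_prop)]
  refine lintegral_congr fun b => ?_
  rw [lintegral_const_mul _ (by fun_prop)]

/-- The substitution `h = r x`, `k = r / x` pairs the four factors so that the hypotheses on `A` (at
`r`, `x`) and on `B` (at `u r`, `v x`) both apply. -/
theorem mellinConv_mul (hA : Measurable A) (hB : Measurable B) {u v : ℝ} (hv : 0 < v) :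
    mellinConv A B (u * v) * mellinConv A B (u / v) =
      2 * ∫⁻ r, ∫⁻ x, A (r * x) * A (r / x) * (B (u * r * (v * x)) * B (u * r / (v * x)))
        ∂mulHaar ∂mulHaar := by
  unfold mellinConv
  rw [← lintegral_lintegral_mul (by fun_prop) (by fun_prop), lintegral_mulHaar_hyperbolic
    (F := fun h k => A h * B (u * v * h) * (A k * B (u / v * k))) (by fun_prop)]
  congr 1
  refine lintegral_congr fun r => lintegral_mulHaar_congr fun x hx => ?_
  rw [mul_mul_mul_comm]
  congr 3
  · ring
  · field_simp

theorem mellinConv_mul_eq_lintegral (F : HypMixture A) (G : HypMixture B) (hA : Measurable A)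
    (hB : Measurable B) {u v : ℝ} (hu : 0 < u) (hv : 0 < v) :
    mellinConv A B (u * v) * mellinConv A B (u / v) =
      ∫⁻ r, 2 * ∫⁻ a, ∫⁻ b, F.W (r, a) * G.W (u * r, b) *
      ∫⁻ x, ENNReal.ofReal (Real.exp (-(F.κ (r, a) * (x + x⁻¹)))) *
        ENNReal.ofReal (Real.exp (-(G.κ (u * r, b) * (v * x + (v * x)⁻¹)))) ∂mulHaar
        ∂G.μ ∂F.μ ∂mulHaar := by
  rw [mellinConv_mul hA hB hv, ← lintegral_const_mul' _ _ (by simp)]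
  refine lintegral_mulHaar_congr fun r hr => ?_
  have h := lintegral_conv_swap F G 1 u v r
  simp only [one_mul] at h
  rw [← h]
  congr 1
  refine lintegral_mulHaar_congr fun x hx => ?_
  rw [F.eq_lintegral r x hr hx, G.eq_lintegral (u * r) (v * x) (by positivity) (by positivity)]

/-- The weight of the representation of a multiplicative convolution. -/
noncomputable def convW (F : HypMixture A) (G : HypMixture B)
    (p : ℝ × (ℝ × (F.Y × (G.Y × ℝ)))) : ℝ≥0∞ :=
  2 * (F.W (p.2.1, p.2.2.1) * G.W (p.1 * p.2.1, p.2.2.2.1) *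
    ENNReal.ofReal (Real.exp (-p.2.2.2.2 -
      (G.κ (p.1 * p.2.1, p.2.2.2.1) ^ 2 + F.κ (p.2.1, p.2.2.1) ^ 2) / p.2.2.2.2)))

/-- The exponent of the representation of a multiplicative convolution. -/
noncomputable def convExponent (F : HypMixture A) (G : HypMixture B)
    (p : ℝ × (ℝ × (F.Y × (G.Y × ℝ)))) : ℝ :=
  G.κ (p.1 * p.2.1, p.2.2.2.1) * F.κ (p.2.1, p.2.2.1) / |p.2.2.2.2|

theorem measurable_convW (F : HypMixture A) (G : HypMixture B) : Measurable (convW F G) := by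
  have hF := F.measurable_W
  have hF' := F.measurable_κ
  have hG := G.measurable_W
  have hG' := G.measurable_κ
  unfold convW
  fun_prop

theorem measurable_convExponent (F : HypMixture A) (G : HypMixture B) :
    Measurable (convExponent F G) := by
  have hF' := F.measurable_κ
  have hG' := G.measurable_κ
  unfold convExponent
  have : Measurable fun x : ℝ => |x| := continuous_abs.measurable
  fun_prop

theorem convExponent_nonneg (F : HypMixture A) (G : HypMixture B)
    (p : ℝ × (ℝ × (F.Y × (G.Y × ℝ)))) : 0 ≤ convExponent F G p :=
  div_nonneg (mul_nonneg (G.nonneg_κ _) (F.nonneg_κ _)) (abs_nonneg _)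

theorem lintegral_convW (F : HypMixture A) (G : HypMixture B) (u w : ℝ) :
    ∫⁻ y, convW F G (u, y) * ENNReal.ofReal (Real.exp (-(convExponent F G (u, y) * w)))
      ∂(mulHaar.prod (F.μ.prod (G.μ.prod mulHaar))) =
    ∫⁻ r, 2 * ∫⁻ a, ∫⁻ b, F.W (r, a) * G.W (u * r, b) *
      ∫⁻ y, ENNReal.ofReal (Real.exp (-y - (G.κ (u * r, b) ^ 2 + F.κ (r, a) ^ 2) / y)) *
        ENNReal.ofReal (Real.exp (-(G.κ (u * r, b) * F.κ (r, a) / y * w))) ∂mulHaar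
        ∂G.μ ∂F.μ ∂mulHaar := by
  have hW := measurable_convW F G
  have hE := measurable_convExponent F G
  have hF := F.measurable_W
  have hF' := F.measurable_κ
  have hG := G.measurable_W
  have hG' := G.measurable_κ
  rw [lintegral_prod _ (by fun_prop)]
  refine lintegral_congr fun r => ?_
  rw [lintegral_prod _ (by fun_prop), ← lintegral_const_mul' _ _ (by simp)]
  refine lintegral_congr fun a => ?_
  rw [lintegral_prod _ (by fun_prop), ← lintegral_const_mul' _ _ (by simp)]
  refine lintegral_congr fun b => ?_
  rw [← lintegral_const_mul _ (by fun_prop), ← lintegral_const_mul' _ _ (by simp)]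
  refine lintegral_mulHaar_congr fun y hy => ?_
  simp only [convW, convExponent, abs_of_pos hy, mul_assoc]

/-- Multiplicative convolutions. -/
noncomputable def conv (F : HypMixture A) (G : HypMixture B) (hA : Measurable A)
    (hB : Measurable B) : HypMixture (mellinConv A B) where
  Y := ℝ × (F.Y × (G.Y × ℝ))
  μ := mulHaar.prod (F.μ.prod (G.μ.prod mulHaar))
  W := convW F G
  κ := convExponent F G
  measurable_W := measurable_convW F G
  measurable_κ := measurable_convExponent F G
  nonneg_κ := convExponent_nonneg F G
  eq_lintegral u v hu hv := by
    rw [lintegral_convW, mellinConv_mul_eq_lintegral F G hA hB hu hv]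
    refine lintegral_congr fun r => ?_
    congr 1
    refine lintegral_congr fun a => lintegral_congr fun b => ?_
    rw [lintegral_hyperbolic_kernel (G.nonneg_κ _) (F.nonneg_κ _) hv]

/-- The mixture at `w` is dominated by the mixture at `v = 1` with both families of exponents
multiplied by `d`; the growth of `F` and `G` controls the latter. Any `w > -2` admits a suitable
`d`. -/
theorem lintegral_convW_le {F : HypMixture A} {G : HypMixture B} {a b : ℝ} (hF : F.Growth a)
    (hG : G.Growth b) (hA : Measurable A) (hB : Measurable B) {d u w : ℝ} (hd : 0 < d)
    (hd1 : d ≤ 1) (hw : 4 * d ^ 2 ≤ 2 + w) (hu : 0 < u) :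
    ∫⁻ y, convW F G (u, y) * ENNReal.ofReal (Real.exp (-(convExponent F G (u, y) * w)))
      ∂(mulHaar.prod (F.μ.prod (G.μ.prod mulHaar))) ≤
      ENNReal.ofReal (d ^ (-(a + b))) * mellinConv A B u ^ 2 := by
  rw [lintegral_convW]
  calc _ ≤ ∫⁻ r, 2 * ∫⁻ a, ∫⁻ b, F.W (r, a) * G.W (u * r, b) *
      ∫⁻ x, ENNReal.ofReal (Real.exp (-(d * F.κ (r, a) * (x + x⁻¹)))) *
        ENNReal.ofReal (Real.exp (-(d * G.κ (u * r, b) * (1 * x + (1 * x)⁻¹)))) ∂mulHaar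
        ∂G.μ ∂F.μ ∂mulHaar := by
        refine lintegral_mono fun r => mul_le_mul_right (lintegral_mono fun a =>
          lintegral_mono fun b => mul_le_mul_right ?_ _) _
        have hα := G.nonneg_κ (u * r, b)
        have hβ := F.nonneg_κ (r, a)
        rw [lintegral_hyperbolic_kernel (mul_nonneg hd.le hα) (mul_nonneg hd.le hβ) one_pos]
        refine lintegral_mulHaar_mono fun y hy => ?_
        rw [← ENNReal.ofReal_mul (Real.exp_pos _).le, ← ENNReal.ofReal_mul (Real.exp_pos _).le,
          ← Real.exp_add, ← Real.exp_add]
        refine ENNReal.ofReal_le_ofReal (Real.exp_le_exp.2 ?_)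
        generalize G.κ (u * r, b) = α at *
        generalize F.κ (r, a) = β at *
        -- Here `d² (α + β)² = d² (α - β)² + 4 d² α β`; bound `d²` by 1 in the first term and `4 d²`
        -- by `2 + w` in the second.
        have h1 : d ^ 2 * (α + β) ^ 2 ≤ α ^ 2 + β ^ 2 + α * β * w := by
          have h2 : d ^ 2 * (α - β) ^ 2 ≤ 1 * (α - β) ^ 2 :=
            mul_le_mul_of_nonneg_right (by nlinarith) (sq_nonneg _)
          nlinarith [mul_le_mul_of_nonneg_left hw (mul_nonneg hα hβ)]
        have h3 := div_le_div_of_nonneg_right h1 hy.le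
        have e1 : -y - (α ^ 2 + β ^ 2) / y + -(α * β / y * w) =
          -y - (α ^ 2 + β ^ 2 + α * β * w) / y := by ring
        have e2 : -y - ((d * α) ^ 2 + (d * β) ^ 2) / y + -(d * α * (d * β) / y * (1 + 1⁻¹)) =
          -y - d ^ 2 * (α + β) ^ 2 / y := by ring
        rw [e1, e2]
        linarith
    _ = ∫⁻ r, 2 * ∫⁻ x, (∫⁻ a, F.W (r, a) *
          ENNReal.ofReal (Real.exp (-(d * F.κ (r, a) * (x + x⁻¹)))) ∂F.μ) *
        (∫⁻ b, G.W (u * r, b) *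
          ENNReal.ofReal (Real.exp (-(d * G.κ (u * r, b) * (1 * x + (1 * x)⁻¹)))) ∂G.μ)
          ∂mulHaar ∂mulHaar := by simp_rw [lintegral_conv_swap]
    _ ≤ ∫⁻ r, 2 * ∫⁻ x, ENNReal.ofReal (d ^ (-(a + b))) * (A (r * x) * A (r / x) *
          (B (u * r * (1 * x)) * B (u * r / (1 * x)))) ∂mulHaar ∂mulHaar := by
        refine lintegral_mulHaar_mono fun r hr => mul_le_mul_right
          (lintegral_mulHaar_mono fun x hx => ?_) _
        refine (mul_le_mul' (hF d r x hd hd1 hr hx)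
          (hG d (u * r) (1 * x) hd hd1 (by positivity) (by positivity))).trans_eq ?_
        rw [neg_add, Real.rpow_add hd, ENNReal.ofReal_mul (by positivity)]
        ring
    _ = _ := by
        have h := mellinConv_mul hA hB (u := u) one_pos
        rw [mul_one, div_one] at h
        rw [sq, h]
        simp_rw [lintegral_const_mul' _ _ ENNReal.ofReal_ne_top]
        rw [← lintegral_const_mul' _ _ (by simp), ← lintegral_const_mul' _ _ (by simp)]
        refine lintegral_congr fun r => ?_
        ring

/-! ### Mixing measures and complete monotonicity. -/

/-- The mixing measure at a given point. -/
noncomputable def mixing (F : HypMixture f) (u : ℝ) : Measure ℝ :=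
  (F.μ.withDensity fun y => F.W (u, y)).map fun y => F.κ (u, y)

theorem lintegral_mixing (F : HypMixture f) (u w : ℝ) :
    ∫⁻ x, ENNReal.ofReal (Real.exp (-(x * w))) ∂(F.mixing u) =
      ∫⁻ y, F.W (u, y) * ENNReal.ofReal (Real.exp (-(F.κ (u, y) * w))) ∂F.μ := by
  have hF := F.measurable_W
  have hF' := F.measurable_κ
  rw [mixing, lintegral_map (by fun_prop) (by fun_prop),
    lintegral_withDensity_eq_lintegral_mul _ (by fun_prop) (by fun_prop)]
  rfl

theorem ae_mixing_nonneg (F : HypMixture f) (u : ℝ) : ∀ᵐ x ∂(F.mixing u), 0 ≤ x := by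
  have hF' := F.measurable_κ
  rw [mixing, ae_map_iff (by fun_prop) measurableSet_Ici]
  exact Eventually.of_forall fun y => F.nonneg_κ _

/-- Finiteness of the convolution by itself only gives convergence for `w ≥ 2`. The larger range `w
> -2` is what permits continuation to `v = e^(iθ)` with `|θ| < π`. The choice `d = min 1 (√(2 + w) /
2)` is the largest allowed by `lintegral_convW_le`. -/
theorem lintegral_conv_mixing_ne_top {F : HypMixture A} {G : HypMixture B} {a b : ℝ}
    (hF : F.Growth a) (hG : G.Growth b) (hA : Measurable A) (hB : Measurable B) {u w : ℝ}
    (hu : 0 < u) (hw : -2 < w) (hfin : mellinConv A B u ≠ ⊤) :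
    ∫⁻ x, ENNReal.ofReal (Real.exp (-(x * w))) ∂((F.conv G hA hB).mixing u) ≠ ⊤ := by
  rw [lintegral_mixing]
  have hd : 0 < min 1 (√(2 + w) / 2) := lt_min one_pos (by
    have := Real.sqrt_pos.2 (show 0 < 2 + w by linarith)
    positivity)
  refine ne_top_of_le_ne_top ?_ (lintegral_convW_le hF hG hA hB hd (min_le_left _ _) ?_ hu)
  · exact ENNReal.mul_ne_top ENNReal.ofReal_ne_top (ENNReal.pow_ne_top hfin)
  · have h1 := pow_le_pow_left₀ hd.le (min_le_right 1 (√(2 + w) / 2)) 2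
    rw [div_pow, Real.sq_sqrt (by linarith)] at h1
    linarith

end HypMixture

theorem integrable_exp_neg_mul_of_lintegral_ne_top {ν : Measure ℝ} {w : ℝ}
    (h : ∫⁻ x, ENNReal.ofReal (Real.exp (-(x * w))) ∂ν ≠ ⊤) :
    Integrable (fun x => Real.exp (w * -x)) ν := by
  refine ⟨by fun_prop, ?_⟩
  rw [hasFiniteIntegral_iff_ofReal (Eventually.of_forall fun x => (Real.exp_pos _).le)]
  refine lt_of_le_of_lt (le_of_eq ?_) h.lt_top
  refine lintegral_congr fun x => ?_
  ring_nf

theorem ofReal_mgf_neg {ν : Measure ℝ} {w : ℝ}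
    (h : ∫⁻ x, ENNReal.ofReal (Real.exp (-(x * w))) ∂ν ≠ ⊤) :
    ENNReal.ofReal (mgf (fun x => -x) ν w) = ∫⁻ x, ENNReal.ofReal (Real.exp (-(x * w))) ∂ν := by
  rw [mgf, ofReal_integral_eq_lintegral_ofReal (integrable_exp_neg_mul_of_lintegral_ne_top h)
    (Eventually.of_forall fun x => (Real.exp_pos _).le)]
  refine lintegral_congr fun x => ?_
  ring_nf

/-- Beyond `a` the transform is analytic, and its derivatives carry the factor `(-x)^n`. At `a`
itself only integrability is known, so continuity there comes from domination by `exp (-a x)`. -/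
theorem isCompletelyMonotoneOnIci_mgf {ν : Measure ℝ} (hν : ∀ᵐ x ∂ν, 0 ≤ x) {a : ℝ}
    (ha : Integrable (fun x => Real.exp (a * -x)) ν) :
    IsCompletelyMonotoneOnIci a (mgf (fun x => -x) ν) := by
  have hle : ∀ w, a ≤ w → ∀ᵐ x ∂ν, ‖Real.exp (w * -x)‖ ≤ Real.exp (a * -x) := by
    intro w hw
    filter_upwards [hν] with x hx
    rw [Real.norm_of_nonneg (Real.exp_pos _).le]
    exact Real.exp_le_exp.2 (by nlinarith)
  have hsub : Set.Ici a ⊆ integrableExpSet (fun x => -x) ν := fun w hw =>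
    ha.mono' (by fun_prop) (hle w hw)
  have hint : Set.Ioi a ⊆ interior (integrableExpSet (fun x => -x) ν) := by
    rw [← interior_Ici]
    exact interior_mono hsub
  refine ⟨?_, ?_, ?_⟩
  · refine continuousOn_of_dominated (bound := fun x => Real.exp (a * -x)) ?_ hle ha ?_
    · intro w _
      fun_prop
    · exact Eventually.of_forall fun x => by fun_prop
  · exact (analyticOnNhd_mgf.mono hint).contDiffOn (uniqueDiffOn_Ioi a)
  · intro n w hw
    rw [iteratedDeriv_mgf (hint hw), ← integral_const_mul]
    refine integral_nonneg_of_ae ?_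
    filter_upwards [hν] with x hx
    have : (-1 : ℝ) ^ n * ((-x) ^ n * Real.exp (w * -x)) = x ^ n * Real.exp (w * -x) := by
      rw [← mul_assoc, ← mul_pow]; simp
    simp only [Pi.zero_apply]
    rw [this]
    positivity

theorem HypMixture.isHCM {f : ℝ → ℝ} (H : HypMixture fun x => ENNReal.ofReal (f x))
    (hf : ∀ x, 0 < x → 0 < f x) : IsHCM f := by
  refine ⟨hf, fun u hu => ⟨mgf (fun x => -x) (H.mixing u), ?_, fun v hv => ?_⟩⟩
  · refine isCompletelyMonotoneOnIci_mgf (H.ae_mixing_nonneg u)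
      (integrable_exp_neg_mul_of_lintegral_ne_top ?_)
    -- `v = 1` is the endpoint `w = 2`, where the mixture equals the finite number `f(u)²`.
    have h := H.eq_lintegral u 1 hu one_pos
    rw [inv_one, one_add_one_eq_two] at h
    rw [H.lintegral_mixing, ← h]
    exact ENNReal.mul_ne_top ENNReal.ofReal_ne_top ENNReal.ofReal_ne_top
  · have h := H.eq_lintegral u v hu hv
    rw [← H.lintegral_mixing, ← ENNReal.ofReal_mul (hf _ (by positivity)).le] at h
    have h2 := ofReal_mgf_neg (ν := H.mixing u) (w := v + v⁻¹) (h ▸ ENNReal.ofReal_ne_top)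
    rw [← h, ENNReal.ofReal_eq_ofReal_iff mgf_nonneg
      (mul_pos (hf _ (by positivity)) (hf _ (by positivity))).le] at h2
    exact h2.symm

/-! ### The Bessel function and its representation as a convolution. -/

theorem besselK_abs (a x : ℝ) : besselK |a| x = besselK a x := by
  unfold besselK
  congr 1
  ext y
  rcases abs_cases a with ⟨h, _⟩ | ⟨h, _⟩ <;> rw [h]
  rw [neg_mul, Real.cosh_neg]

theorem measurable_besselK (a : ℝ) : Measurable (besselK a) := by
  have h : StronglyMeasurable (Function.uncurry fun x y : ℝ =>
      Real.cosh (a * y) * Real.exp (-(x * Real.cosh y))) := by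
    have h1 : Continuous (Function.uncurry fun x y : ℝ =>
      Real.cosh (a * y) * Real.exp (-(x * Real.cosh y))) := by
      simp only [Function.uncurry_def]
      fun_prop
    exact h1.stronglyMeasurable
  exact (h.integral_prod_right (ν := volume.restrict (Set.Ioi (0 : ℝ)))).measurable

theorem lintegral_rpow_mul_exp_add_inv_lt_top {p r : ℝ} (hp : 0 < p) (hr : 0 < r) :
    ∫⁻ s, ENNReal.ofReal (s ^ p * Real.exp (-(r * (s + s⁻¹)))) ∂mulHaar < ⊤ := by
  refine lt_of_le_of_lt ?_ (lintegral_mulHaar_rpow_mul_exp hp hr ▸ ENNReal.ofReal_lt_top)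
  refine lintegral_mulHaar_mono fun s hs => ENNReal.ofReal_le_ofReal ?_
  have : r * s ≤ r * (s + s⁻¹) := by gcongr; simp [hs.le]
  gcongr

theorem exp_rpow_mul_exp_add_inv (a r y : ℝ) :
    Real.exp y ^ a * Real.exp (-(r * (Real.exp y + (Real.exp y)⁻¹))) =
      Real.exp (a * y) * Real.exp (-(2 * r * Real.cosh y)) := by
  rw [← Real.exp_mul, mul_comm y, ← Real.exp_neg, Real.cosh_eq]
  congr 2
  ring

theorem integrableOn_besselK (a : ℝ) {r : ℝ} (hr : 0 < r) :
    IntegrableOn (fun y => Real.cosh (a * y) * Real.exp (-(2 * r * Real.cosh y)))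
      (Set.Ioi 0) := by
  have h := lintegral_rpow_mul_exp_add_inv_lt_top (p := |a| + 1) (by positivity) hr
  rw [lintegral_mulHaar] at h
  have hint : Integrable fun y : ℝ => Real.exp ((|a| + 1) * y) *
      Real.exp (-(2 * r * Real.cosh y)) := by
    refine ⟨by fun_prop, ?_⟩
    rw [hasFiniteIntegral_iff_ofReal (Eventually.of_forall fun x => by positivity)]
    simpa only [exp_rpow_mul_exp_add_inv] using h
  refine hint.integrableOn.mono' (by fun_prop) ?_
  filter_upwards [ae_restrict_mem measurableSet_Ioi] with y hy
  have hy' : 0 < y := hy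
  rw [Real.norm_of_nonneg (by positivity)]
  refine mul_le_mul_of_nonneg_right ?_ (Real.exp_pos _).le
  rw [← Real.cosh_abs, abs_mul, abs_of_pos hy', Real.cosh_eq]
  have h1 : Real.exp (-(|a| * y)) ≤ Real.exp ((|a| + 1) * y) :=
    Real.exp_le_exp.2 (by nlinarith [mul_nonneg (abs_nonneg a) hy'.le])
  have h2 : Real.exp (|a| * y) ≤ Real.exp ((|a| + 1) * y) := Real.exp_le_exp.2 (by nlinarith)
  linarith

theorem lintegral_eq_Ioi_add_neg (g : ℝ → ℝ≥0∞) (hg : Measurable g) :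
    ∫⁻ y, g y = ∫⁻ y in Set.Ioi (0 : ℝ), (g y + g (-y)) := by
  rw [lintegral_add_left hg, ← lintegral_add_compl g (measurableSet_Ioi (a := (0 : ℝ))),
    Set.compl_Ioi, setLIntegral_congr Iio_ae_eq_Iic.symm]
  congr 1
  rw [← lintegral_indicator measurableSet_Iio, ← lintegral_indicator measurableSet_Ioi,
    ← lintegral_neg_eq_self]
  refine lintegral_congr fun y => ?_
  simp [Set.indicator]

theorem lintegral_rpow_mul_exp_add_inv (a : ℝ) {r : ℝ} (hr : 0 < r) :
    ∫⁻ s, ENNReal.ofReal (s ^ a * Real.exp (-(r * (s + s⁻¹)))) ∂mulHaar =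
      2 * ENNReal.ofReal (besselK a (2 * r)) := by
  rw [lintegral_mulHaar]
  simp_rw [exp_rpow_mul_exp_add_inv]
  rw [lintegral_eq_Ioi_add_neg _ (by fun_prop), besselK,
    ofReal_integral_eq_lintegral_ofReal (integrableOn_besselK a hr)
    (Eventually.of_forall fun y => by positivity), ← lintegral_const_mul' _ _ (by simp)]
  refine lintegral_congr fun y => ?_
  rw [← ENNReal.ofReal_add (by positivity) (by positivity), ← ENNReal.ofReal_ofNat,
    ← ENNReal.ofReal_mul (by norm_num), Real.cosh_neg, ← add_mul, Real.cosh_eq (a * y), mul_neg]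
  congr 1
  ring

theorem besselK_pos (a : ℝ) {x : ℝ} (hx : 0 < x) : 0 < besselK a x := by
  have h := lintegral_rpow_mul_exp_add_inv a (half_pos hx)
  rw [mul_div_cancel₀ x two_ne_zero] at h
  by_contra hc
  rw [ENNReal.ofReal_of_nonpos (not_lt.1 hc), mul_zero, lintegral_mulHaar,
    lintegral_eq_zero_iff (by fun_prop)] at h
  have h0 : (volume : Measure ℝ) = 0 := by
    rw [← ae_eq_bot, ← eventually_false_iff_eq_bot]
    filter_upwards [h] with y hy
    rw [Pi.zero_apply, ENNReal.ofReal_eq_zero] at hy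
    exact absurd hy (not_le.2 (by positivity))
  exact NeZero.ne (volume : Measure ℝ) h0

/-- With `s = e^(2y)` one has `c (s + s⁻¹) = 2c + 4c sinh² y`. Symmetrizing turns the factor `e^y`
into `cosh y`, the derivative of `sinh y`, and a Gaussian integral remains. -/
theorem lintegral_mulHaar_half {c : ℝ} (hc : 0 < c) :
    ∫⁻ s, ENNReal.ofReal (s ^ (1 / 2 : ℝ) * Real.exp (-(c * (s + s⁻¹)))) ∂mulHaar =
      ENNReal.ofReal (√(Real.pi / c) * Real.exp (-(2 * c))) := by
  rw [← lintegral_mulHaar_rpow _ two_pos, lintegral_mulHaar]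
  have h1 : ∀ y : ℝ, (Real.exp y ^ (2 : ℝ)) ^ (1 / 2 : ℝ) *
      Real.exp (-(c * (Real.exp y ^ (2 : ℝ) + (Real.exp y ^ (2 : ℝ))⁻¹))) =
      Real.exp y * (Real.exp (-(2 * c)) * Real.exp (-(4 * c) * Real.sinh y ^ 2)) := by
    intro y
    rw [← Real.rpow_mul (Real.exp_pos y).le, ← Real.exp_add]
    norm_num
    rw [← inv_pow, ← Real.exp_neg, Real.sinh_eq]
    have : Real.exp y * Real.exp (-y) = 1 := by rw [← Real.exp_add]; simp
    linear_combination (-2 * c) * this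
  simp_rw [h1]
  have h2 := lintegral_image_eq_lintegral_abs_deriv_mul (s := Set.univ) MeasurableSet.univ
    (fun x _ => (Real.hasDerivAt_sinh x).hasDerivWithinAt) Real.sinh_injective.injOn
    (fun u => ENNReal.ofReal (Real.exp (-(2 * c)) * Real.exp (-(4 * c) * u ^ 2)))
  rw [Set.image_univ, Real.sinh_surjective.range_eq, Measure.restrict_univ] at h2
  have h3 : ∫⁻ u : ℝ, ENNReal.ofReal (Real.exp (-(2 * c)) * Real.exp (-(4 * c) * u ^ 2)) =
      ENNReal.ofReal (Real.exp (-(2 * c)) * √(Real.pi / (4 * c))) := by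
    rw [← integral_gaussian, ← integral_const_mul, ofReal_integral_eq_lintegral_ofReal
      ((integrable_exp_neg_mul_sq (by positivity)).const_mul _)
      (Eventually.of_forall fun y => by positivity)]
  have h4 : ∫⁻ y : ℝ, ENNReal.ofReal (Real.exp y * (Real.exp (-(2 * c)) *
      Real.exp (-(4 * c) * Real.sinh y ^ 2))) = ∫⁻ y : ℝ, ENNReal.ofReal |Real.cosh y| *
      ENNReal.ofReal (Real.exp (-(2 * c)) * Real.exp (-(4 * c) * Real.sinh y ^ 2)) := by
    rw [lintegral_eq_Ioi_add_neg _ (by fun_prop), lintegral_eq_Ioi_add_neg _ (by fun_prop)]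
    refine lintegral_congr fun y => ?_
    rw [Real.sinh_neg, Real.cosh_neg, neg_sq, abs_of_pos (Real.cosh_pos y),
      ← ENNReal.ofReal_mul (by positivity), ← ENNReal.ofReal_add (by positivity) (by positivity),
      ← ENNReal.ofReal_add (by positivity) (by positivity), Real.cosh_eq]
    congr 1
    ring
  rw [h4, ← h2, h3, ← ENNReal.ofReal_mul (by norm_num)]
  congr 1
  rw [mul_comm 4 c, ← div_div, Real.sqrt_div' _ (by norm_num : (0 : ℝ) ≤ 4),
    show √(4 : ℝ) = 2 by rw [show (4 : ℝ) = 2 ^ 2 by norm_num]; simp]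
  ring

theorem lintegral_mulHaar_half_exp {A B : ℝ} (hA : 0 < A) (hB : 0 < B) :
    ∫⁻ s, ENNReal.ofReal (s ^ (1 / 2 : ℝ) * Real.exp (-(A * s + B / s))) ∂mulHaar =
      ENNReal.ofReal (√(Real.pi / A) * Real.exp (-(2 * √(A * B)))) := by
  have hd : 0 < √B / √A := by positivity
  rw [← lintegral_mulHaar_mul_left _ hd]
  have hAB : 0 < √A * √B := by positivity
  have h := lintegral_mulHaar_half hAB
  calc _ = ENNReal.ofReal ((√B / √A) ^ (1 / 2 : ℝ)) * ∫⁻ s, ENNReal.ofReal (s ^ (1 / 2 : ℝ) *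
        Real.exp (-(√A * √B * (s + s⁻¹)))) ∂mulHaar := by
        rw [← lintegral_const_mul' _ _ ENNReal.ofReal_ne_top]
        refine lintegral_mulHaar_congr fun s hs => ?_
        rw [← ENNReal.ofReal_mul (by positivity), Real.mul_rpow hd.le hs.le, mul_assoc]
        congr 4
        have h1 := Real.mul_self_sqrt hA.le
        have h2 := Real.mul_self_sqrt hB.le
        have h3 : 0 < √A := by positivity
        have h4 : 0 < √B := by positivity
        generalize √A = a at *
        generalize √B = b at *
        subst h1 h2
        field_simp
    _ = _ := by
        rw [h, ← ENNReal.ofReal_mul (by positivity), Real.sqrt_mul hA.le, ← mul_assoc,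
          ← Real.sqrt_eq_rpow, ← Real.sqrt_mul (by positivity)]
        congr 3
        have h1 := Real.mul_self_sqrt hA.le
        have h3 : 0 < √A := by positivity
        have h4 : 0 < √B := by positivity
        generalize √A = a at *
        subst h1
        field_simp

/-- The substitution `b = h (h + 2)` makes `1 + b = (h + 1)²` a square, which removes the square
roots left by the index `1/2`. -/
theorem lintegral_mulHaar_quadratic (g : ℝ → ℝ≥0∞) :
    ∫⁻ b, g b ∂mulHaar =
      ∫⁻ h, ENNReal.ofReal (2 * (h + 1) / (h + 2)) * g (h * (h + 2)) ∂mulHaar := by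
  have h1 : ∀ g : ℝ → ℝ≥0∞, ∫⁻ b, g b ∂mulHaar =
      ∫⁻ b in Set.Ioi (0 : ℝ), ENNReal.ofReal b⁻¹ * g b := by
    intro g
    rw [setLIntegral_Ioi_eq_mulHaar]
    refine lintegral_mulHaar_congr fun x hx => ?_
    rw [← mul_assoc, ← ENNReal.ofReal_mul hx.le, mul_inv_cancel₀ hx.ne']
    simp
  have himg : (fun h : ℝ => h * (h + 2)) '' Set.Ioi 0 = Set.Ioi 0 := by
    ext b
    constructor
    · rintro ⟨h, hh, rfl⟩
      have : 0 < h := hh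
      exact mul_pos this (by linarith)
    · intro hb
      have hb' : 0 < b := hb
      refine ⟨√(1 + b) - 1, ?_, ?_⟩
      · have := Real.lt_sqrt_of_sq_lt (show (1 : ℝ) ^ 2 < 1 + b by linarith)
        exact sub_pos.2 this
      · have := Real.mul_self_sqrt (show 0 ≤ 1 + b by linarith)
        linear_combination this
  have hinj : Set.InjOn (fun h : ℝ => h * (h + 2)) (Set.Ioi 0) := by
    intro a ha b hb hab
    have ha' : 0 < a := ha
    have hb' : 0 < b := hb
    have h2 : (a - b) * (a + b + 2) = 0 := by
      linear_combination hab
    rcases mul_eq_zero.1 h2 with h | h <;> linarith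
  have hder : ∀ x ∈ Set.Ioi (0 : ℝ), HasDerivWithinAt (fun h : ℝ => h * (h + 2)) (2 * (x + 1))
      (Set.Ioi 0) x := by
    intro x _
    have := (hasDerivAt_id x).mul ((hasDerivAt_id x).add_const 2)
    refine (this.congr_deriv ?_).hasDerivWithinAt
    simp
    ring
  have h2 := lintegral_image_eq_lintegral_abs_deriv_mul measurableSet_Ioi hder hinj
    (fun b => ENNReal.ofReal b⁻¹ * g b)
  rw [himg] at h2
  rw [h1, h2, h1]
  refine setLIntegral_congr_fun measurableSet_Ioi fun x hx => ?_
  have hx' : 0 < x := hx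
  rw [← mul_assoc, ← mul_assoc, ← ENNReal.ofReal_mul (by positivity),
    ← ENNReal.ofReal_mul (by positivity), abs_of_pos (by positivity)]
  congr 2
  field_simp

/-- Split `s^(-a) = s^(1/2) s^(-(a + 1/2))` and write the second factor as a gamma mixture with
parameter `b`. The integral over `s` is then the explicit one of index `1/2`, and `b = x h (h + 2)`
gives the result. The exponent `-(1/2 - a)` is nonpositive exactly when `a ≤ 1/2`; this is the
source of the condition `|t - s| ≤ 1/2`. -/
theorem besselK_eq_lintegral {a x : ℝ} (ha : 0 ≤ a) (hx : 0 < x) :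
    2 * ENNReal.ofReal (besselK a (2 * x)) =
      ENNReal.ofReal (2 * √Real.pi / Real.Gamma (a + 1 / 2) * 2 ^ (a - 1 / 2)) *
        (ENNReal.ofReal (x ^ a) * ENNReal.ofReal (Real.exp (-(2 * x))) *
        ∫⁻ h, ENNReal.ofReal (h ^ (a + 1 / 2)) *
          ENNReal.ofReal ((1 + 1 / 2 * h) ^ (-(1 / 2 - a))) *
          ENNReal.ofReal (Real.exp (-(2 * (x * h)))) ∂mulHaar) := by
  have hq : 0 < a + 1 / 2 := by linarith
  have hG := Real.Gamma_pos_of_pos hq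
  have h1 := lintegral_rpow_mul_exp_add_inv (-a) hx
  rw [← besselK_abs, abs_neg, besselK_abs] at h1
  rw [← h1]
  calc _ = ∫⁻ s, ∫⁻ b, ENNReal.ofReal (b ^ (a + 1 / 2) / Real.Gamma (a + 1 / 2)) *
        ENNReal.ofReal (s ^ (1 / 2 : ℝ) * Real.exp (-((x + b) * s + x / s))) ∂mulHaar ∂mulHaar := by
        refine lintegral_mulHaar_congr fun s hs => ?_
        have e : s ^ (-a) = s ^ (1 / 2 : ℝ) * s ^ (-(a + 1 / 2)) := by
          rw [← Real.rpow_add hs]; ring_nf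
        rw [e, mul_right_comm, ENNReal.ofReal_mul (by positivity),
          ← HypMixture.lintegral_gamma_mixture hq hs,
          ← lintegral_const_mul' _ _ ENNReal.ofReal_ne_top]
        refine lintegral_mulHaar_congr fun b hb => ?_
        rw [← ENNReal.ofReal_mul (by positivity), ← ENNReal.ofReal_mul (by positivity)]
        congr 1
        rw [show -((x + b) * s + x / s) = -(x * (s + s⁻¹)) + -(s * b) by ring, Real.exp_add]
        ring
    _ = ∫⁻ b, ∫⁻ s, ENNReal.ofReal (b ^ (a + 1 / 2) / Real.Gamma (a + 1 / 2)) *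
        ENNReal.ofReal (s ^ (1 / 2 : ℝ) * Real.exp (-((x + b) * s + x / s))) ∂mulHaar ∂mulHaar :=
        lintegral_lintegral_swap (by fun_prop)
    _ = ∫⁻ b, ENNReal.ofReal (b ^ (a + 1 / 2) / Real.Gamma (a + 1 / 2) *
          (√(Real.pi / (x + b)) * Real.exp (-(2 * √((x + b) * x))))) ∂mulHaar := by
        refine lintegral_mulHaar_congr fun b hb => ?_
        rw [lintegral_const_mul' _ _ ENNReal.ofReal_ne_top,
          lintegral_mulHaar_half_exp (by positivity) hx, ← ENNReal.ofReal_mul (by positivity)]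
    _ = _ := by
        rw [← lintegral_mulHaar_mul_left _ hx, lintegral_mulHaar_quadratic,
          ← ENNReal.ofReal_mul (by positivity), ← mul_assoc, ← ENNReal.ofReal_mul (by positivity),
          ← lintegral_const_mul' _ _ (ENNReal.ofReal_ne_top)]
        refine lintegral_mulHaar_congr fun h hh => ?_
        rw [← ENNReal.ofReal_mul (by positivity), ← ENNReal.ofReal_mul (by positivity),
          ← ENNReal.ofReal_mul (by positivity), ← ENNReal.ofReal_mul (by positivity)]
        congr 1
        have e1 : x + x * (h * (h + 2)) = x * (h + 1) ^ 2 := by ring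
        have e2 : √(x * (h + 1) ^ 2 * x) = x * (h + 1) := by
          rw [show x * (h + 1) ^ 2 * x = (x * (h + 1)) ^ 2 by ring]
          exact Real.sqrt_sq (by positivity)
        have e3 : √(Real.pi / (x * (h + 1) ^ 2)) = √Real.pi / (x ^ (1 / 2 : ℝ) * (h + 1)) := by
          rw [Real.sqrt_div Real.pi_pos.le, Real.sqrt_mul hx.le, Real.sqrt_sq (by positivity),
            Real.sqrt_eq_rpow x]
        have e4 : (2 : ℝ) ^ (a - 1 / 2) * (1 + 1 / 2 * h) ^ (-(1 / 2 - a)) =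
            (h + 2) ^ (a - 1 / 2) := by
          rw [neg_sub, ← Real.mul_rpow (by norm_num) (by positivity)]
          ring_nf
        have e5 : (x * (h * (h + 2))) ^ (a + 1 / 2) = x ^ a * x ^ (1 / 2 : ℝ) *
            (h ^ (a + 1 / 2) * ((h + 2) ^ (a - 1 / 2) * (h + 2))) := by
          rw [Real.mul_rpow hx.le (by positivity), Real.mul_rpow hh.le (by positivity),
            Real.rpow_add hx, ← Real.rpow_add_one (by positivity)]
          ring_nf
        have e6 : Real.exp (-(2 * (x * (h + 1)))) = Real.exp (-(2 * x)) *
            Real.exp (-(2 * (x * h))) := by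
          rw [← Real.exp_add]; ring_nf
        rw [e1, e2, e3, e5, e6, ← e4]
        have : 0 < x ^ (1 / 2 : ℝ) := by positivity
        field_simp

/-! ### Gamma laws and the density of `√(γ_t γ_s)`. -/

theorem lintegral_gammaMeasure {t : ℝ} (ht : 0 < t) {f : ℝ → ℝ≥0∞} (hf : Measurable f) :
    ∫⁻ x, f x ∂(gammaMeasure t 1) =
      ∫⁻ x, ENNReal.ofReal (x ^ t * Real.exp (-x) / Real.Gamma t) * f x ∂mulHaar := by
  have hG := Real.Gamma_pos_of_pos ht
  have hm : Measurable (gammaPDF t 1) := (measurable_gammaPDFReal t 1).ennreal_ofReal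
  rw [gammaMeasure, lintegral_withDensity_eq_lintegral_mul _ hm hf,
    ← lintegral_add_compl _ (measurableSet_Ioi (a := (0 : ℝ))), Set.compl_Ioi,
    setLIntegral_congr Iio_ae_eq_Iic.symm]
  have h0 : ∫⁻ x in Set.Iio (0 : ℝ), (gammaPDF t 1 * f) x = 0 := by
    rw [setLIntegral_congr_fun (g := fun _ => 0) measurableSet_Iio]
    · simp
    · intro x hx
      simp [gammaPDF_of_neg (Set.mem_Iio.1 hx)]
  rw [h0, add_zero, setLIntegral_Ioi_eq_mulHaar]
  refine lintegral_mulHaar_congr fun x hx => ?_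
  rw [Pi.mul_apply, gammaPDF_of_nonneg hx.le, ← mul_assoc, ← ENNReal.ofReal_mul hx.le]
  congr 2
  rw [Real.rpow_sub_one hx.ne']
  field_simp
  simp

theorem lintegral_measureWithDensityOnPos {f : ℝ → ℝ} {g : ℝ → ℝ≥0∞} (hf : Measurable f)
    (hg : Measurable g) :
    ∫⁻ x, g x ∂(measureWithDensityOnPos f) =
      ∫⁻ x, ENNReal.ofReal (x * f x) * g x ∂mulHaar := by
  rw [measureWithDensityOnPos, lintegral_withDensity_eq_lintegral_mul _ (by fun_prop) hg,
    setLIntegral_Ioi_eq_mulHaar]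
  refine lintegral_mulHaar_congr fun x hx => ?_
  rw [Pi.mul_apply, ← mul_assoc, ← ENNReal.ofReal_mul hx.le]

/-- The density of the square root of the product of two independent gamma variables. -/
noncomputable def sqrtGammaDensity (t s x : ℝ) : ℝ :=
  4 * x ^ (t + s - 1) / (Real.Gamma t * Real.Gamma s) * besselK (t - s) (2 * x)

theorem measurable_sqrtGammaDensity (t s : ℝ) : Measurable (sqrtGammaDensity t s) := by
  have := measurable_besselK (t - s)
  unfold sqrtGammaDensity
  fun_prop

theorem sqrtGammaDensity_pos {t s x : ℝ} (ht : 0 < t) (hs : 0 < s) (hx : 0 < x) :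
    0 < sqrtGammaDensity t s x := by
  have := besselK_pos (t - s) (show 0 < 2 * x by positivity)
  have := Real.Gamma_pos_of_pos ht
  have := Real.Gamma_pos_of_pos hs
  unfold sqrtGammaDensity
  positivity

/-- In the coordinates `(r x, r / x)` the root of the product is `r`. The remaining integral of
`x^(t-s) exp (-r (x + x⁻¹))` is `2 K_{t-s} (2r)`, and the other factor 2 is the Jacobian. -/
theorem map_sqrt_gamma_prod {t s : ℝ} (ht : 0 < t) (hs : 0 < s) :
    ((gammaMeasure t 1).prod (gammaMeasure s 1)).map (fun p => √(p.1 * p.2)) =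
      measureWithDensityOnPos (sqrtGammaDensity t s) := by
  have := isProbabilityMeasure_gammaMeasure ht one_pos
  have := isProbabilityMeasure_gammaMeasure hs one_pos
  have hGt := Real.Gamma_pos_of_pos ht
  have hGs := Real.Gamma_pos_of_pos hs
  refine Measure.ext_of_lintegral _ fun g hg => ?_
  rw [lintegral_map hg (by fun_prop), lintegral_prod _ (by fun_prop),
    lintegral_measureWithDensityOnPos (measurable_sqrtGammaDensity t s) hg,
    lintegral_gammaMeasure ht (f := fun x => ∫⁻ y, g √(x * y) ∂(gammaMeasure s 1))
      (Measurable.lintegral_prod_right' (f := fun p : ℝ × ℝ => g √(p.1 * p.2)) (by fun_prop))]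
  calc _ = ∫⁻ x, ∫⁻ y, ENNReal.ofReal (x ^ t * Real.exp (-x) / Real.Gamma t) *
        (ENNReal.ofReal (y ^ s * Real.exp (-y) / Real.Gamma s) * g √(x * y)) ∂mulHaar ∂mulHaar := by
        refine lintegral_congr fun x => ?_
        rw [lintegral_gammaMeasure hs (by fun_prop), lintegral_const_mul' _ _ ENNReal.ofReal_ne_top]
    _ = 2 * ∫⁻ r, ∫⁻ x, ENNReal.ofReal (r ^ (t + s) / (Real.Gamma t * Real.Gamma s)) * g r *
          ENNReal.ofReal (x ^ (t - s) * Real.exp (-(r * (x + x⁻¹)))) ∂mulHaar ∂mulHaar := by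
        rw [lintegral_mulHaar_hyperbolic (by fun_prop)]
        congr 1
        refine lintegral_mulHaar_congr fun r hr => lintegral_mulHaar_congr fun x hx => ?_
        have e1 : √(r * x * (r / x)) = r := by
          rw [show r * x * (r / x) = r ^ 2 by field_simp]
          exact Real.sqrt_sq hr.le
        rw [e1, ← mul_assoc, mul_right_comm _ (g r), ← ENNReal.ofReal_mul (by positivity),
          ← ENNReal.ofReal_mul (by positivity)]
        congr 2
        rw [Real.mul_rpow hr.le hx.le, Real.div_rpow hr.le hx.le, Real.rpow_add hr,
          Real.rpow_sub hx, show -(r * (x + x⁻¹)) = -(r * x) + -(r / x) by ring, Real.exp_add]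
        ring
    _ = _ := by
        rw [← lintegral_const_mul' _ _ (by simp)]
        refine lintegral_mulHaar_congr fun r hr => ?_
        rw [lintegral_const_mul _ (by fun_prop), lintegral_rpow_mul_exp_add_inv _ hr]
        have e : ENNReal.ofReal (r * sqrtGammaDensity t s r) =
            2 * (ENNReal.ofReal (r ^ (t + s) / (Real.Gamma t * Real.Gamma s)) *
              (2 * ENNReal.ofReal (besselK (t - s) (2 * r)))) := by
          rw [← ENNReal.ofReal_ofNat, ← ENNReal.ofReal_mul (by norm_num),
            ← ENNReal.ofReal_mul (by positivity), ← ENNReal.ofReal_mul (by norm_num)]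
          congr 1
          rw [sqrtGammaDensity, Real.rpow_sub_one hr.ne']
          field_simp
          ring
        rw [e]
        ring

theorem map_sqrt_mul_eq {Ω : Type*} [MeasurableSpace Ω] {P : Measure Ω} [IsProbabilityMeasure P]
    {t s : ℝ} (ht : 0 < t) (hs : 0 < s) {X Y : Ω → ℝ} (hX : HasLaw X (gammaMeasure t 1) P)
    (hY : HasLaw Y (gammaMeasure s 1) P) (hXY : IndepFun X Y P) :
    P.map (fun o => √(X o * Y o)) = measureWithDensityOnPos (sqrtGammaDensity t s) := by
  rw [← map_sqrt_gamma_prod ht hs, ← hX.map_eq, ← hY.map_eq,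
    ← (indepFun_iff_map_prod_eq_prod_map_map hX.aemeasurable hY.aemeasurable).1 hXY,
    AEMeasurable.map_map_of_aemeasurable (by fun_prop)
      (hX.aemeasurable.prodMk hY.aemeasurable)]
  rfl

theorem besselK_two_mul_eq_mellinConv {a x : ℝ} (hx : 0 < x) :
    ENNReal.ofReal (√Real.pi / Real.Gamma (|a| + 1 / 2) * 2 ^ (|a| - 1 / 2)) *
        (ENNReal.ofReal (x ^ |a|) * ENNReal.ofReal (Real.exp (-(2 * x))) *
        HypMixture.mellinConv (fun h => ENNReal.ofReal (h ^ (|a| + 1 / 2)) *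
          ENNReal.ofReal ((1 + 1 / 2 * h) ^ (-(1 / 2 - |a|))))
          (fun y => ENNReal.ofReal (Real.exp (-(2 * y)))) x) =
      ENNReal.ofReal (besselK a (2 * x)) := by
  have h := besselK_eq_lintegral (abs_nonneg a) hx
  rw [besselK_abs] at h
  rw [← ENNReal.mul_right_inj two_ne_zero ENNReal.ofNat_ne_top, h, ← mul_assoc]
  congr 1
  rw [← ENNReal.ofReal_ofNat, ← ENNReal.ofReal_mul (by norm_num)]
  congr 1
  ring

theorem nonempty_hypMixture_besselK {a : ℝ} (ha : |a| ≤ 1 / 2) :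
    Nonempty (HypMixture fun x => ENNReal.ofReal (besselK a (2 * x))) := by
  obtain ⟨H, -⟩ := HypMixture.exists_onePlus_growth (c := 1 / 2) (by norm_num) (sub_nonneg.2 ha)
  have K := ((HypMixture.rpow (|a| + 1 / 2)).mul H).conv
    (HypMixture.expNeg (c := 2) (by norm_num)) (by fun_prop) (by fun_prop)
  exact ⟨((((HypMixture.rpow |a|).mul (HypMixture.expNeg (c := 2) (by norm_num))).mul
    K).constMul _).congr fun x hx => besselK_two_mul_eq_mellinConv hx⟩

theorem nonempty_hypMixture_sqrtGammaDensity {t s : ℝ} (ht : 0 < t) (hs : 0 < s)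
    (hts : |t - s| ≤ 1 / 2) :
    Nonempty (HypMixture fun x => ENNReal.ofReal (sqrtGammaDensity t s x)) := by
  obtain ⟨K⟩ := nonempty_hypMixture_besselK hts
  have hGt := Real.Gamma_pos_of_pos ht
  have hGs := Real.Gamma_pos_of_pos hs
  refine ⟨(((HypMixture.rpow (t + s - 1)).mul K).constMul (ENNReal.ofReal
    (4 / (Real.Gamma t * Real.Gamma s)))).congr fun x hx => ?_⟩
  rw [← ENNReal.ofReal_mul (by positivity), ← ENNReal.ofReal_mul (by positivity),
    sqrtGammaDensity]
  congr 1
  ring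

theorem isHCM_sqrtGammaDensity {t s : ℝ} (ht : 0 < t) (hs : 0 < s) (hts : |t - s| ≤ 1 / 2) :
    IsHCM (sqrtGammaDensity t s) := by
  obtain ⟨K⟩ := nonempty_hypMixture_sqrtGammaDensity ht hs hts
  exact K.isHCM fun x hx => sqrtGammaDensity_pos ht hs hx

/-! ### Beta integrals and the function `1 / (x^(4/3) + x^(2/3) + 1)`. -/

theorem lintegral_mulHaar_beta {a b : ℝ} (ha : 0 < a) (hb : 0 < b) :
    ∫⁻ y, ENNReal.ofReal (y ^ a * (1 + y) ^ (-(a + b))) ∂mulHaar =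
      ENNReal.ofReal (Real.Gamma a * Real.Gamma b / Real.Gamma (a + b)) := by
  have hGa := Real.Gamma_pos_of_pos ha
  have hGb := Real.Gamma_pos_of_pos hb
  have hGab := Real.Gamma_pos_of_pos (add_pos ha hb)
  calc _ = ∫⁻ y, ∫⁻ q, ENNReal.ofReal (q ^ (a + b) * Real.exp (-q) / Real.Gamma (a + b)) *
        ENNReal.ofReal (y ^ a * Real.exp (-(q * y))) ∂mulHaar ∂mulHaar := by
        refine lintegral_mulHaar_congr fun y hy => ?_
        rw [ENNReal.ofReal_mul (by positivity), ← HypMixture.lintegral_gamma_mixture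
          (add_pos ha hb) (show 0 < 1 + y by positivity),
          ← lintegral_const_mul' _ _ ENNReal.ofReal_ne_top]
        refine lintegral_mulHaar_congr fun q hq => ?_
        rw [← ENNReal.ofReal_mul (by positivity), ← ENNReal.ofReal_mul (by positivity),
          show -((1 + y) * q) = -q + -(q * y) by ring, Real.exp_add]
        congr 1
        ring
    _ = ∫⁻ q, ∫⁻ y, ENNReal.ofReal (q ^ (a + b) * Real.exp (-q) / Real.Gamma (a + b)) *
        ENNReal.ofReal (y ^ a * Real.exp (-(q * y))) ∂mulHaar ∂mulHaar :=
        lintegral_lintegral_swap (by fun_prop)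
    _ = ∫⁻ q, ENNReal.ofReal (Real.Gamma a / Real.Gamma (a + b)) *
          ENNReal.ofReal (q ^ b * Real.exp (-(1 * q))) ∂mulHaar := by
        refine lintegral_mulHaar_congr fun q hq => ?_
        rw [lintegral_const_mul' _ _ ENNReal.ofReal_ne_top, lintegral_mulHaar_rpow_mul_exp ha hq,
          ← ENNReal.ofReal_mul (by positivity), ← ENNReal.ofReal_mul (by positivity)]
        congr 1
        rw [Real.rpow_add hq, Real.rpow_neg hq.le, one_mul]
        field_simp
    _ = _ := by
        rw [lintegral_const_mul' _ _ ENNReal.ofReal_ne_top,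
          lintegral_mulHaar_rpow_mul_exp hb one_pos, ← ENNReal.ofReal_mul (by positivity)]
        congr 1
        rw [Real.one_rpow]
        ring

theorem lintegral_mulHaar_rpow_div {ν X : ℝ} (h0 : 0 < ν) (h1 : ν < 1) (hX : 0 < X) :
    ∫⁻ y, ENNReal.ofReal (y ^ ν / (X + y)) ∂mulHaar =
      ENNReal.ofReal (X ^ (ν - 1) * (Real.Gamma ν * Real.Gamma (1 - ν))) := by
  have h := lintegral_mulHaar_beta h0 (sub_pos.2 h1)
  rw [add_sub_cancel, Real.Gamma_one, div_one] at h
  rw [ENNReal.ofReal_mul (by positivity), ← h, ← lintegral_const_mul' _ _ ENNReal.ofReal_ne_top,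
    ← lintegral_mulHaar_mul_left _ hX]
  refine lintegral_mulHaar_congr fun y hy => ?_
  rw [← ENNReal.ofReal_mul (by positivity), Real.mul_rpow hX.le hy.le, Real.rpow_sub_one hX.ne',
    Real.rpow_neg_one]
  congr 1
  field_simp

/-- Partial fractions: `(X - 1) y / ((1 + y)(X + y)) + 1 / (1 + y) = X / (X + y)`. The identity is
kept in additive form because the integrals take values in `ℝ≥0∞`. -/
theorem lintegral_mulHaar_rpow_div_mul_of_one_lt {ν X : ℝ} (h0 : 0 < ν) (h1 : ν < 1)
    (hX : 1 < X) :
    ∫⁻ y, ENNReal.ofReal (y ^ (ν + 1) / ((1 + y) * (X + y))) ∂mulHaar =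
      ENNReal.ofReal (Real.Gamma ν * Real.Gamma (1 - ν) * ((X ^ ν - 1) / (X - 1))) := by
  have hX0 : 0 < X := by linarith
  have hX1 : 0 < X - 1 := by linarith
  have hG : 0 < Real.Gamma ν * Real.Gamma (1 - ν) :=
    mul_pos (Real.Gamma_pos_of_pos h0) (Real.Gamma_pos_of_pos (by linarith))
  have hXν : 1 < X ^ ν := Real.one_lt_rpow hX h0
  have e := lintegral_mulHaar_rpow_div h0 h1 hX0
  have e1 := lintegral_mulHaar_rpow_div h0 h1 one_pos
  rw [Real.one_rpow, one_mul] at e1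
  have key : ENNReal.ofReal (X - 1) *
      ∫⁻ y, ENNReal.ofReal (y ^ (ν + 1) / ((1 + y) * (X + y))) ∂mulHaar +
      ENNReal.ofReal (Real.Gamma ν * Real.Gamma (1 - ν)) =
      ENNReal.ofReal (X ^ ν * (Real.Gamma ν * Real.Gamma (1 - ν))) := by
    have e2 : X ^ ν * (Real.Gamma ν * Real.Gamma (1 - ν)) =
        X * (X ^ (ν - 1) * (Real.Gamma ν * Real.Gamma (1 - ν))) := by
      rw [Real.rpow_sub_one hX0.ne']
      field_simp
    rw [e2, ENNReal.ofReal_mul hX0.le, ← e, ← e1, ← lintegral_const_mul' _ _ ENNReal.ofReal_ne_top,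
      ← lintegral_const_mul' _ _ ENNReal.ofReal_ne_top, ← lintegral_add_left (by fun_prop)]
    refine lintegral_mulHaar_congr fun y hy => ?_
    rw [← ENNReal.ofReal_mul hX1.le, ← ENNReal.ofReal_mul hX0.le,
      ← ENNReal.ofReal_add (by positivity) (by positivity), Real.rpow_add_one hy.ne']
    congr 1
    field_simp
    ring
  have e3 : ENNReal.ofReal (X ^ ν * (Real.Gamma ν * Real.Gamma (1 - ν))) =
      ENNReal.ofReal (X - 1) *
        ENNReal.ofReal (Real.Gamma ν * Real.Gamma (1 - ν) * ((X ^ ν - 1) / (X - 1))) +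
      ENNReal.ofReal (Real.Gamma ν * Real.Gamma (1 - ν)) := by
    have : 0 < (X ^ ν - 1) / (X - 1) := div_pos (by linarith) hX1
    rw [← ENNReal.ofReal_mul hX1.le, ← ENNReal.ofReal_add (by positivity) (by positivity)]
    congr 1
    field_simp
    ring
  rw [e3, ENNReal.add_left_inj ENNReal.ofReal_ne_top,
    ENNReal.mul_right_inj (by simpa using hX) ENNReal.ofReal_ne_top] at key
  exact key

/-- For `ν = 1/3` and `X = w³` the quotient `(X^ν - 1) / (X - 1)` is `1 / (w² + w + 1)`. The case `w
< 1` follows from `w⁻¹` by scaling `y` by `w³`, and `w = 1`, where the quotient degenerates, is a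
beta integral. -/
theorem lintegral_mulHaar_rpow_div_mul_cubic {w : ℝ} (hw : 0 < w) :
    ∫⁻ y, ENNReal.ofReal (y ^ (1 / 3 + 1 : ℝ) / ((1 + y) * (w ^ 3 + y))) ∂mulHaar =
      ENNReal.ofReal (Real.Gamma (1 / 3) * Real.Gamma (1 - 1 / 3) * (1 / (w ^ 2 + w + 1))) := by
  have hroot : ∀ z : ℝ, 0 < z → (z ^ 3) ^ (1 / 3 : ℝ) = z := fun z hz => by
    rw [← Real.rpow_natCast, ← Real.rpow_mul hz.le]; norm_num
  have hquot : ∀ z : ℝ, z ≠ 1 → 0 < z → (z - 1) / (z ^ 3 - 1) = 1 / (z ^ 2 + z + 1) := by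
    intro z hz hz0
    have h1 : z - 1 ≠ 0 := sub_ne_zero.2 hz
    have : z ^ 3 - 1 = (z - 1) * (z ^ 2 + z + 1) := by ring
    rw [this]
    have : z ^ 2 + z + 1 ≠ 0 := by positivity
    field_simp
  have hgt : ∀ z : ℝ, 1 < z → ∫⁻ y, ENNReal.ofReal (y ^ (1 / 3 + 1 : ℝ) /
      ((1 + y) * (z ^ 3 + y))) ∂mulHaar =
      ENNReal.ofReal (Real.Gamma (1 / 3) * Real.Gamma (1 - 1 / 3) * (1 / (z ^ 2 + z + 1))) := by
    intro z hz
    rw [lintegral_mulHaar_rpow_div_mul_of_one_lt (by norm_num) (by norm_num)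
      (one_lt_pow₀ hz (by norm_num)), hroot z (by linarith), hquot z hz.ne' (by linarith)]
  rcases lt_trichotomy w 1 with h | rfl | h
  · have h2 := hgt w⁻¹ ((one_lt_inv₀ hw).2 h)
    have hw3 : 0 < w ^ 3 := by positivity
    have e : ENNReal.ofReal (Real.Gamma (1 / 3) * Real.Gamma (1 - 1 / 3) *
        (1 / (w ^ 2 + w + 1))) = ENNReal.ofReal (w⁻¹ ^ 2) * ENNReal.ofReal (Real.Gamma (1 / 3) *
        Real.Gamma (1 - 1 / 3) * (1 / (w⁻¹ ^ 2 + w⁻¹ + 1))) := by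
      rw [← ENNReal.ofReal_mul (by positivity)]
      congr 1
      field_simp
      ring
    rw [e, ← h2, ← lintegral_const_mul' _ _ ENNReal.ofReal_ne_top,
      ← lintegral_mulHaar_mul_left _ hw3]
    refine lintegral_mulHaar_congr fun y hy => ?_
    rw [← ENNReal.ofReal_mul (by positivity), Real.rpow_add_one (by positivity),
      Real.rpow_add_one hy.ne', Real.mul_rpow hw3.le hy.le, hroot w hw]
    congr 1
    field_simp
  · have h2 := lintegral_mulHaar_beta (a := 1 / 3 + 1) (b := 1 - 1 / 3) (by norm_num) (by norm_num)
    rw [Real.Gamma_add_one (by norm_num)] at h2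
    norm_num at h2 ⊢
    rw [show 1 / 3 * Real.Gamma (1 / 3) * Real.Gamma (2 / 3) =
      Real.Gamma (1 / 3) * Real.Gamma (2 / 3) * (1 / 3) by ring] at h2
    rw [← h2]
    refine lintegral_mulHaar_congr fun y hy => ?_
    congr 1
    rw [div_eq_mul_inv, sq]
  · exact hgt w h

theorem lintegral_mulHaar_sq_mul_exp {D : ℝ} (hD : 0 < D) :
    ∫⁻ r, ENNReal.ofReal (r ^ 2 * Real.exp (-(D * r ^ 2))) ∂mulHaar =
      ENNReal.ofReal (1 / (2 * D)) := by
  have h := lintegral_mulHaar_rpow_mul_exp one_pos hD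
  rw [← lintegral_mulHaar_rpow _ two_pos] at h
  simp only [Real.rpow_two, Real.rpow_one, Real.Gamma_one, one_mul, Real.rpow_neg_one] at h
  rw [← ENNReal.mul_right_inj (a := ENNReal.ofReal 2) (by simp) (by simp), h,
    ← ENNReal.ofReal_mul (by norm_num)]
  congr 1
  field_simp

theorem two_mul_besselK_eq_lintegral_sub (a : ℝ) {b : ℝ} (hb : 0 < b) :
    2 * ENNReal.ofReal (besselK a (2 * b)) = ENNReal.ofReal (b ^ (-a)) *
      ∫⁻ s, ENNReal.ofReal (s ^ a * Real.exp (-s - b ^ 2 / s)) ∂mulHaar := by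
  rw [← lintegral_rpow_mul_exp_add_inv a hb, ← lintegral_const_mul' _ _ ENNReal.ofReal_ne_top]
  symm
  rw [← lintegral_mulHaar_mul_left _ hb]
  refine lintegral_mulHaar_congr fun s hs => ?_
  rw [← ENNReal.ofReal_mul (by positivity), Real.mul_rpow hb.le hs.le, Real.rpow_neg hb.le]
  congr 1
  rw [← mul_assoc, inv_mul_cancel_left₀ (by positivity)]
  congr 2
  field_simp
  ring

/-- Each Bessel factor is an integral of Gaussians in `r`. As `K` is even in its order, one factor
is taken with order `-ν`, so that the powers `(x r)^(-ν)` and `r^ν` cancel in `r`. Integrating out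
`r`, setting `S = Q y` and integrating out `Q` leaves a rational kernel in `y`. -/
theorem four_mul_mellinConv_besselK {ν x : ℝ} (hx : 0 < x) :
    4 * HypMixture.mellinConv (fun r => ENNReal.ofReal (r ^ (2 : ℝ)) *
        ENNReal.ofReal (besselK ν (2 * r))) (fun r => ENNReal.ofReal (besselK ν (2 * r))) x =
      ENNReal.ofReal (x ^ (-ν) / 2) *
        ∫⁻ y, ENNReal.ofReal (y ^ (ν + 1) / ((1 + y) * (x ^ 2 + y))) ∂mulHaar := by
  unfold HypMixture.mellinConv
  rw [← lintegral_const_mul' _ _ (by simp)]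
  calc _ = ∫⁻ r, ∫⁻ S, ∫⁻ Q, ENNReal.ofReal (x ^ (-ν) * (S ^ ν * Q ^ (-ν) * Real.exp (-S - Q))) *
        ENNReal.ofReal (r ^ 2 * Real.exp (-((x ^ 2 / S + 1 / Q) * r ^ 2)))
        ∂mulHaar ∂mulHaar ∂mulHaar := by
        refine lintegral_mulHaar_congr fun r hr => ?_
        have h1 := two_mul_besselK_eq_lintegral_sub ν (mul_pos hx hr)
        have h2 := two_mul_besselK_eq_lintegral_sub (-ν) hr
        rw [← besselK_abs, abs_neg, besselK_abs, neg_neg] at h2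
        calc _ = ENNReal.ofReal (r ^ 2) * ((2 * ENNReal.ofReal (besselK ν (2 * (x * r)))) *
              (2 * ENNReal.ofReal (besselK ν (2 * r)))) := by
              simp only [Real.rpow_two]; ring
          _ = ENNReal.ofReal (r ^ 2 * ((x * r) ^ (-ν) * r ^ ν)) *
              ((∫⁻ s, ENNReal.ofReal (s ^ ν * Real.exp (-s - (x * r) ^ 2 / s)) ∂mulHaar) *
              ∫⁻ q, ENNReal.ofReal (q ^ (-ν) * Real.exp (-q - r ^ 2 / q)) ∂mulHaar) := by
              rw [h1, h2, ENNReal.ofReal_mul (by positivity), ENNReal.ofReal_mul (by positivity)]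
              ring
          _ = _ := by
              rw [← lintegral_lintegral_mul (by fun_prop) (by fun_prop),
                ← lintegral_const_mul' _ _ ENNReal.ofReal_ne_top]
              refine lintegral_mulHaar_congr fun S hS => ?_
              rw [← lintegral_const_mul' _ _ ENNReal.ofReal_ne_top]
              refine lintegral_mulHaar_congr fun Q hQ => ?_
              rw [← ENNReal.ofReal_mul (by positivity), ← ENNReal.ofReal_mul (by positivity),
                ← ENNReal.ofReal_mul (by positivity), Real.mul_rpow hx.le hr.le]
              congr 1
              have e1 : r ^ (-ν) * r ^ ν = 1 := by rw [← Real.rpow_add hr]; simp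
              have e2 : Real.exp (-S - (x * r) ^ 2 / S) * Real.exp (-Q - r ^ 2 / Q) =
                  Real.exp (-S - Q) * Real.exp (-((x ^ 2 / S + 1 / Q) * r ^ 2)) := by
                rw [← Real.exp_add, ← Real.exp_add]
                congr 1
                ring
              linear_combination (r ^ 2 * x ^ (-ν) * S ^ ν * Q ^ (-ν) *
                (Real.exp (-S - (x * r) ^ 2 / S) * Real.exp (-Q - r ^ 2 / Q))) * e1 +
                (r ^ 2 * x ^ (-ν) * S ^ ν * Q ^ (-ν)) * e2
    _ = ∫⁻ S, ∫⁻ Q, ∫⁻ r, ENNReal.ofReal (x ^ (-ν) * (S ^ ν * Q ^ (-ν) * Real.exp (-S - Q))) *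
        ENNReal.ofReal (r ^ 2 * Real.exp (-((x ^ 2 / S + 1 / Q) * r ^ 2)))
        ∂mulHaar ∂mulHaar ∂mulHaar := by
        rw [lintegral_lintegral_swap (by fun_prop)]
        refine lintegral_congr fun S => ?_
        rw [lintegral_lintegral_swap (by fun_prop)]
    _ = ∫⁻ S, ∫⁻ Q, ENNReal.ofReal (x ^ (-ν) * (S ^ ν * Q ^ (-ν) * Real.exp (-S - Q))) *
        ENNReal.ofReal (1 / (2 * (x ^ 2 / S + 1 / Q))) ∂mulHaar ∂mulHaar := by
        refine lintegral_mulHaar_congr fun S hS => lintegral_mulHaar_congr fun Q hQ => ?_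
        rw [lintegral_const_mul' _ _ ENNReal.ofReal_ne_top,
          lintegral_mulHaar_sq_mul_exp (by positivity)]
    _ = ∫⁻ Q, ∫⁻ S, ENNReal.ofReal (x ^ (-ν) * (S ^ ν * Q ^ (-ν) * Real.exp (-S - Q))) *
        ENNReal.ofReal (1 / (2 * (x ^ 2 / S + 1 / Q))) ∂mulHaar ∂mulHaar :=
        lintegral_lintegral_swap (by fun_prop)
    _ = ∫⁻ Q, ∫⁻ y, ENNReal.ofReal (x ^ (-ν) / 2 * (y ^ (ν + 1) / (x ^ 2 + y))) *
          ENNReal.ofReal (Q ^ (1 : ℝ) * Real.exp (-((1 + y) * Q))) ∂mulHaar ∂mulHaar := by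
        refine lintegral_mulHaar_congr fun Q hQ => ?_
        rw [← lintegral_mulHaar_mul_left _ hQ]
        refine lintegral_mulHaar_congr fun y hy => ?_
        rw [← ENNReal.ofReal_mul (by positivity), ← ENNReal.ofReal_mul (by positivity),
          Real.mul_rpow hQ.le hy.le, Real.rpow_add_one hy.ne', Real.rpow_neg hQ.le, Real.rpow_one,
          show -(Q * y) - Q = -((1 + y) * Q) by ring]
        congr 1
        field_simp
    _ = ∫⁻ y, ∫⁻ Q, ENNReal.ofReal (x ^ (-ν) / 2 * (y ^ (ν + 1) / (x ^ 2 + y))) *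
          ENNReal.ofReal (Q ^ (1 : ℝ) * Real.exp (-((1 + y) * Q))) ∂mulHaar ∂mulHaar :=
        lintegral_lintegral_swap (by fun_prop)
    _ = _ := by
        rw [← lintegral_const_mul' _ _ ENNReal.ofReal_ne_top]
        refine lintegral_mulHaar_congr fun y hy => ?_
        rw [lintegral_const_mul' _ _ ENNReal.ofReal_ne_top,
          lintegral_mulHaar_rpow_mul_exp one_pos (by positivity), Real.Gamma_one,
          Real.rpow_neg_one, ← ENNReal.ofReal_mul (by positivity),
          ← ENNReal.ofReal_mul (by positivity)]
        congr 1
        field_simp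

theorem cauchyTypeFun_third (x : ℝ) : cauchyTypeFun (1 / 3) (1 - 1 / 3) x =
    1 / (x ^ (4 / 3 : ℝ) + x ^ (2 / 3 : ℝ) + 1) := by
  rw [cauchyTypeFun, mul_one_div, Real.cos_pi_div_three]
  norm_num

theorem isHCM_cauchyTypeFun_third : IsHCM (cauchyTypeFun (1 / 3) (1 - 1 / 3)) := by
  obtain ⟨K⟩ := nonempty_hypMixture_besselK (a := 1 / 3) (by norm_num [abs_of_pos])
  have hm : Measurable fun r => ENNReal.ofReal (besselK (1 / 3) (2 * r)) := by
    have := measurable_besselK (1 / 3)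
    fun_prop
  have hG : 0 < Real.Gamma (1 / 3) * Real.Gamma (1 - 1 / 3) :=
    mul_pos (Real.Gamma_pos_of_pos (by norm_num)) (Real.Gamma_pos_of_pos (by norm_num))
  -- The factor `x^(1/3)` applied to `C` below cancels the `x^(-ν)` of
  -- `four_mul_mellinConv_besselK`, and `x² = w³` with `w = x^(2/3)`.
  have C := ((HypMixture.rpow 2).mul K).conv K (by fun_prop) hm
  refine (((HypMixture.rpow (1 / 3)).mul C).constMul
    (ENNReal.ofReal (2 / (Real.Gamma (1 / 3) * Real.Gamma (1 - 1 / 3))) * 4)).congr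
    (g := fun x => ENNReal.ofReal (cauchyTypeFun (1 / 3) (1 - 1 / 3) x))
    (fun x hx => ?_) |>.isHCM fun x hx => ?_
  · have e1 : x ^ 2 = (x ^ (2 / 3 : ℝ)) ^ 3 := by
      rw [← Real.rpow_natCast, ← Real.rpow_natCast, ← Real.rpow_mul hx.le]; norm_num
    have e2 : x ^ (4 / 3 : ℝ) = (x ^ (2 / 3 : ℝ)) ^ 2 := by
      rw [← Real.rpow_natCast, ← Real.rpow_mul hx.le]; norm_num
    have h := four_mul_mellinConv_besselK (ν := 1 / 3) hx
    rw [e1, lintegral_mulHaar_rpow_div_mul_cubic (by positivity)] at h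
    rw [mul_assoc, mul_left_comm 4, h, cauchyTypeFun_third, e2, ← ENNReal.ofReal_mul (by positivity),
      ← ENNReal.ofReal_mul (by positivity), ← ENNReal.ofReal_mul (by positivity)]
    congr 1
    rw [Real.rpow_neg hx.le]
    field_simp
  · rw [cauchyTypeFun_third]
    positivity

/-! ### Uniqueness theorems for moment generating functions and Laplace transforms. -/

theorem tendsto_complexMGF_nhdsGT {μ : Measure ℝ} [IsFiniteMeasure μ]
    (hμ : Integrable (fun x => Real.exp (1 * x)) μ) (t : ℝ) :
    Tendsto (fun e : ℝ => complexMGF id μ (e + t * Complex.I)) (𝓝[>] 0)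
      (𝓝 (complexMGF id μ (t * Complex.I))) := by
  unfold complexMGF
  refine tendsto_integral_filter_of_dominated_convergence (fun x => 1 + Real.exp (1 * x))
    (Eventually.of_forall fun e => by fun_prop) ?_ ((integrable_const 1).add hμ) ?_
  · filter_upwards [Ioo_mem_nhdsGT (show (0 : ℝ) < 1 by norm_num)] with e he
    refine Eventually.of_forall fun x => ?_
    rw [Complex.norm_exp]
    have : ((↑e + ↑t * Complex.I) * ((id x : ℝ) : ℂ)).re = e * x := by simp
    rw [this]
    rcases le_total x 0 with hx | hx
    · have h1 : Real.exp (e * x) ≤ 1 := Real.exp_le_one_iff.2 (by nlinarith [he.1])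
      linarith [Real.exp_pos (1 * x)]
    · have h1 : Real.exp (e * x) ≤ Real.exp (1 * x) := Real.exp_le_exp.2 (by nlinarith [he.2])
      linarith
  · refine Eventually.of_forall fun x => ?_
    have h : Continuous fun e : ℝ => Complex.exp ((e + t * Complex.I) * ((id x : ℝ) : ℂ)) := by
      fun_prop
    have h2 := (h.tendsto 0).mono_left (nhdsWithin_le_nhds (s := Set.Ioi 0))
    simpa using h2

/-- Finiteness is assumed only for `t > 0`, so `0` need not be interior to the domain. The identity
theorem gives equality on the right half-plane, and the characteristic functions are the boundary
values on the imaginary axis. -/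
theorem measure_eq_of_mgf_eq {μ ν : Measure ℝ} [IsFiniteMeasure μ] [IsFiniteMeasure ν]
    (hμ : ∀ t : ℝ, 0 < t → Integrable (fun x => Real.exp (t * x)) μ)
    (hν : ∀ t : ℝ, 0 < t → Integrable (fun x => Real.exp (t * x)) ν)
    (h : ∀ t : ℝ, 0 < t → ∫ x, Real.exp (t * x) ∂μ = ∫ x, Real.exp (t * x) ∂ν) : μ = ν := by
  have han : ∀ {ρ : Measure ℝ}, (∀ t : ℝ, 0 < t → Integrable (fun x => Real.exp (t * x)) ρ) →
      AnalyticOnNhd ℂ (complexMGF id ρ) {z | z.re ∈ Set.Ioi 0} := fun hρ =>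
    analyticOnNhd_complexMGF.mono fun z hz =>
      interior_maximal (fun t ht => hρ t ht) isOpen_Ioi hz
  have heq : Set.EqOn (complexMGF id μ) (complexMGF id ν) {z | z.re ∈ Set.Ioi 0} := by
    refine (han hμ).eqOn_of_preconnected_of_frequently_eq (han hν)
      ((convex_Ioi 0).linear_preimage Complex.reLm).isPreconnected (z₀ := ((1 : ℝ) : ℂ))
      (by simp) ?_
    have h_real : ∃ᶠ x : ℝ in 𝓝[≠] 1, complexMGF id μ x = complexMGF id ν x := by
      refine Eventually.frequently ?_
      filter_upwards [nhdsWithin_le_nhds (Ioi_mem_nhds (show (0 : ℝ) < 1 by norm_num))] with x hx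
      rw [complexMGF_ofReal, complexMGF_ofReal, mgf, mgf]
      simp only [id]
      rw [h x hx]
    refine Tendsto.frequently ?_ h_real
    refine tendsto_nhdsWithin_iff.2 ⟨?_, ?_⟩
    · exact (Complex.continuous_ofReal.tendsto 1).mono_left nhdsWithin_le_nhds
    · filter_upwards [self_mem_nhdsWithin] with x hx
      simpa using hx
  refine Measure.ext_of_charFun ?_
  ext t
  rw [← complexMGF_id_mul_I, ← complexMGF_id_mul_I]
  refine tendsto_nhds_unique (tendsto_complexMGF_nhdsGT (hμ 1 one_pos) t) ?_
  refine (tendsto_complexMGF_nhdsGT (hν 1 one_pos) t).congr' ?_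
  filter_upwards [self_mem_nhdsWithin] with e he
  exact (heq (by simpa using he)).symm

theorem measure_eq_of_lintegral_exp_eq {μ ν : Measure ℝ} [IsFiniteMeasure μ] [IsFiniteMeasure ν]
    (hfin : ∀ t : ℝ, 0 < t → ∫⁻ x, ENNReal.ofReal (Real.exp (t * x)) ∂μ ≠ ⊤)
    (h : ∀ t : ℝ, 0 < t → ∫⁻ x, ENNReal.ofReal (Real.exp (t * x)) ∂μ =
      ∫⁻ x, ENNReal.ofReal (Real.exp (t * x)) ∂ν) : μ = ν := by
  have hint : ∀ {ρ : Measure ℝ}, (∀ t : ℝ, 0 < t →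
      ∫⁻ x, ENNReal.ofReal (Real.exp (t * x)) ∂ρ ≠ ⊤) →
      ∀ t : ℝ, 0 < t → Integrable (fun x => Real.exp (t * x)) ρ := fun hρ t ht => by
    refine ⟨by fun_prop, ?_⟩
    rw [hasFiniteIntegral_iff_ofReal (Eventually.of_forall fun x => (Real.exp_pos _).le)]
    exact (hρ t ht).lt_top
  refine measure_eq_of_mgf_eq (hint hfin) (hint fun t ht => h t ht ▸ hfin t ht) fun t ht => ?_
  rw [integral_eq_lintegral_of_nonneg_ae (Eventually.of_forall fun x => (Real.exp_pos _).le)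
    (by fun_prop), integral_eq_lintegral_of_nonneg_ae
    (Eventually.of_forall fun x => (Real.exp_pos _).le) (by fun_prop), h t ht]

/-- Laws on `[0, ∞)` are determined by their Laplace transforms. -/
theorem measure_eq_of_laplace_eq {μ ν : Measure ℝ} [IsFiniteMeasure μ] [IsFiniteMeasure ν]
    (hμ : ∀ᵐ x ∂μ, 0 ≤ x) (hν : ∀ᵐ x ∂ν, 0 ≤ x)
    (h : ∀ t : ℝ, 0 < t → ∫ x, Real.exp (-(t * x)) ∂μ = ∫ x, Real.exp (-(t * x)) ∂ν) :
    μ = ν := by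
  have hint : ∀ {ρ : Measure ℝ} [IsFiniteMeasure ρ], (∀ᵐ x ∂ρ, 0 ≤ x) → ∀ t : ℝ, 0 < t →
      Integrable (fun x => Real.exp (t * x)) (ρ.map Neg.neg) := by
    intro ρ _ hρ t ht
    rw [integrable_map_measure (by fun_prop) (by fun_prop)]
    refine (integrable_const (1 : ℝ)).mono' (by fun_prop) ?_
    filter_upwards [hρ] with x hx
    rw [Function.comp_apply, Real.norm_of_nonneg (Real.exp_pos _).le]
    exact Real.exp_le_one_iff.2 (by nlinarith)
  have key : μ.map Neg.neg = ν.map Neg.neg := by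
    refine measure_eq_of_mgf_eq (hint hμ) (hint hν) fun t ht => ?_
    rw [integral_map (by fun_prop) (by fun_prop), integral_map (by fun_prop) (by fun_prop)]
    simpa using h t ht
  have := congrArg (Measure.map Neg.neg) key
  rw [Measure.map_map measurable_neg measurable_neg,
    Measure.map_map measurable_neg measurable_neg] at this
  simpa using this

/-! ### The triplication formula and the stable law of index `1/3`. -/

theorem convexOn_log_Gamma_affine {c : ℝ} (hc : 0 ≤ c) :
    ConvexOn ℝ (Set.Ioi 0) fun s : ℝ => Real.log (Real.Gamma (s / 3 + c)) := by
  refine ⟨convex_Ioi 0, fun x hx y hy a b ha hb hab => ?_⟩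
  have hx' : 0 < x := hx
  have hy' : 0 < y := hy
  have h := Real.convexOn_log_Gamma.2 (x := x / 3 + c) (y := y / 3 + c)
    (Set.mem_Ioi.2 (by positivity)) (Set.mem_Ioi.2 (by positivity)) ha hb hab
  simp only [smul_eq_mul, Function.comp_apply] at h ⊢
  refine le_trans (le_of_eq ?_) h
  congr 2
  linear_combination -c * hab

/-- Gauss's multiplication formula for three factors. -/
theorem Gamma_triplication {s : ℝ} (hs : 0 < s) :
    Real.Gamma (s / 3) * Real.Gamma (s / 3 + 1 / 3) * Real.Gamma (s / 3 + 2 / 3) * 3 ^ (s - 1) /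
      (Real.Gamma (1 / 3) * Real.Gamma (2 / 3)) = Real.Gamma s := by
  have hC : 0 < Real.Gamma (1 / 3) * Real.Gamma (2 / 3) :=
    mul_pos (Real.Gamma_pos_of_pos (by norm_num)) (Real.Gamma_pos_of_pos (by norm_num))
  have hpos : ∀ s : ℝ, 0 < s → ∀ c : ℝ, 0 ≤ c → 0 < Real.Gamma (s / 3 + c) := fun s hs c hc =>
    Real.Gamma_pos_of_pos (by positivity)
  have hpos0 : ∀ s : ℝ, 0 < s → 0 < Real.Gamma (s / 3) := fun s hs =>
    Real.Gamma_pos_of_pos (by positivity)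
  -- Bohr–Mollerup: the left side is positive and log-convex, satisfies the functional equation of
  -- `Γ`, and equals 1 at 1.
  refine Real.eq_Gamma_of_log_convex (f := fun s => Real.Gamma (s / 3) *
    Real.Gamma (s / 3 + 1 / 3) * Real.Gamma (s / 3 + 2 / 3) * 3 ^ (s - 1) /
      (Real.Gamma (1 / 3) * Real.Gamma (2 / 3))) ?_ ?_ ?_ ?_ hs
  · have h3 : ConvexOn ℝ (Set.Ioi 0) fun s : ℝ => s * Real.log 3 := by
      simpa only [mul_comm _ (Real.log _)] using!
        (convexOn_id (convex_Ioi (0 : ℝ))).smul (Real.log_pos (by norm_num : (1 : ℝ) < 3)).le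
    refine ((((convexOn_log_Gamma_affine (c := 0) le_rfl).add
      (convexOn_log_Gamma_affine (c := 1 / 3) (by norm_num))).add
      (convexOn_log_Gamma_affine (c := 2 / 3) (by norm_num))).add h3).add_const
      (-Real.log 3 - Real.log (Real.Gamma (1 / 3) * Real.Gamma (2 / 3))) |>.congr ?_
    intro s hs
    have hs' : 0 < s := hs
    have h1 := hpos0 s hs'
    have h2 := hpos s hs' (1 / 3) (by norm_num)
    have h4 := hpos s hs' (2 / 3) (by norm_num)
    simp only [Pi.add_apply, Function.comp_apply, add_zero]
    rw [Real.log_div (by positivity) hC.ne',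
      Real.log_mul (mul_pos (mul_pos h1 h2) h4).ne' (by positivity), Real.log_mul (mul_pos h1 h2).ne' h4.ne', Real.log_mul h1.ne' h2.ne',
      Real.log_rpow (by norm_num)]
    ring
  · intro y hy
    have e : (y + 1) / 3 + 2 / 3 = y / 3 + 1 := by ring
    rw [e, Real.Gamma_add_one (by positivity), show (y + 1) / 3 = y / 3 + 1 / 3 by ring,
      show y / 3 + 1 / 3 + 1 / 3 = y / 3 + 2 / 3 by ring, add_sub_cancel_right,
      Real.rpow_sub_one (by norm_num)]
    field_simp
  · intro y hy
    have h1 := hpos0 y hy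
    have h2 := hpos y hy (1 / 3) (by norm_num)
    have h4 := hpos y hy (2 / 3) (by norm_num)
    positivity
  · have := (Real.Gamma_pos_of_pos (show (0 : ℝ) < 1 / 3 by norm_num)).ne'
    have := (Real.Gamma_pos_of_pos (show (0 : ℝ) < 2 / 3 by norm_num)).ne'
    norm_num
    exact ⟨‹_›, ‹_›⟩

theorem lintegral_rpow_gammaMeasure {t σ : ℝ} (ht : 0 < t) (hσ : 0 ≤ σ) :
    ∫⁻ x, ENNReal.ofReal (x ^ σ) ∂(gammaMeasure t 1) =
      ENNReal.ofReal (Real.Gamma (t + σ) / Real.Gamma t) := by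
  have hG := Real.Gamma_pos_of_pos ht
  rw [lintegral_gammaMeasure ht (by fun_prop), div_eq_mul_inv, ENNReal.ofReal_mul' (by positivity)]
  have h := lintegral_mulHaar_rpow_mul_exp (p := t + σ) (by positivity) one_pos
  rw [Real.one_rpow, mul_one] at h
  rw [← h, ← lintegral_mul_const' _ _ ENNReal.ofReal_ne_top]
  refine lintegral_mulHaar_congr fun x hx => ?_
  rw [← ENNReal.ofReal_mul (by positivity), ← ENNReal.ofReal_mul (by positivity),
    Real.rpow_add hx, one_mul]
  congr 1
  ring

theorem ae_gammaMeasure_pos {t : ℝ} (ht : 0 < t) : ∀ᵐ x ∂(gammaMeasure t 1), 0 < x := by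
  rw [ae_iff, ← lintegral_indicator_one (by measurability),
    lintegral_gammaMeasure ht (measurable_one.indicator (by measurability))]
  rw [lintegral_mulHaar_congr (g := fun _ => 0) fun x hx => by simp [hx]]
  simp

theorem lintegral_exp_neg_of_stable {α : ℝ} {μ : Measure ℝ} (hμ : IsPositiveStableLaw α μ) {l : ℝ}
    (hl : 0 ≤ l) : ∫⁻ x, ENNReal.ofReal (Real.exp (-(l * x))) ∂μ =
      ENNReal.ofReal (Real.exp (-(l ^ α))) := by
  have := hμ.1
  rw [← hμ.2.2 l hl, ofReal_integral_eq_lintegral_ofReal _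
    (Eventually.of_forall fun x => (Real.exp_pos _).le)]
  refine (integrable_const (1 : ℝ)).mono' (by fun_prop) ?_
  filter_upwards [hμ.2.1] with x hx
  rw [Real.norm_of_nonneg (Real.exp_pos _).le]
  exact Real.exp_le_one_iff.2 (by nlinarith)

/-- Writing `x^(-σ)` as a gamma mixture of `exp (-b x)` brings in the Laplace transform `exp
(-b^(1/3))`; replacing `b` by `b³` leaves a gamma integral. -/
theorem lintegral_rpow_neg_of_stable_third {μ : Measure ℝ} (hμ : IsPositiveStableLaw (1 / 3) μ)
    {σ : ℝ} (hσ : 0 < σ) : ∫⁻ x, ENNReal.ofReal (x ^ (-σ)) ∂μ =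
      ENNReal.ofReal (3 * Real.Gamma (3 * σ) / Real.Gamma σ) := by
  have := hμ.1
  have hG := Real.Gamma_pos_of_pos hσ
  calc _ = ∫⁻ x, ∫⁻ b, ENNReal.ofReal (b ^ σ / Real.Gamma σ) *
        ENNReal.ofReal (Real.exp (-(b * x))) ∂mulHaar ∂μ := by
        refine lintegral_congr_ae ?_
        filter_upwards [hμ.2.1] with x hx
        rw [← HypMixture.lintegral_gamma_mixture hσ hx]
        refine lintegral_mulHaar_congr fun b hb => ?_
        rw [← ENNReal.ofReal_mul (by positivity)]
        congr 1
        ring_nf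
    _ = ∫⁻ b, ∫⁻ x, ENNReal.ofReal (b ^ σ / Real.Gamma σ) *
        ENNReal.ofReal (Real.exp (-(b * x))) ∂μ ∂mulHaar := lintegral_lintegral_swap (by fun_prop)
    _ = ∫⁻ b, ENNReal.ofReal (b ^ σ / Real.Gamma σ) *
        ENNReal.ofReal (Real.exp (-(b ^ (1 / 3 : ℝ)))) ∂mulHaar := by
        refine lintegral_mulHaar_congr fun b hb => ?_
        rw [lintegral_const_mul' _ _ ENNReal.ofReal_ne_top, lintegral_exp_neg_of_stable hμ hb.le]
    _ = ENNReal.ofReal (3 / Real.Gamma σ) *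
          ∫⁻ b, ENNReal.ofReal (b ^ (3 * σ) * Real.exp (-(1 * b))) ∂mulHaar := by
        rw [← lintegral_mulHaar_rpow _ (show (0 : ℝ) < 3 by norm_num),
          ← lintegral_const_mul' _ _ ENNReal.ofReal_ne_top,
          ← lintegral_const_mul' _ _ ENNReal.ofReal_ne_top]
        refine lintegral_mulHaar_congr fun b hb => ?_
        rw [← ENNReal.ofReal_mul (by positivity), ← ENNReal.ofReal_mul (by positivity),
          ← ENNReal.ofReal_mul (by positivity), ← Real.rpow_mul hb.le, ← Real.rpow_mul hb.le,
          show (3 : ℝ) * (1 / 3) = 1 by norm_num, Real.rpow_one, one_mul]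
        congr 1
        ring
    _ = _ := by
        rw [lintegral_mulHaar_rpow_mul_exp (by positivity) one_pos,
          ← ENNReal.ofReal_mul (by positivity), Real.one_rpow]
        congr 1
        ring

/-- The exponential moments of order `σ > 0` on the two sides are `3 Γ(3σ) / Γ(σ)` and `27^σ Γ(1/3 +
σ) Γ(2/3 + σ) / (Γ(1/3) Γ(2/3))`. They agree by the triplication formula at `3σ`. Passing to
logarithms makes `measure_eq_of_lintegral_exp_eq` applicable. -/
theorem map_neg_log_of_stable_third {μ : Measure ℝ} (hμ : IsPositiveStableLaw (1 / 3) μ) :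
    μ.map (fun z => -Real.log z) = ((gammaMeasure (1 / 3) 1).prod (gammaMeasure (2 / 3) 1)).map
      fun p => Real.log (27 * (p.1 * p.2)) := by
  have := hμ.1
  have h13 : (0 : ℝ) < 1 / 3 := by norm_num
  have h23 : (0 : ℝ) < 2 / 3 := by norm_num
  have := isProbabilityMeasure_gammaMeasure h13 one_pos
  have := isProbabilityMeasure_gammaMeasure h23 one_pos
  have hlaw : ∀ σ : ℝ, 0 < σ → ∫⁻ x, ENNReal.ofReal (Real.exp (σ * x))
      ∂(μ.map fun z => -Real.log z) = ENNReal.ofReal (3 * Real.Gamma (3 * σ) / Real.Gamma σ) := by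
    intro σ hσ
    rw [lintegral_map (by fun_prop) (by fun_prop), ← lintegral_rpow_neg_of_stable_third hμ hσ]
    refine lintegral_congr_ae ?_
    filter_upwards [hμ.2.1] with x hx
    rw [Real.rpow_def_of_pos hx]
    ring_nf
  refine measure_eq_of_lintegral_exp_eq (fun σ hσ => hlaw σ hσ ▸ ENNReal.ofReal_ne_top)
    fun σ hσ => ?_
  rw [hlaw σ hσ, lintegral_map (by fun_prop) (by fun_prop)]
  have hae : ∀ᵐ p ∂((gammaMeasure (1 / 3) 1).prod (gammaMeasure (2 / 3) 1)),
      0 < p.1 ∧ 0 < p.2 :=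
    (Measure.quasiMeasurePreserving_fst.ae (ae_gammaMeasure_pos h13)).and
      (Measure.quasiMeasurePreserving_snd.ae (ae_gammaMeasure_pos h23))
  have e : ∀ p : ℝ × ℝ, 0 < p.1 ∧ 0 < p.2 →
      ENNReal.ofReal (Real.exp (σ * Real.log (27 * (p.1 * p.2)))) =
      ENNReal.ofReal (27 ^ σ) * (ENNReal.ofReal (p.1 ^ σ) * ENNReal.ofReal (p.2 ^ σ)) := by
    intro p ⟨h1, h2⟩
    rw [← ENNReal.ofReal_mul (by positivity), ← ENNReal.ofReal_mul (by positivity),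
      ← Real.mul_rpow h1.le h2.le, ← Real.mul_rpow (by norm_num) (by positivity),
      Real.rpow_def_of_pos (by positivity), mul_comm σ]
  rw [lintegral_congr_ae (hae.mono e), lintegral_const_mul' _ _ ENNReal.ofReal_ne_top,
    lintegral_prod_mul (f := fun x => ENNReal.ofReal (x ^ σ))
      (g := fun x => ENNReal.ofReal (x ^ σ)) (by fun_prop) (by fun_prop), lintegral_rpow_gammaMeasure h13 hσ.le,
    lintegral_rpow_gammaMeasure h23 hσ.le]
  have g1 := Real.Gamma_pos_of_pos h13
  have g2 := Real.Gamma_pos_of_pos h23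
  have g3 := Real.Gamma_pos_of_pos hσ
  have g4 := Real.Gamma_pos_of_pos (show 0 < 1 / 3 + σ by positivity)
  have g5 := Real.Gamma_pos_of_pos (show 0 < 2 / 3 + σ by positivity)
  rw [← ENNReal.ofReal_mul (by positivity), ← ENNReal.ofReal_mul (by positivity),
    ← Gamma_triplication (show 0 < 3 * σ by positivity)]
  congr 1
  rw [show (27 : ℝ) = 3 ^ (3 : ℝ) by norm_num, ← Real.rpow_mul (by norm_num),
    Real.rpow_sub_one (by norm_num), mul_div_cancel_left₀ σ (by norm_num : (3 : ℝ) ≠ 0),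
    add_comm σ, add_comm σ]
  field_simp

theorem map_inv_sqrt_of_stable_third {μ : Measure ℝ} (hμ : IsPositiveStableLaw (1 / 3) μ) :
    μ.map (fun z => 1 / √z) = ((gammaMeasure (1 / 3) 1).prod (gammaMeasure (2 / 3) 1)).map
      fun p => 3 * √(3 * (p.1 * p.2)) := by
  have h13 : (0 : ℝ) < 1 / 3 := by norm_num
  have h23 : (0 : ℝ) < 2 / 3 := by norm_num
  have := isProbabilityMeasure_gammaMeasure h13 one_pos
  have := isProbabilityMeasure_gammaMeasure h23 one_pos
  have hexp : ∀ x : ℝ, 0 < x → Real.exp (Real.log x / 2) = √x := by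
    intro x hx
    rw [Real.sqrt_eq_rpow, Real.rpow_def_of_pos hx]
    ring_nf
  have h := congrArg (Measure.map fun x : ℝ => Real.exp (x / 2)) (map_neg_log_of_stable_third hμ)
  rw [Measure.map_map (by fun_prop) (by fun_prop), Measure.map_map (by fun_prop) (by fun_prop)] at h
  have hae : ∀ᵐ p ∂((gammaMeasure (1 / 3) 1).prod (gammaMeasure (2 / 3) 1)),
      0 < p.1 ∧ 0 < p.2 :=
    (Measure.quasiMeasurePreserving_fst.ae (ae_gammaMeasure_pos h13)).and
      (Measure.quasiMeasurePreserving_snd.ae (ae_gammaMeasure_pos h23))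
  calc _ = _ := by
        refine Measure.map_congr ?_
        filter_upwards [hμ.2.1] with x hx
        rw [one_div, ← hexp x hx, ← Real.exp_neg]
        simp only [Function.comp_apply]
        ring_nf
    _ = _ := h
    _ = _ := by
        refine Measure.map_congr ?_
        filter_upwards [hae] with p hp
        have := mul_pos hp.1 hp.2
        rw [Function.comp_apply, hexp _ (by positivity),
          show 27 * (p.1 * p.2) = 3 ^ 2 * (3 * (p.1 * p.2)) by ring, Real.sqrt_mul (by norm_num),
          Real.sqrt_sq (by norm_num)]

theorem map_inv_measureWithDensityOnPos {f : ℝ → ℝ} (hf : Measurable f)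
    {c : ℝ} (hc : 0 < c) :
    (measureWithDensityOnPos f).map (fun r => (c * r)⁻¹) =
      measureWithDensityOnPos fun y => f (c * y)⁻¹ / (c * y ^ 2) := by
  refine Measure.ext_of_lintegral _ fun g hg => ?_
  rw [lintegral_map hg (by fun_prop), lintegral_measureWithDensityOnPos hf (by fun_prop),
    lintegral_measureWithDensityOnPos (by fun_prop) hg, ← lintegral_mulHaar_inv,
    ← lintegral_mulHaar_mul_left _ hc]
  refine lintegral_mulHaar_congr fun y hy => ?_
  congr 2
  · field_simp
  · field_simp

/-- `√Z` is distributed as `(3 √3 R)⁻¹` with `R = √(γ_{1/3} γ_{2/3})`. Its density arises from that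
of `R` by inversion, dilation and multiplication by a power, and `|1/3 - 2/3| ≤ 1/2`. -/
theorem hasHCMDensity_map_sqrt_of_stable_third {μ : Measure ℝ}
    (hμ : IsPositiveStableLaw (1 / 3) μ) : HasHCMDensity (μ.map fun z => √z) := by
  have h13 : (0 : ℝ) < 1 / 3 := by norm_num
  have h23 : (0 : ℝ) < 2 / 3 := by norm_num
  have hm := measurable_sqrtGammaDensity (1 / 3) (2 / 3)
  have hc : 0 < 3 * √3 := by positivity
  have hts : |(1 / 3 : ℝ) - 2 / 3| ≤ 1 / 2 := by norm_num [abs_of_neg]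
  obtain ⟨K⟩ := nonempty_hypMixture_sqrtGammaDensity h13 h23 hts
  refine ⟨fun y => sqrtGammaDensity (1 / 3) (2 / 3) (3 * √3 * y)⁻¹ / (3 * √3 * y ^ 2),
    by fun_prop, ?_, ?_⟩
  · refine (((K.invert.dilate hc).mul (HypMixture.rpow (-2))).constMul
      (ENNReal.ofReal (3 * √3)⁻¹)).congr (g := fun y => ENNReal.ofReal
        (sqrtGammaDensity (1 / 3) (2 / 3) (3 * √3 * y)⁻¹ / (3 * √3 * y ^ 2)))
        (fun y hy => ?_) |>.isHCM fun y hy => ?_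
    · have := sqrtGammaDensity_pos h13 h23 (show 0 < (3 * √3 * y)⁻¹ by positivity)
      rw [← ENNReal.ofReal_mul (by positivity), ← ENNReal.ofReal_mul (by positivity),
        Real.rpow_neg hy.le, Real.rpow_two]
      congr 1
      field_simp
    · have := sqrtGammaDensity_pos h13 h23 (show 0 < (3 * √3 * y)⁻¹ by positivity)
      positivity
  · rw [← map_inv_measureWithDensityOnPos hm hc, ← map_sqrt_gamma_prod h13 h23,
      Measure.map_map (by fun_prop) (by fun_prop)]
    have h := congrArg (Measure.map fun x : ℝ => x⁻¹) (map_inv_sqrt_of_stable_third hμ)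
    rw [Measure.map_map (by fun_prop) (by fun_prop),
      Measure.map_map (by fun_prop) (by fun_prop)] at h
    convert! h using 2
    · ext z
      simp
    · ext p
      simp only [Function.comp_apply]
      rw [Real.sqrt_mul (by norm_num : (0 : ℝ) ≤ 3), mul_assoc]

/-! ### Laws on `[0, ∞)` through their Laplace transforms. -/

/-- `ν` is a law on `[0, ∞)` with Laplace transform `φ`. -/
structure HasLaplaceTransform (ν : Measure ℝ) (φ : ℝ → ℝ) : Prop where
  isProbabilityMeasure : IsProbabilityMeasure ν
  ae_nonneg : ∀ᵐ x ∂ν, 0 ≤ x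
  integral_exp : ∀ z : ℝ, 0 ≤ z → ∫ x, Real.exp (-(z * x)) ∂ν = φ z

namespace HasLaplaceTransform

variable {μ ν : Measure ℝ} {φ ψ : ℝ → ℝ}

theorem integrable (h : HasLaplaceTransform ν φ) {z : ℝ} (hz : 0 ≤ z) :
    Integrable (fun x => Real.exp (-(z * x))) ν := by
  have := h.isProbabilityMeasure
  refine (integrable_const (1 : ℝ)).mono' (by fun_prop) ?_
  filter_upwards [h.ae_nonneg] with x hx
  rw [Real.norm_of_nonneg (Real.exp_pos _).le]
  exact Real.exp_le_one_iff.2 (by nlinarith)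

theorem congr (h : HasLaplaceTransform ν φ) (hφ : ∀ z, 0 ≤ z → φ z = ψ z) :
    HasLaplaceTransform ν ψ :=
  ⟨h.1, h.2, fun z hz => (h.3 z hz).trans (hφ z hz)⟩

theorem dirac {c : ℝ} (hc : 0 ≤ c) :
    HasLaplaceTransform (Measure.dirac c) fun z => Real.exp (-(z * c)) :=
  ⟨inferInstance, by rw [ae_dirac_eq]; exact hc, fun z _ => by simp⟩

theorem conv (hμ : HasLaplaceTransform μ φ) (hν : HasLaplaceTransform ν ψ) :
    HasLaplaceTransform (Measure.conv μ ν) fun z => φ z * ψ z := by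
  have := hμ.isProbabilityMeasure
  have := hν.isProbabilityMeasure
  refine ⟨inferInstance, ?_, fun z hz => ?_⟩
  · rw [Measure.conv, ae_map_iff (by fun_prop) measurableSet_Ici]
    filter_upwards [Measure.quasiMeasurePreserving_fst.ae hμ.ae_nonneg,
      Measure.quasiMeasurePreserving_snd.ae hν.ae_nonneg] with p h1 h2
    exact add_nonneg h1 h2
  · rw [Measure.conv, integral_map (by fun_prop) (by fun_prop)]
    simp_rw [mul_add, neg_add, Real.exp_add]
    rw [integral_prod_mul (fun x => Real.exp (-(z * x))) (fun x => Real.exp (-(z * x))),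
      hμ.integral_exp z hz, hν.integral_exp z hz]

theorem convPower (hν : HasLaplaceTransform ν φ) (n : ℕ) :
    HasLaplaceTransform (convPower ν n) fun z => φ z ^ n := by
  induction n with
  | zero => exact (dirac le_rfl).congr fun z _ => by simp
  | succ n ih => exact (ih.conv hν).congr fun z _ => by rw [pow_succ]

theorem unique (hμ : HasLaplaceTransform μ φ) (hν : HasLaplaceTransform ν φ) : μ = ν := by
  have := hμ.isProbabilityMeasure
  have := hν.isProbabilityMeasure
  exact measure_eq_of_laplace_eq hμ.ae_nonneg hν.ae_nonneg fun t ht => by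
    rw [hμ.integral_exp t ht.le, hν.integral_exp t ht.le]

theorem gamma {a b : ℝ} (ha : 0 < a) (hb : 0 < b) :
    HasLaplaceTransform ((gammaMeasure a 1).map fun x => b * x)
      fun z => (1 + b * z) ^ (-a) := by
  have := isProbabilityMeasure_gammaMeasure ha one_pos
  have hG := Real.Gamma_pos_of_pos ha
  refine ⟨Measure.isProbabilityMeasure_map (by fun_prop), ?_, fun z hz => ?_⟩
  · rw [ae_map_iff (by fun_prop) measurableSet_Ici]
    filter_upwards [ae_gammaMeasure_pos ha] with x hx
    positivity
  · rw [integral_map (by fun_prop) (by fun_prop), integral_eq_lintegral_of_nonneg_ae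
      (Eventually.of_forall fun x => (Real.exp_pos _).le) (by fun_prop),
      lintegral_gammaMeasure ha (by fun_prop)]
    have h := HypMixture.lintegral_gamma_mixture ha (show 0 < 1 + b * z by positivity)
    have h2 : ∫⁻ x, ENNReal.ofReal (x ^ a * Real.exp (-x) / Real.Gamma a) *
        ENNReal.ofReal (Real.exp (-(z * (b * x)))) ∂mulHaar =
        ENNReal.ofReal ((1 + b * z) ^ (-a)) := by
      rw [← h]
      refine lintegral_mulHaar_congr fun x hx => ?_
      rw [← ENNReal.ofReal_mul (by positivity), show -((1 + b * z) * x) = -x + -(z * (b * x)) by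
        ring, Real.exp_add]
      congr 1
      ring
    rw [h2, ENNReal.toReal_ofReal (by positivity)]

/-- Markov's inequality for `(1 - exp (-x / r)) / (1 - e⁻¹)`, which is at least 1 when `x > r`. It
bounds tails by the transform near 0, hence yields tightness. -/
theorem measure_norm_gt_le (h : HasLaplaceTransform ν φ) {r : ℝ} (hr : 0 < r) :
    ν {x | r < ‖x‖} ≤ ENNReal.ofReal ((1 - φ r⁻¹) / (1 - Real.exp (-1))) := by
  have := h.isProbabilityMeasure
  have he : 0 < 1 - Real.exp (-1) := by
    have := Real.exp_lt_exp.2 (show (-1 : ℝ) < 0 by norm_num)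
    rw [Real.exp_zero] at this
    linarith
  have hr' : 0 ≤ r⁻¹ := by positivity
  have hint : Integrable (fun x => (1 - Real.exp (-(r⁻¹ * x))) / (1 - Real.exp (-1))) ν :=
    ((integrable_const 1).sub (h.integrable hr')).div_const _
  have hnn : 0 ≤ᵐ[ν] fun x => (1 - Real.exp (-(r⁻¹ * x))) / (1 - Real.exp (-1)) := by
    filter_upwards [h.ae_nonneg] with x hx
    refine div_nonneg ?_ he.le
    have := Real.exp_le_one_iff.2 (neg_nonpos.2 (mul_nonneg hr' hx))
    linarith
  rw [← h.integral_exp _ hr']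
  have e : (1 - ∫ x, Real.exp (-(r⁻¹ * x)) ∂ν) / (1 - Real.exp (-1)) =
      ∫ x, (1 - Real.exp (-(r⁻¹ * x))) / (1 - Real.exp (-1)) ∂ν := by
    rw [integral_div, integral_sub (integrable_const 1) (h.integrable hr')]
    simp
  have hms : MeasurableSet {x : ℝ | r < ‖x‖} := measurableSet_lt measurable_const (by fun_prop)
  rw [e, ofReal_integral_eq_lintegral_ofReal hint hnn, ← lintegral_indicator_one hms]
  refine lintegral_mono_ae ?_
  filter_upwards [h.ae_nonneg] with x hx
  by_cases hxr : r < ‖x‖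
  · rw [Set.indicator_of_mem (by exact hxr), Pi.one_apply, ← ENNReal.ofReal_one]
    refine ENNReal.ofReal_le_ofReal ?_
    rw [one_le_div he]
    rw [Real.norm_of_nonneg hx] at hxr
    have : Real.exp (-(r⁻¹ * x)) ≤ Real.exp (-1) := by
      refine Real.exp_le_exp.2 (neg_le_neg ?_)
      rw [inv_mul_eq_div, one_le_div hr]
      exact hxr.le
    linarith
  · rw [Set.indicator_of_notMem (by exact hxr)]
    exact zero_le

/-- The continuity theorem for Laplace transforms. -/
theorem exists_of_tendsto {ν : ℕ → Measure ℝ} {φ : ℕ → ℝ → ℝ} {ψ : ℝ → ℝ}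
    (h : ∀ n, HasLaplaceTransform (ν n) (φ n))
    (hlim : ∀ z, 0 ≤ z → Tendsto (fun n => φ n z) atTop (𝓝 (ψ z)))
    (hψ : ContinuousWithinAt ψ (Set.Ici 0) 0) (hψ0 : ψ 0 = 1) :
    ∃ μ, HasLaplaceTransform μ ψ := by
  have hprob := fun n => (h n).isProbabilityMeasure
  have htight : IsTightMeasureSet (Set.range ν) := by
    refine isTightMeasureSet_range_of_tendsto_limsup_measure_norm_gt ?_
    have hr : Tendsto (fun r : ℝ => r⁻¹) atTop (𝓝[≥] 0) :=
      tendsto_inv_atTop_nhdsGT_zero.mono_right (nhdsWithin_mono _ Set.Ioi_subset_Ici_self)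
    have h1 : Tendsto (fun r : ℝ => ENNReal.ofReal ((1 - ψ r⁻¹) / (1 - Real.exp (-1)))) atTop
        (𝓝 0) := by
      have h2 : Tendsto (fun r : ℝ => (1 - ψ r⁻¹) / (1 - Real.exp (-1))) atTop
          (𝓝 ((1 - ψ 0) / (1 - Real.exp (-1)))) :=
        ((hψ.tendsto.comp hr).const_sub 1).div_const _
      rw [hψ0, sub_self, zero_div] at h2
      simpa using ENNReal.tendsto_ofReal h2
    refine tendsto_of_tendsto_of_tendsto_of_le_of_le' tendsto_const_nhds h1
      (Eventually.of_forall fun _ => zero_le) ?_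
    filter_upwards [eventually_gt_atTop 0] with r hr
    have h3 : Tendsto (fun n => ENNReal.ofReal ((1 - φ n r⁻¹) / (1 - Real.exp (-1)))) atTop
        (𝓝 (ENNReal.ofReal ((1 - ψ r⁻¹) / (1 - Real.exp (-1))))) :=
      ENNReal.tendsto_ofReal (((hlim _ (by positivity)).const_sub 1).div_const _)
    rw [← h3.limsup_eq]
    exact limsup_le_limsup (Eventually.of_forall fun n => (h n).measure_norm_gt_le hr)
  let νp : ℕ → ProbabilityMeasure ℝ := fun n => ⟨ν n, hprob n⟩
  have hcomp : IsCompact (closure (Set.range νp)) := by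
    refine isCompact_closure_of_isTightMeasureSet (htight.subset ?_)
    rintro _ ⟨_, ⟨n, rfl⟩, rfl⟩
    exact ⟨n, rfl⟩
  -- By Prokhorov the sequence converges along any ultrafilter. The hyperfilter refines `atTop`, so
  -- it sees the pointwise limits of the transforms.
  obtain ⟨μ, -, hμ⟩ := hcomp.ultrafilter_le_nhds ((hyperfilter ℕ).map νp) (by
    refine le_principal_iff.2 (Ultrafilter.mem_map.2 ?_)
    exact univ_mem' fun n => subset_closure ⟨n, rfl⟩)
  have hμ' : Tendsto νp (hyperfilter ℕ : Filter ℕ) (𝓝 μ) := hμ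
  rw [ProbabilityMeasure.tendsto_iff_forall_integral_tendsto] at hμ'
  have hU : (hyperfilter ℕ : Filter ℕ) ≤ atTop := Nat.hyperfilter_le_atTop
  have hnn : ∀ᵐ x ∂(μ : Measure ℝ), 0 ≤ x := by
    -- A bounded continuous test function that is positive exactly on the negative half-line, so
    -- that a zero integral excludes negative mass.
    let f : BoundedContinuousFunction ℝ ℝ := BoundedContinuousFunction.ofNormedAddCommGroup
      (fun x : ℝ => min 1 (max (-x) 0)) (by fun_prop) 1 (fun x => by
        rw [Real.norm_of_nonneg (le_min zero_le_one (le_max_right _ _))]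
        exact min_le_left _ _)
    have hf : ∀ n, ∫ x, f x ∂(νp n : Measure ℝ) = 0 := fun n => by
      refine integral_eq_zero_of_ae ?_
      filter_upwards [(h n).ae_nonneg] with x hx
      simp [f, hx]
    have h1 : ∫ x, f x ∂(μ : Measure ℝ) = 0 := by
      refine tendsto_nhds_unique (hμ' f) ?_
      simp only [hf]
      exact tendsto_const_nhds
    have hf0 : (0 : ℝ → ℝ) ≤ fun x => f x := fun x => le_min zero_le_one (le_max_right (-x) 0)
    filter_upwards [(integral_eq_zero_iff_of_nonneg hf0 (f.integrable _)).1 h1] with x hx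
    by_contra hneg
    have : 0 < f x := lt_min one_pos (lt_max_of_lt_left (by linarith))
    exact this.ne' hx
  refine ⟨μ, inferInstance, hnn, fun z hz => ?_⟩
  let f : BoundedContinuousFunction ℝ ℝ := BoundedContinuousFunction.ofNormedAddCommGroup
    (fun x : ℝ => Real.exp (-(z * max x 0))) (by fun_prop) 1 (fun x => by
      rw [Real.norm_of_nonneg (Real.exp_pos _).le]
      exact Real.exp_le_one_iff.2 (neg_nonpos.2 (mul_nonneg hz (le_max_right _ _))))
  have hf : ∀ ρ : Measure ℝ, (∀ᵐ x ∂ρ, 0 ≤ x) →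
      ∫ x, Real.exp (-(z * x)) ∂ρ = ∫ x, f x ∂ρ := fun ρ hρ => by
    refine integral_congr_ae ?_
    filter_upwards [hρ] with x hx
    simp [f, hx]
  rw [hf _ hnn]
  refine tendsto_nhds_unique (hμ' f) (((hlim z hz).mono_left hU).congr fun n => ?_)
  rw [← (h n).integral_exp z hz, hf _ (h n).ae_nonneg]
  rfl

end HasLaplaceTransform

/-! ### Laplace exponents as a convex cone closed under limits and integrals. -/

/-- `S` is the Laplace exponent of an infinitely divisible law on `[0, ∞)`. -/
def IsLaplaceExponent (S : ℝ → ℝ) : Prop :=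
  ∀ a : ℝ, 0 < a → ∃ ν, HasLaplaceTransform ν fun z => Real.exp (-(a * S z))

namespace IsLaplaceExponent

variable {S T : ℝ → ℝ}

theorem congr (hS : IsLaplaceExponent S) (h : ∀ z, 0 ≤ z → S z = T z) : IsLaplaceExponent T :=
  fun a ha => (hS a ha).imp fun _ hν => hν.congr fun z hz => by rw [h z hz]

theorem zero : IsLaplaceExponent fun _ => 0 :=
  fun _ _ => ⟨_, (HasLaplaceTransform.dirac le_rfl).congr fun z _ => by simp⟩

theorem mul_const {c : ℝ} (hc : 0 ≤ c) : IsLaplaceExponent fun z => z * c := fun a ha =>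
  ⟨_, (HasLaplaceTransform.dirac (mul_nonneg ha.le hc)).congr fun z _ => by ring_nf⟩

theorem log_one_add {b : ℝ} (hb : 0 < b) : IsLaplaceExponent fun z => Real.log (1 + b * z) :=
  fun a ha => ⟨_, (HasLaplaceTransform.gamma ha hb).congr fun z hz => by
    rw [Real.rpow_def_of_pos (by positivity)]
    ring_nf⟩

theorem add (hS : IsLaplaceExponent S) (hT : IsLaplaceExponent T) :
    IsLaplaceExponent fun z => S z + T z := by
  intro a ha
  obtain ⟨μ, hμ⟩ := hS a ha
  obtain ⟨ν, hν⟩ := hT a ha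
  exact ⟨_, (hμ.conv hν).congr fun z _ => by rw [← Real.exp_add]; ring_nf⟩

theorem const_mul (hS : IsLaplaceExponent S) {c : ℝ} (hc : 0 ≤ c) :
    IsLaplaceExponent fun z => c * S z := by
  rcases hc.eq_or_lt with rfl | hc
  · exact zero.congr fun z _ => by simp
  · intro a ha
    obtain ⟨ν, hν⟩ := hS (a * c) (mul_pos ha hc)
    exact ⟨ν, hν.congr fun z _ => by rw [mul_assoc]⟩

theorem sum {ι : Type*} {F : ι → ℝ → ℝ} (s : Finset ι) (hF : ∀ i ∈ s, IsLaplaceExponent (F i)) :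
    IsLaplaceExponent fun z => ∑ i ∈ s, F i z := by
  classical
  induction s using Finset.induction_on with
  | empty => simpa using zero
  | insert i s hi ih =>
    simp_rw [Finset.sum_insert hi]
    exact (hF i (Finset.mem_insert_self i s)).add
      (ih fun j hj => hF j (Finset.mem_insert_of_mem hj))

theorem of_tendsto {F : ℕ → ℝ → ℝ} (hF : ∀ n, IsLaplaceExponent (F n))
    (hlim : ∀ z, 0 ≤ z → Tendsto (fun n => F n z) atTop (𝓝 (S z)))
    (hS : ContinuousWithinAt S (Set.Ici 0) 0) (hS0 : S 0 = 0) : IsLaplaceExponent S := by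
  intro a ha
  choose ν hν using fun n => hF n a ha
  refine HasLaplaceTransform.exists_of_tendsto hν (fun z hz => ?_) ?_ (by simp [hS0])
  · exact (Real.continuous_exp.tendsto _).comp ((hlim z hz).const_mul a).neg
  · exact Real.continuous_exp.continuousAt.comp_continuousWithinAt
      (continuousWithinAt_const.mul hS).neg

end IsLaplaceExponent

theorem tendsto_riemannSum {f : ℝ → ℝ} {b : ℝ} (hb : 0 < b) (hf : ContinuousOn f (Set.Icc 0 b)) :
    Tendsto (fun n : ℕ => ∑ j ∈ Finset.range (n + 1), b / (n + 1) * f (b / (n + 1) * j)) atTop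
      (𝓝 (∫ x in 0..b, f x)) := by
  rw [Metric.tendsto_atTop]
  intro ε hε
  have huc := isCompact_Icc.uniformContinuousOn_of_continuous hf
  rw [Metric.uniformContinuousOn_iff] at huc
  obtain ⟨δ, hδ, h⟩ := huc (ε / (2 * b)) (by positivity)
  obtain ⟨N, hN⟩ := exists_nat_gt (b / δ)
  refine ⟨N, fun n hn => ?_⟩
  have hn1 : (0 : ℝ) < n + 1 := by positivity
  set d : ℝ := b / (n + 1) with hd
  have hd0 : 0 < d := by positivity
  have hdδ : d < δ := by
    rw [hd, div_lt_comm₀ hn1 hδ]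
    have : (N : ℝ) ≤ n := by exact_mod_cast hn
    linarith
  have hdb : d * (n + 1 : ℕ) = b := by rw [hd]; push_cast; field_simp
  have hmem : ∀ j < n + 1, ∀ x ∈ Set.Icc (d * j) (d * (j + 1 : ℕ)), x ∈ Set.Icc 0 b := by
    intro j hj x hx
    have h1 : d * (j + 1 : ℕ) ≤ d * (n + 1 : ℕ) :=
      mul_le_mul_of_nonneg_left (by exact_mod_cast hj) hd0.le
    exact ⟨le_trans (by positivity) hx.1, by linarith [hx.2]⟩
  have hle : ∀ j : ℕ, d * j ≤ d * (j + 1 : ℕ) := fun j =>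
    mul_le_mul_of_nonneg_left (by push_cast; linarith) hd0.le
  have hii : ∀ j < n + 1, IntervalIntegrable f volume (d * j) (d * (j + 1 : ℕ)) := fun j hj =>
    (hf.mono fun x hx => hmem j hj x (Set.uIcc_of_le (hle j) ▸ hx)).intervalIntegrable
  have hsum := intervalIntegral.sum_integral_adjacent_intervals (a := fun j : ℕ => d * j) hii
  simp only [Nat.cast_zero, mul_zero] at hsum
  rw [hdb] at hsum
  rw [← hsum, Real.dist_eq, ← Finset.sum_sub_distrib]
  have hterm : ∀ j ∈ Finset.range (n + 1),
      |d * f (d * j) - ∫ x in (d * j)..(d * (j + 1 : ℕ)), f x| ≤ ε / (2 * b) * d := by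
    intro j hj
    have hj' := Finset.mem_range.1 hj
    have e : d * f (d * j) = ∫ _ in (d * j)..(d * (j + 1 : ℕ)), f (d * j) := by
      rw [intervalIntegral.integral_const, smul_eq_mul]
      push_cast
      ring
    rw [e, ← intervalIntegral.integral_sub (by simp) (hii j hj')]
    have h2 := intervalIntegral.norm_integral_le_of_norm_le_const (C := ε / (2 * b))
      (f := fun x => f (d * j) - f x) (a := d * j) (b := d * (j + 1 : ℕ)) (fun x hx => ?_)
    · refine h2.trans_eq ?_
      rw [abs_of_nonneg (sub_nonneg.2 (hle j))]
      push_cast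
      ring
    · rw [Set.uIoc_of_le (hle j)] at hx
      refine le_of_lt (h _ (hmem j hj' _ ⟨le_rfl, hle j⟩) _ (hmem j hj' _ ⟨hx.1.le, hx.2⟩) ?_)
      rw [Real.dist_eq, abs_sub_comm, abs_of_pos (sub_pos.2 hx.1)]
      have := hx.2
      push_cast at this
      linarith
  calc _ ≤ ∑ j ∈ Finset.range (n + 1),
        |d * f (d * j) - ∫ x in (d * j)..(d * (j + 1 : ℕ)), f x| := Finset.abs_sum_le_sum_abs _ _
    _ ≤ ∑ _ ∈ Finset.range (n + 1), ε / (2 * b) * d := Finset.sum_le_sum hterm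
    _ = ε / 2 := by
        rw [Finset.sum_const, Finset.card_range, nsmul_eq_mul, mul_left_comm, mul_comm _ d, hdb]
        field_simp
    _ < ε := by linarith

/-- Riemann sums are nonnegative combinations of exponents, and the continuity theorem passes to
their limit. -/
theorem IsLaplaceExponent.intervalIntegral {F : ℝ → ℝ → ℝ} {b : ℝ} (hb : 0 < b)
    (hF : ∀ x, IsLaplaceExponent (F x))
    (hcont : ∀ z, 0 ≤ z → ContinuousOn (fun x => F x z) (Set.Icc 0 b))
    (h0 : ContinuousWithinAt (fun z => ∫ x in 0..b, F x z) (Set.Ici 0) 0)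
    (h00 : ∫ x in 0..b, F x 0 = 0) :
    IsLaplaceExponent fun z => ∫ x in 0..b, F x z :=
  of_tendsto (F := fun n z => ∑ j ∈ Finset.range (n + 1), b / (n + 1) * F (b / (n + 1) * j) z)
    (fun n => sum _ fun j _ => (hF _).const_mul (by positivity))
    (fun z hz => tendsto_riemannSum hb (hcont z hz)) h0 h00

/-! ### Pick functions, by the Poisson formula on smaller disks. -/

theorem sphere_sub_ofReal_ne_zero {R a : ℝ} (ha : |a| < R) {z : ℂ} (hz : z ∈ Metric.sphere 0 R) :
    z - a ≠ 0 := by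
  intro h
  rw [sub_eq_zero] at h
  rw [mem_sphere_zero_iff_norm, h, Complex.norm_real, Real.norm_eq_abs] at hz
  exact ha.ne hz

/-- The Poisson integral formula on the real diameter of a disk, in terms of the imaginary part. -/
theorem DiffContOnCl.re_sub_re_eq_integral {f : ℂ → ℂ} {R a : ℝ} (ha : |a| < R)
    (hf : DiffContOnCl ℂ f (Metric.ball 0 R)) :
    (f a).re - (f 0).re = (2 * Real.pi)⁻¹ * ∫ θ in 0..2 * Real.pi,
      2 * a * (R * Real.sin θ) * (f (circleMap 0 R θ)).im /
        (R ^ 2 - 2 * a * R * Real.cos θ + a ^ 2) := by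
  have hR : 0 < R := (abs_nonneg a).trans_lt ha
  have hR' : |R| = R := abs_of_pos hR
  have hw : (a : ℂ) ∈ Metric.ball (0 : ℂ) R := by simpa using ha
  have hcf : ContinuousOn f (Metric.sphere 0 |R|) := by
    rw [hR']
    refine hf.continuousOn.mono ?_
    rw [closure_ball _ hR.ne']
    exact Metric.sphere_subset_closedBall
  have hne : ∀ z ∈ Metric.sphere (0 : ℂ) |R|, z - a ≠ 0 := fun z hz =>
    sphere_sub_ofReal_ne_zero ha (hR' ▸ hz)
  have hfR : DiffContOnCl ℂ f (Metric.ball 0 |R|) := by rwa [hR']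
  have h1 := hfR.circleAverage_smul_div (w := (a : ℂ)) (by rwa [hR'])
  have h2 := hfR.circleAverage
  have h3 := hf.circleAverage_re_herglotzRieszKernel_smul' hw
  simp only [sub_zero] at h1 h3
  have c0 : ContinuousOn (fun z : ℂ => z / (z - a)) (Metric.sphere 0 |R|) := by
    fun_prop (disch := assumption)
  have ck : ContinuousOn (fun z : ℂ => (z + a) / (z - a)) (Metric.sphere 0 |R|) := by
    fun_prop (disch := assumption)
  have i1 : CircleIntegrable (fun z => (z / (z - a)) • f z) 0 R := (c0.smul hcf).circleIntegrable'
  have i2 : CircleIntegrable f 0 R := hcf.circleIntegrable'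
  have i3 : CircleIntegrable (fun z => ((z + a) / (z - a)).re • f z) 0 R :=
    ((Complex.continuous_re.comp_continuousOn ck).smul hcf).circleIntegrable'
  have iJ : CircleIntegrable (fun z => (Complex.I * (((z + a) / (z - a)).im : ℂ)) • f z) 0 R :=
    ((continuousOn_const.mul (Complex.continuous_ofReal.comp_continuousOn
      (Complex.continuous_im.comp_continuousOn ck))).smul hcf).circleIntegrable'
  -- Averaged against `f`, the full kernel `2 z / (z - a) - 1` gives `2 f(a) - f(0)` and its real
  -- part gives `f(a)`. Hence `i` times its imaginary part gives `f(a) - f(0)`, and taking real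
  -- parts leaves only `Im f` under the integral.
  have hJ : Real.circleAverage (fun z => (Complex.I * (((z + a) / (z - a)).im : ℂ)) • f z) 0 R =
      f a - f 0 := by
    have e : Real.circleAverage (fun z => (Complex.I * (((z + a) / (z - a)).im : ℂ)) • f z) 0 R =
        Real.circleAverage (fun z => ((z / (z - a)) • f z + ((z / (z - a)) • f z - f z)) -
          ((z + a) / (z - a)).re • f z) 0 R := by
      refine Real.circleAverage_congr_sphere fun z hz => ?_
      have e1 : (z + a) / (z - a) = z / (z - a) + (z / (z - a) - 1) := by
        field_simp [hne z hz]
        ring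
      have e2 := Complex.re_add_im ((z + a) / (z - a))
      simp only [smul_eq_mul, Complex.real_smul]
      linear_combination f z * (e2 + e1)
    have i4 : CircleIntegrable (fun z => (z / (z - a)) • f z - f z) 0 R := i1.sub i2
    have i5 : CircleIntegrable (fun z => (z / (z - a)) • f z + ((z / (z - a)) • f z - f z)) 0 R :=
      i1.add i4
    rw [e, Real.circleAverage_fun_sub i5 i3, Real.circleAverage_fun_add i1 i4, Real.circleAverage_fun_sub i1 i2, h1, h2, h3]
    ring
  have hre := Complex.reCLM.circleAverage_comp_comm iJ
  rw [hJ] at hre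
  rw [← Complex.sub_re, ← Complex.reCLM_apply, ← hre, Real.circleAverage_def, smul_eq_mul]
  congr 1
  refine intervalIntegral.integral_congr fun θ _ => ?_
  have hz : circleMap 0 R θ ∈ Metric.sphere (0 : ℂ) |R| := circleMap_mem_sphere' 0 R θ
  have hz0 := hne _ hz
  have hre : (circleMap 0 R θ).re = R * Real.cos θ := by simp [circleMap, Complex.exp_ofReal_mul_I_re]
  have him : (circleMap 0 R θ).im = R * Real.sin θ := by simp [circleMap, Complex.exp_ofReal_mul_I_im]
  have hN : Complex.normSq (circleMap 0 R θ - a) = R ^ 2 - 2 * a * R * Real.cos θ + a ^ 2 := by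
    rw [Complex.normSq_apply, Complex.sub_re, Complex.sub_im, hre, him]
    simp only [Complex.ofReal_re, Complex.ofReal_im]
    linear_combination R ^ 2 * Real.sin_sq_add_cos_sq θ
  have hN0 : R ^ 2 - 2 * a * R * Real.cos θ + a ^ 2 ≠ 0 := by
    rw [← hN]
    exact (Complex.normSq_pos.2 hz0).ne'
  simp only [Function.comp_apply, Complex.reCLM_apply, smul_eq_mul, mul_assoc, Complex.I_mul_re,
    Complex.im_ofReal_mul]
  rw [Complex.div_im, hN]
  simp only [Complex.add_re, Complex.add_im, Complex.sub_re, Complex.sub_im, hre, him,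
    Complex.ofReal_re, Complex.ofReal_im]
  field_simp
  ring

/-- The square of the Cayley transform of the unit disk onto the right half-plane. -/
noncomputable def sqCayley (w : ℂ) : ℂ := ((1 + w) / (1 - w)) ^ 2

theorem one_sub_ne_zero_of_norm_lt {w : ℂ} (hw : ‖w‖ < 1) : 1 - w ≠ 0 := by
  intro h
  rw [sub_eq_zero] at h
  rw [← h, norm_one] at hw
  exact lt_irrefl _ hw

/-- `(1 + w) / (1 - w)` has positive real part, so its square avoids the cut and its imaginary part
has the sign of `Im w`. The sign condition on a Pick function thus transfers to the disk. -/
theorem exists_sqCayley_im {w : ℂ} (hw : ‖w‖ < 1) : ∃ c : ℝ, 0 < c ∧ (sqCayley w).im = c * w.im ∧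
    sqCayley w ∈ Complex.slitPlane := by
  have h0 := one_sub_ne_zero_of_norm_lt hw
  have hN := Complex.normSq_pos.2 h0
  have hw2 : w.re ^ 2 + w.im ^ 2 < 1 := by
    have := Complex.sq_norm w
    rw [Complex.normSq_apply] at this
    nlinarith [norm_nonneg w]
  have hre : ((1 + w) / (1 - w)).re = (1 - (w.re ^ 2 + w.im ^ 2)) / Complex.normSq (1 - w) := by
    rw [Complex.div_re]
    simp only [Complex.add_re, Complex.sub_re, Complex.add_im, Complex.sub_im, Complex.one_re,
      Complex.one_im]
    field_simp
    ring
  have him : ((1 + w) / (1 - w)).im = 2 / Complex.normSq (1 - w) * w.im := by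
    rw [Complex.div_im]
    simp only [Complex.add_re, Complex.sub_re, Complex.add_im, Complex.sub_im, Complex.one_re,
      Complex.one_im]
    field_simp
    ring
  have hrep : 0 < ((1 + w) / (1 - w)).re := by
    rw [hre]
    exact div_pos (by linarith) hN
  have hsq : (sqCayley w).im = 2 * ((1 + w) / (1 - w)).re * ((1 + w) / (1 - w)).im := by
    rw [sqCayley, sq, Complex.mul_im]
    ring
  refine ⟨2 * ((1 + w) / (1 - w)).re * (2 / Complex.normSq (1 - w)), by positivity, ?_, ?_⟩
  · rw [hsq, him]
    ring
  · rw [Complex.mem_slitPlane_iff, or_iff_not_imp_right, not_not, hsq]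
    intro h
    have h1 : ((1 + w) / (1 - w)).im = 0 := by
      rcases mul_eq_zero.1 h with h | h
      · exact absurd h (by positivity)
      · exact h
    rw [sqCayley, sq, Complex.mul_re, h1]
    nlinarith

theorem differentiableOn_sqCayley : DifferentiableOn ℂ sqCayley (Metric.ball 0 1) := by
  intro w hw
  have := one_sub_ne_zero_of_norm_lt (mem_ball_zero_iff.1 hw)
  unfold sqCayley
  fun_prop (disch := assumption)

/-- The image of `ζ` under the dilation by `r` in the disk coordinate. -/
noncomputable def shrink (r ζ : ℝ) : ℝ :=
  ((1 + r * ((√ζ - 1) / (√ζ + 1))) / (1 - r * ((√ζ - 1) / (√ζ + 1)))) ^ 2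

/-- `(√ζ - 1) / (√ζ + 1)` is the point of the disk that `sqCayley` sends to `ζ`. -/
theorem abs_sqrt_sub_div_lt {ζ : ℝ} (hζ : 0 < ζ) : |(√ζ - 1) / (√ζ + 1)| < 1 := by
  have h := Real.sqrt_pos.2 hζ
  rw [abs_div, abs_of_pos (by linarith : 0 < √ζ + 1), div_lt_one (by linarith), abs_lt]
  constructor <;> linarith

theorem shrink_pos {r ζ : ℝ} (hr : r ∈ Set.Icc (0 : ℝ) 1) (hζ : 0 < ζ) : 0 < shrink r ζ := by
  have h := abs_lt.1 (abs_sqrt_sub_div_lt hζ)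
  rw [shrink]
  have h1 : 0 < 1 + r * ((√ζ - 1) / (√ζ + 1)) := by nlinarith [hr.1, hr.2]
  have h2 : 0 < 1 - r * ((√ζ - 1) / (√ζ + 1)) := by nlinarith [hr.1, hr.2]
  positivity

theorem shrink_one {ζ : ℝ} (hζ : 0 < ζ) : shrink 1 ζ = ζ := by
  have h := Real.sqrt_pos.2 hζ
  have e : (1 + 1 * ((√ζ - 1) / (√ζ + 1))) / (1 - 1 * ((√ζ - 1) / (√ζ + 1))) = √ζ := by
    have : √ζ + 1 ≠ 0 := by positivity
    have h2 : 1 - 1 * ((√ζ - 1) / (√ζ + 1)) ≠ 0 := by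
      rw [one_mul, one_sub_div this]
      exact div_ne_zero (by ring_nf; norm_num) this
    rw [div_eq_iff h2]
    field_simp
    ring
  rw [shrink, e, Real.sq_sqrt hζ.le]

theorem continuousOn_shrink_left {ζ : ℝ} (hζ : 0 < ζ) :
    ContinuousOn (fun r => shrink r ζ) (Set.Icc 0 1) := by
  intro r hr
  have h := abs_lt.1 (abs_sqrt_sub_div_lt hζ)
  have h1 : 1 - r * ((√ζ - 1) / (√ζ + 1)) ≠ 0 := by nlinarith [hr.1, hr.2]
  refine ContinuousAt.continuousWithinAt ?_
  unfold shrink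
  fun_prop (disch := assumption)

theorem continuousOn_shrink_right {r : ℝ} (hr : r ∈ Set.Icc (0 : ℝ) 1) :
    ContinuousOn (shrink r) (Set.Ioi 0) := by
  intro ζ hζ
  have h := abs_lt.1 (abs_sqrt_sub_div_lt hζ)
  have h1 : 1 - r * ((√ζ - 1) / (√ζ + 1)) ≠ 0 := by nlinarith [hr.1, hr.2]
  have h2 : √ζ + 1 ≠ 0 := by positivity
  refine ContinuousAt.continuousWithinAt ?_
  unfold shrink
  fun_prop (disch := assumption)

theorem shrink_mem_Icc {r ζ : ℝ} (hr : r ∈ Set.Icc (0 : ℝ) 1) (hζ : 1 ≤ ζ) :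
    shrink r ζ ∈ Set.Icc 1 ζ := by
  have hζ0 : 0 < ζ := by linarith
  have h := abs_lt.1 (abs_sqrt_sub_div_lt hζ0)
  have h0 : 0 ≤ (√ζ - 1) / (√ζ + 1) :=
    div_nonneg (by have := Real.one_le_sqrt.2 hζ; linarith) (by positivity)
  constructor
  · rw [shrink]
    refine one_le_pow₀ ?_
    rw [one_le_div (by nlinarith [hr.1, hr.2])]
    nlinarith [hr.1, hr.2, mul_nonneg hr.1 h0]
  · conv_rhs => rw [← shrink_one hζ0]
    rw [shrink, shrink]
    have h1 : 0 < 1 - 1 * ((√ζ - 1) / (√ζ + 1)) := by linarith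
    have h2 : r * ((√ζ - 1) / (√ζ + 1)) ≤ 1 * ((√ζ - 1) / (√ζ + 1)) :=
      mul_le_mul_of_nonneg_right hr.2 h0
    have h3 := mul_nonneg hr.1 h0
    have h4 : 0 ≤ (1 + r * ((√ζ - 1) / (√ζ + 1))) / (1 - r * ((√ζ - 1) / (√ζ + 1))) :=
      div_nonneg (by linarith) (by linarith)
    gcongr

theorem four_add_pos {ζ c : ℝ} (hζ : 0 < ζ) (h1 : -1 ≤ c) (h2 : c ≤ 1) :
    0 < 4 + (2 - 2 * c) * (ζ - 1) := by
  rcases le_total 1 ζ with h | h <;> nlinarith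

/-- A smoothed Nevanlinna representation: the Poisson formula on the circle of radius `r` for `g ∘
sqCayley`. The density contains `sin θ · Im g`, which is nonnegative for a Pick function, and in the
coordinate `ζ` the Poisson kernel becomes a Möbius function. -/
theorem exists_density_re_shrink {g : ℂ → ℂ} (hg : DifferentiableOn ℂ g Complex.slitPlane)
    (him : ∀ z ∈ Complex.slitPlane, 0 ≤ z.im * (g z).im) {r : ℝ} (hr0 : 0 < r) (hr1 : r < 1) :
    ∃ D : ℝ → ℝ, Continuous D ∧ (∀ θ, 0 ≤ D θ) ∧ ∀ ζ : ℝ, 0 < ζ →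
      (g (shrink r ζ)).re = (g 1).re + ∫ θ in 0..2 * Real.pi,
        D θ * ((ζ - 1) / (4 + (2 - 2 * Real.cos θ) * (ζ - 1))) := by
  have hball : Set.MapsTo sqCayley (Metric.ball 0 1) Complex.slitPlane := fun w hw =>
    (exists_sqCayley_im (mem_ball_zero_iff.1 hw)).choose_spec.2.2
  have hP : DifferentiableOn ℂ (fun w => g (sqCayley w)) (Metric.ball 0 1) :=
    hg.comp differentiableOn_sqCayley hball
  have hsub : Metric.closedBall (0 : ℂ) r ⊆ Metric.ball 0 1 :=
    Metric.closedBall_subset_ball hr1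
  have hPr : DiffContOnCl ℂ (fun w => g (sqCayley w)) (Metric.ball 0 r) :=
    (hP.mono (by rwa [closure_ball _ hr0.ne'])).diffContOnCl
  have hcirc : ∀ θ, circleMap 0 r θ ∈ Metric.ball (0 : ℂ) 1 := fun θ =>
    hsub (circleMap_mem_closedBall 0 hr0.le θ)
  refine ⟨fun θ => (2 * Real.pi)⁻¹ * (2 * Real.sin θ * (g (sqCayley (circleMap 0 r θ))).im),
    ?_, fun θ => ?_, fun ζ hζ => ?_⟩
  · have h1 : Continuous fun θ => g (sqCayley (circleMap 0 r θ)) :=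
      hP.continuousOn.comp_continuous (continuous_circleMap 0 r) hcirc
    have h2 : Continuous fun θ => (g (sqCayley (circleMap 0 r θ))).im :=
      Complex.continuous_im.comp h1
    fun_prop
  · obtain ⟨c, hc, h1, h2⟩ := exists_sqCayley_im (mem_ball_zero_iff.1 (hcirc θ))
    have h3 := him _ h2
    have h4 : (circleMap 0 r θ).im = r * Real.sin θ := by
      simp [circleMap, Complex.exp_ofReal_mul_I_im]
    rw [h1, h4] at h3
    have h5 : 0 ≤ (c * r) * (Real.sin θ * (g (sqCayley (circleMap 0 r θ))).im) := by
      linarith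
    have h6 := nonneg_of_mul_nonneg_right h5 (mul_pos hc hr0)
    have := Real.pi_pos
    have : 0 ≤ 2 * Real.sin θ * (g (sqCayley (circleMap 0 r θ))).im := by linarith
    positivity
  · set q := √ζ with hq
    have hq0 : 0 < q := Real.sqrt_pos.2 hζ
    have hqs : ζ = q ^ 2 := (Real.sq_sqrt hζ.le).symm
    have habs := abs_sqrt_sub_div_lt hζ
    rw [← hq] at habs
    have ha : |r * ((q - 1) / (q + 1))| < r := by
      rw [abs_mul, abs_of_pos hr0]
      nlinarith
    have h := hPr.re_sub_re_eq_integral ha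
    have e1 : sqCayley ((r * ((q - 1) / (q + 1)) : ℝ) : ℂ) = (shrink r ζ : ℝ) := by
      rw [sqCayley, shrink, ← hq]
      push_cast
      rfl
    have e0 : sqCayley 0 = 1 := by simp [sqCayley]
    simp only [e1, e0] at h
    rw [← sub_eq_iff_eq_add', h, ← intervalIntegral.integral_const_mul]
    refine intervalIntegral.integral_congr fun θ _ => ?_
    have hden := four_add_pos hζ (Real.neg_one_le_cos θ) (Real.cos_le_one θ)
    have hq1 : q + 1 ≠ 0 := by positivity
    have hd2 : r ^ 2 - 2 * (r * ((q - 1) / (q + 1))) * r * Real.cos θ +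
        (r * ((q - 1) / (q + 1))) ^ 2 =
        r ^ 2 * (4 + (2 - 2 * Real.cos θ) * (ζ - 1)) / (q + 1) ^ 2 := by
      rw [hqs]
      field_simp
      ring
    simp only
    rw [hd2, mul_assoc (2 * Real.pi)⁻¹]
    congr 1
    have e2 : (ζ - 1) = (q - 1) * (q + 1) := by rw [hqs]; ring
    generalize 4 + (2 - 2 * Real.cos θ) * (ζ - 1) = Q at hden
    rw [e2]
    field_simp

namespace IsLaplaceExponent

/-- The building blocks: for `k > 0` the integral is `k⁻¹ log (1 + k z / (a + 2k))`, a gamma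
exponent, and for `k = 0` it is a drift. -/
theorem integral_inv_affine {a k : ℝ} (hk : 0 ≤ k) (hak : 0 < a + 2 * k) :
    IsLaplaceExponent fun z => ∫ ζ in 2..2 + z, (a + k * ζ)⁻¹ := by
  rcases hk.eq_or_lt with rfl | hk
  · refine (mul_const (c := a⁻¹) (inv_nonneg.2 (by linarith))).congr fun z _ => ?_
    simp
  · refine ((log_one_add (b := k / (a + 2 * k)) (by positivity)).const_mul
      (c := k⁻¹) (by positivity)).congr fun z hz => ?_
    have h1 : 0 < a + k * (2 + z) := by nlinarith
    rw [intervalIntegral.integral_comp_add_mul (fun x => x⁻¹) hk.ne' a,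
      integral_inv_of_pos (by linarith) h1, smul_eq_mul]
    have h2 : a + k * 2 ≠ 0 := by linarith
    have h3 : a + 2 * k ≠ 0 := by linarith
    congr 2
    rw [eq_div_iff h2]
    field_simp
    ring

theorem integral_integral {h : ℝ → ℝ → ℝ} (hc : Continuous (Function.uncurry h)) {b : ℝ}
    (hb : 0 < b) (hh : ∀ θ, IsLaplaceExponent fun z => ∫ ζ in 2..2 + z, h θ ζ) :
    IsLaplaceExponent fun z => ∫ ζ in 2..2 + z, ∫ θ in 0..b, h θ ζ := by
  have hswap : ∀ z, ∫ θ in 0..b, ∫ ζ in 2..2 + z, h θ ζ = ∫ ζ in 2..2 + z, ∫ θ in 0..b, h θ ζ :=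
    fun z => intervalIntegral_intervalIntegral_swap
      ((hc.continuousOn.integrableOn_compact (isCompact_uIcc.prod isCompact_uIcc)).mono_set
        (Set.prod_mono Set.uIoc_subset_uIcc Set.uIoc_subset_uIcc))
  have hci : Continuous fun ζ => ∫ θ in 0..b, h θ ζ :=
    intervalIntegral.continuous_parametric_intervalIntegral_of_continuous'
      (f := fun ζ θ => h θ ζ) (hc.comp continuous_swap) 0 b
  have hcz : Continuous fun z => ∫ ζ in 2..2 + z, ∫ θ in 0..b, h θ ζ :=
    (intervalIntegral.continuous_primitive (fun a b => hci.intervalIntegrable a b) 2).comp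
      (continuous_const.add continuous_id)
  refine (IsLaplaceExponent.intervalIntegral (F := fun θ z => ∫ ζ in 2..2 + z, h θ ζ) hb hh
    (fun z _ => ?_) ?_ ?_).congr fun z _ => hswap z
  · exact (intervalIntegral.continuous_parametric_intervalIntegral_of_continuous' hc 2
      (2 + z)).continuousOn
  · simp_rw [hswap]
    exact hcz.continuousWithinAt
  · simp

end IsLaplaceExponent

section Pick

variable {g : ℂ → ℂ}

theorem continuousOn_re_comp_ofReal (hg : DifferentiableOn ℂ g Complex.slitPlane) :
    ContinuousOn (fun x : ℝ => (g x).re) (Set.Ioi 0) :=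
  Complex.continuous_re.comp_continuousOn (hg.continuousOn.comp
    Complex.continuous_ofReal.continuousOn fun _ hx => Complex.ofReal_mem_slitPlane.2 hx)

/-- Write `G(ζ) / (ζ - c) = G(c) / (ζ - c) + (G(ζ) - G(c)) / (ζ - c)` with `G ζ = (g (shrink r
ζ)).re`. The divided difference of the Möbius kernel is 4 over the product of its denominators at
`ζ` and `c`, so both terms are positive mixtures of reciprocals of affine functions. Taking `c > 0`
keeps the evaluation point off the cut. -/
theorem isLaplaceExponent_integral_shrink (hg : DifferentiableOn ℂ g Complex.slitPlane)
    (him : ∀ z ∈ Complex.slitPlane, 0 ≤ z.im * (g z).im) (hre : ∀ x : ℝ, 0 < x → 0 ≤ (g x).re)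
    {r c : ℝ} (hr0 : 0 < r) (hr1 : r < 1) (hc0 : 0 < c) (hc1 : c < 1) :
    IsLaplaceExponent fun z => ∫ ζ in 2..2 + z, (g (shrink r ζ)).re / (ζ - c) := by
  obtain ⟨D, hDc, hD0, hD⟩ := exists_density_re_shrink hg him hr0 hr1
  have hpos : ∀ θ ζ : ℝ, 0 < ζ → 0 < 4 + (2 - 2 * Real.cos θ) * (ζ - 1) := fun θ ζ hζ =>
    four_add_pos hζ (Real.neg_one_le_cos θ) (Real.cos_le_one θ)
  let E : ℝ → ℝ := fun θ => 4 * D θ / (4 + (2 - 2 * Real.cos θ) * (c - 1))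
  have hE0 : ∀ θ, 0 ≤ E θ := fun θ =>
    div_nonneg (mul_nonneg (by norm_num) (hD0 θ)) (hpos θ c hc0).le
  have hEc : Continuous E := by
    have h := fun θ => (hpos θ c hc0).ne'
    fun_prop (disch := assumption)
  -- The truncation `max ζ 2` changes nothing for `ζ ≥ 2`, where the integral lives, and makes the
  -- kernel continuous on the whole plane.
  let h : ℝ → ℝ → ℝ := fun θ ζ => E θ * (4 + (2 - 2 * Real.cos θ) * (max ζ 2 - 1))⁻¹
  have hhc : Continuous (Function.uncurry h) := by
    have h1 : ∀ p : ℝ × ℝ, 4 + (2 - 2 * Real.cos p.1) * (max p.2 2 - 1) ≠ 0 := fun p =>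
      (hpos p.1 _ (lt_max_of_lt_right two_pos)).ne'
    have h2 : Continuous fun p : ℝ × ℝ => E p.1 := hEc.comp continuous_fst
    unfold h Function.uncurry
    exact h2.mul (Continuous.inv₀ (by fun_prop) h1)
  have key := IsLaplaceExponent.integral_integral (b := 2 * Real.pi) hhc Real.two_pi_pos
    fun θ => ?_
  · have hlog := (IsLaplaceExponent.integral_inv_affine (a := -c) (k := 1) zero_le_one
      (by linarith)).const_mul (hre _ (shrink_pos ⟨hr0.le, hr1.le⟩ hc0))
    refine (hlog.add key).congr fun z hz => ?_
    have hle : (2 : ℝ) ≤ 2 + z := by linarith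
    have hci : Continuous fun ζ => ∫ θ in 0..2 * Real.pi, h θ ζ :=
      intervalIntegral.continuous_parametric_intervalIntegral_of_continuous'
        (f := fun ζ θ => h θ ζ) (hhc.comp continuous_swap) 0 _
    have hic : ContinuousOn (fun ζ : ℝ => (-c + 1 * ζ)⁻¹) (Set.uIcc 2 (2 + z)) := by
      refine ContinuousOn.inv₀ (by fun_prop) fun ζ hζ => ?_
      rw [Set.uIcc_of_le hle] at hζ
      linarith [hζ.1]
    rw [← intervalIntegral.integral_const_mul, ← intervalIntegral.integral_add
      (hic.intervalIntegrable.const_mul _) (hci.intervalIntegrable _ _)]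
    refine intervalIntegral.integral_congr fun ζ hζ => ?_
    rw [Set.uIcc_of_le hle] at hζ
    have hζ0 : 0 < ζ := by linarith [hζ.1]
    have hζc : 0 < ζ - c := by linarith [hζ.1]
    have hi : ∀ x : ℝ, 0 < x → IntervalIntegrable
        (fun θ => D θ * ((x - 1) / (4 + (2 - 2 * Real.cos θ) * (x - 1)))) volume 0
        (2 * Real.pi) := fun x hx => by
      have := fun θ => (hpos θ x hx).ne'
      exact Continuous.intervalIntegrable (by fun_prop (disch := assumption)) _ _
    have e : (g (shrink r ζ)).re - (g (shrink r c)).re =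
        (ζ - c) * ∫ θ in 0..2 * Real.pi, h θ ζ := by
      rw [hD ζ hζ0, hD c hc0, add_sub_add_left_eq_sub,
        ← intervalIntegral.integral_sub (hi ζ hζ0) (hi c hc0),
        ← intervalIntegral.integral_const_mul]
      refine intervalIntegral.integral_congr fun θ _ => ?_
      have h1 := hpos θ ζ hζ0
      have h2 := hpos θ c hc0
      have h3 : (ζ - 1) * (4 + (2 - 2 * Real.cos θ) * (c - 1)) -
          (4 + (2 - 2 * Real.cos θ) * (ζ - 1)) * (c - 1) = 4 * (ζ - c) := by ring
      simp only [h, E, max_eq_left hζ.1]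
      generalize 4 + (2 - 2 * Real.cos θ) * (ζ - 1) = A at *
      generalize 4 + (2 - 2 * Real.cos θ) * (c - 1) = B at *
      rw [← mul_sub, div_sub_div _ _ h1.ne' h2.ne', h3]
      field_simp
    have e2 : (g (shrink r ζ)).re =
        (g (shrink r c)).re + (ζ - c) * ∫ θ in 0..2 * Real.pi, h θ ζ := by linarith
    rw [e2, neg_add_eq_sub, one_mul]
    field_simp
  · have hk : 0 ≤ 2 - 2 * Real.cos θ := by linarith [Real.cos_le_one θ]
    refine ((IsLaplaceExponent.integral_inv_affine (a := 4 - (2 - 2 * Real.cos θ)) hk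
      (by linarith)).const_mul (hE0 θ)).congr fun z hz => ?_
    rw [← intervalIntegral.integral_const_mul]
    refine intervalIntegral.integral_congr fun ζ hζ => ?_
    rw [Set.uIcc_of_le (by linarith)] at hζ
    simp only [h, max_eq_left hζ.1]
    congr 2
    ring

/-- A Pick function that is nonnegative on `(0, ∞)`, divided by the variable, is the derivative
of the Laplace exponent of an infinitely divisible law. -/
theorem isLaplaceExponent_integral_of_pick (hg : DifferentiableOn ℂ g Complex.slitPlane)
    (him : ∀ z ∈ Complex.slitPlane, 0 ≤ z.im * (g z).im) (hre : ∀ x : ℝ, 0 < x → 0 ≤ (g x).re) :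
    IsLaplaceExponent fun z => ∫ ζ in 2..2 + z, (g ζ).re / ζ := by
  have hgc := continuousOn_re_comp_ofReal hg
  -- One sequence drives both limits: the radius `1 - ε n` tends to 1 and the pole `ε n` to 0.
  obtain ⟨ε, hε, hlim0⟩ : ∃ ε : ℕ → ℝ, (∀ n, 0 < ε n ∧ ε n < 1) ∧ Tendsto ε atTop (𝓝 0) := by
    refine ⟨fun n => (1 / 2) ^ (n + 1), fun n => ⟨by positivity, ?_⟩,
      (tendsto_pow_atTop_nhds_zero_of_lt_one (by norm_num) (by norm_num)).comp
        (tendsto_add_atTop_nat 1)⟩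
    exact pow_lt_one₀ (by norm_num) (by norm_num) (by simp)
  have hlim1 : Tendsto (fun n : ℕ => 1 - ε n) atTop (𝓝 1) := by
    simpa using hlim0.const_sub 1
  have hr : ∀ n : ℕ, 1 - ε n ∈ Set.Icc (0 : ℝ) 1 := fun n =>
    ⟨by linarith [(hε n).2], by linarith [(hε n).1]⟩
  refine IsLaplaceExponent.of_tendsto
    (F := fun n z => ∫ ζ in 2..2 + z, (g (shrink (1 - ε n) ζ)).re /
      (ζ - ε n))
    (fun n => isLaplaceExponent_integral_shrink hg him hre (by linarith [(hε n).2])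
      (by linarith [(hε n).1]) (hε n).1 (hε n).2) (fun z hz => ?_) ?_ (by simp)
  · have hle : (2 : ℝ) ≤ 2 + z := by linarith
    obtain ⟨C, hC⟩ := (isCompact_Icc (a := (1 : ℝ)) (b := 2 + z)).exists_bound_of_continuousOn
      (hgc.mono fun x hx => lt_of_lt_of_le one_pos hx.1)
    have hζ2 : ∀ ζ ∈ Set.uIoc 2 (2 + z), 2 ≤ ζ ∧ ζ ≤ 2 + z := fun ζ hζ => by
      rw [Set.uIoc_of_le hle] at hζ
      exact ⟨hζ.1.le, hζ.2⟩
    refine intervalIntegral.tendsto_integral_filter_of_dominated_convergence (fun _ => C)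
      (Eventually.of_forall fun n => ?_) (Eventually.of_forall fun n =>
        Eventually.of_forall fun ζ hζ => ?_) (by simp) (Eventually.of_forall fun ζ hζ => ?_)
    · refine ContinuousOn.aestronglyMeasurable ?_ measurableSet_uIoc
      refine ContinuousOn.div ?_ (by fun_prop) fun ζ hζ => ?_
      · have h1 : ContinuousOn (shrink (1 - ε n)) (Set.uIoc 2 (2 + z)) :=
          (continuousOn_shrink_right (hr n)).mono fun ζ hζ => Set.mem_Ioi.2
            (by linarith [(hζ2 ζ hζ).1])
        exact ContinuousOn.comp (g := fun x : ℝ => (g x).re) hgc h1 fun ζ hζ =>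
          shrink_pos (hr n) (by linarith [(hζ2 ζ hζ).1])
      · linarith [(hζ2 ζ hζ).1, (hε n).2]
    · obtain ⟨h1, h2⟩ := hζ2 ζ hζ
      have hs := shrink_mem_Icc (hr n) (show 1 ≤ ζ by linarith)
      have h3 := hC _ ⟨hs.1, hs.2.trans h2⟩
      rw [norm_div]
      refine (div_le_self (norm_nonneg _) ?_).trans h3
      rw [Real.norm_eq_abs]
      exact le_trans (by linarith [(hε n).2]) (le_abs_self _)
    · obtain ⟨h1, h2⟩ := hζ2 ζ hζ
      have hζ0 : 0 < ζ := by linarith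
      have hs : Tendsto (fun n : ℕ => shrink (1 - ε n) ζ) atTop (𝓝 ζ) := by
        have h3 := (continuousOn_shrink_left hζ0 1 (by simp)).tendsto
        have h4 : Tendsto (fun n => 1 - ε n) atTop (𝓝[Set.Icc 0 1] 1) :=
          tendsto_nhdsWithin_iff.2 ⟨hlim1, Eventually.of_forall hr⟩
        have h5 := h3.comp h4
        rwa [shrink_one hζ0] at h5
      have h6 : Tendsto (fun n => (g (shrink (1 - ε n) ζ)).re / (ζ - ε n)) atTop
          (𝓝 ((g ζ).re / (ζ - 0))) := ((hgc.continuousAt (Ioi_mem_nhds hζ0)).tendsto.comp hs).div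
        (hlim0.const_sub ζ) (by simpa using hζ0.ne')
      rwa [sub_zero] at h6
  · have hc : Continuous fun x : ℝ => (g (max x 2 : ℝ)).re / max x 2 := by
      refine Continuous.div (hgc.comp_continuous (by fun_prop) fun x => ?_) (by fun_prop)
        fun x => ?_
      · exact Set.mem_Ioi.2 (lt_max_of_lt_right two_pos)
      · exact (lt_max_of_lt_right two_pos).ne'
    have hcz : Continuous fun z => ∫ ζ in 2..2 + z, (g (max ζ 2 : ℝ)).re / max ζ 2 :=
      (intervalIntegral.continuous_primitive (fun a b => hc.intervalIntegrable a b) 2).comp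
        (continuous_const.add continuous_id)
    refine hcz.continuousWithinAt.congr (fun z hz => ?_) (by simp)
    refine intervalIntegral.integral_congr fun ζ hζ => ?_
    rw [Set.uIcc_of_le (by linarith [Set.mem_Ici.1 hz])] at hζ
    simp only [max_eq_left hζ.1]

end Pick

/-! ### Generalized Stieltjes transforms on the slit plane. -/

theorem one_add_mul_ofReal_mem_slitPlane {ζ : ℂ} (hζ : ζ ∈ Complex.slitPlane) {h : ℝ} (hh : 0 ≤ h) :
    1 + ζ * h ∈ Complex.slitPlane := by
  rcases hh.eq_or_lt with rfl | hh
  · simp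
  · rw [Complex.mem_slitPlane_iff] at hζ ⊢
    rcases hζ with h1 | h1
    · left
      simp only [Complex.add_re, Complex.one_re, Complex.re_mul_ofReal]
      positivity
    · right
      simpa [Complex.im_mul_ofReal] using ⟨h1, hh.ne'⟩

/-- `(1 + ζ h) / (1 + h)` lies on the segment from 1 to `ζ`, and the slit plane is star-shaped about
1. Compactness of `K × [0, 1]` then gives a bound uniform in `h ∈ [0, ∞)`. -/
theorem exists_mul_one_add_le_norm {K : Set ℂ} (hK : IsCompact K) (hKs : K ⊆ Complex.slitPlane) :
    ∃ c : ℝ, 0 < c ∧ ∀ ζ ∈ K, ∀ h : ℝ, 0 ≤ h → c * (1 + h) ≤ ‖1 + ζ * h‖ := by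
  obtain ⟨c, hc, h⟩ := (hK.prod (isCompact_Icc (a := (0 : ℝ)) (b := 1))).exists_forall_le'
    (f := fun p : ℂ × ℝ => ‖((1 - p.2 : ℝ) : ℂ) + p.2 * p.1‖) (by fun_prop) (a := 0) (by
      rintro ⟨ζ, s⟩ ⟨hζ, hs⟩
      refine norm_pos_iff.2 (Complex.slitPlane_ne_zero ?_)
      simpa using Complex.starConvex_one_slitPlane (hKs hζ) (sub_nonneg.2 hs.2) hs.1 (by ring))
  refine ⟨c, hc, fun ζ hζ x hx => ?_⟩
  have h1 : 0 < 1 + x := by linarith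
  have h2 := h (ζ, x / (1 + x)) ⟨hζ, by positivity, by rw [div_le_one h1]; linarith⟩
  have e : ((1 - x / (1 + x) : ℝ) : ℂ) + (x / (1 + x) : ℝ) * ζ =
      ((1 + x)⁻¹ : ℝ) * (1 + ζ * x) := by
    have e1 : 1 - x / (1 + x) = (1 + x)⁻¹ := by field_simp; ring
    have e2 : x / (1 + x) = (1 + x)⁻¹ * x := by field_simp
    rw [e1, e2]
    push_cast
    ring
  simp only [e, norm_mul, Complex.norm_real, Real.norm_of_nonneg (inv_pos.2 h1).le] at h2
  rw [inv_mul_eq_div, le_div_iff₀ h1] at h2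
  exact h2

/-- The generalized Stieltjes transform `∫ (1 + ζ h) ^ (-m) dρ(h)`. -/
noncomputable def stieltjesTransform (ρ : Measure ℝ) (m : ℝ) (ζ : ℂ) : ℂ :=
  ∫ h : ℝ, (1 + ζ * h) ^ ((-m : ℝ) : ℂ) ∂ρ

section Stieltjes

variable {ρ : Measure ℝ} {m : ℝ}

theorem aestronglyMeasurable_one_add_mul_cpow (ζ : ℂ) (c : ℂ) :
    AEStronglyMeasurable (fun h : ℝ => (1 + ζ * h) ^ c) ρ :=
  (by fun_prop : Measurable fun h : ℝ => (1 + ζ * h) ^ c).aestronglyMeasurable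

theorem differentiableOn_stieltjesTransform (hm : 0 < m) (hρ : ∀ᵐ h ∂ρ, 0 ≤ h)
    (hint : Integrable (fun h => (1 + h) ^ (-m)) ρ) :
    DifferentiableOn ℂ (stieltjesTransform ρ m) Complex.slitPlane := by
  intro ζ hζ
  obtain ⟨K, hK, hζK, hKs⟩ := exists_compact_subset Complex.isOpen_slitPlane hζ
  obtain ⟨c, hc, hcb⟩ := exists_mul_one_add_le_norm hK hKs
  have hb : ∀ a : ℝ, a ≤ 0 → ∀ z ∈ K, ∀ h : ℝ, 0 ≤ h →
      ‖(1 + z * h) ^ (a : ℂ)‖ ≤ c ^ a * (1 + h) ^ a := fun a ha z hz h hh => by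
    rw [Complex.norm_cpow_real, ← Real.mul_rpow hc.le (by linarith)]
    exact Real.rpow_le_rpow_of_nonpos (by positivity) (hcb z hz h hh) ha
  have hbint : Integrable (fun h => m * c ^ (-m - 1) * (1 + h) ^ (-m)) ρ := hint.const_mul _
  have key := hasDerivAt_integral_of_dominated_loc_of_deriv_le (μ := ρ) (s := interior K)
    (F := fun (z : ℂ) (h : ℝ) => (1 + z * h) ^ ((-m : ℝ) : ℂ))
    (F' := fun (z : ℂ) (h : ℝ) => ((-m : ℝ) : ℂ) * (1 + z * h) ^ (((-m : ℝ) : ℂ) - 1) * h)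
    (x₀ := ζ) (bound := fun h => m * c ^ (-m - 1) * (1 + h) ^ (-m))
    (isOpen_interior.mem_nhds hζK)
    (Eventually.of_forall fun z => aestronglyMeasurable_one_add_mul_cpow z _) ?_
    (by fun_prop) ?_ hbint ?_
  · exact key.2.differentiableAt.differentiableWithinAt
  · refine (hint.const_mul (c ^ (-m))).mono' (aestronglyMeasurable_one_add_mul_cpow ζ _) ?_
    filter_upwards [hρ] with h hh
    exact hb _ (by linarith) ζ (interior_subset hζK) h hh
  · filter_upwards [hρ] with h hh z hz
    have h1 : 0 < 1 + h := by linarith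
    have h2 := hb (-m - 1) (by linarith) z (interior_subset hz) h hh
    rw [norm_mul, norm_mul, Complex.norm_real, Complex.norm_real, Real.norm_of_nonneg hh,
      norm_neg, Real.norm_of_nonneg hm.le,
      show ((-m : ℝ) : ℂ) - 1 = ((-m - 1 : ℝ) : ℂ) by push_cast; ring]
    have h3 : (1 + h) ^ (-m) = (1 + h) ^ (-m - 1) * (1 + h) := by
      rw [← Real.rpow_add_one h1.ne']
      ring_nf
    calc m * ‖(1 + z * h) ^ ((-m - 1 : ℝ) : ℂ)‖ * h
        ≤ m * (c ^ (-m - 1) * (1 + h) ^ (-m - 1)) * (1 + h) := by gcongr; linarith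
      _ = m * c ^ (-m - 1) * (1 + h) ^ (-m) := by rw [h3]; ring
  · filter_upwards [hρ] with h hh z hz
    have h1 : HasDerivAt (fun z : ℂ => 1 + z * h) (h : ℂ) z := by
      simpa using ((hasDerivAt_id z).mul_const (h : ℂ)).const_add 1
    exact h1.cpow_const (one_add_mul_ofReal_mem_slitPlane (hKs (interior_subset hz)) hh)

theorem stieltjesTransform_ofReal (hρ : ∀ᵐ h ∂ρ, 0 ≤ h) {x : ℝ} (hx : 0 ≤ x) :
    stieltjesTransform ρ m x = ((∫ h, (1 + x * h) ^ (-m) ∂ρ : ℝ) : ℂ) := by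
  rw [stieltjesTransform, ← integral_complex_ofReal]
  refine integral_congr_ae ?_
  filter_upwards [hρ] with h hh
  rw [Complex.ofReal_cpow (by positivity)]
  push_cast
  rfl

theorem stieltjesTransform_conj (hρ : ∀ᵐ h ∂ρ, 0 ≤ h) {ζ : ℂ} (hζ : ζ ∈ Complex.slitPlane) :
    stieltjesTransform ρ m (starRingEnd ℂ ζ) = starRingEnd ℂ (stieltjesTransform ρ m ζ) := by
  rw [stieltjesTransform, stieltjesTransform, ← integral_conj]
  refine integral_congr_ae ?_
  filter_upwards [hρ] with h hh
  have h1 := (Complex.mem_slitPlane_iff_arg.1 (one_add_mul_ofReal_mem_slitPlane hζ hh)).1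
  have h2 := Complex.cpow_conj (1 + ζ * h) ((-m : ℝ) : ℂ) h1
  rw [Complex.conj_ofReal] at h2
  rw [h2, starRingEnd_self_apply]
  simp

end Stieltjes

/-! ### Continuation in the hyperbolic variable and the Pick property of `-ζ Φ'/Φ`. -/

theorem Complex.re_cosh (ξ : ℂ) :
    (Complex.cosh ξ).re = Real.cosh ξ.re * Real.cos ξ.im := by
  conv_lhs => rw [← Complex.re_add_im ξ]
  rw [Complex.cosh_add, Complex.cosh_mul_I, Complex.sinh_mul_I, ← Complex.ofReal_cosh,
    ← Complex.ofReal_cos, ← Complex.ofReal_sinh, ← Complex.ofReal_sin]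
  simp only [Complex.add_re, Complex.mul_re, Complex.ofReal_re, Complex.ofReal_im, Complex.mul_im,
    Complex.I_re, Complex.I_im]
  ring

theorem ofReal_mul_exp_mem_slitPlane {u : ℝ} (hu : 0 < u) {ξ : ℂ} (hξ : |ξ.im| < Real.pi) :
    (u : ℂ) * Complex.exp ξ ∈ Complex.slitPlane := by
  rw [Complex.mem_slitPlane_iff, Complex.re_ofReal_mul, Complex.im_ofReal_mul, Complex.exp_re,
    Complex.exp_im]
  obtain ⟨h1, h2⟩ := abs_lt.1 hξ
  have hE := Real.exp_pos ξ.re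
  rcases eq_or_ne ξ.im 0 with h | h
  · left
    rw [h, Real.cos_zero]
    positivity
  · right
    have h3 : Real.sin ξ.im ≠ 0 := by
      rcases h.lt_or_gt with h | h
      · exact (Real.sin_neg_of_neg_of_neg_pi_lt h h1).ne
      · exact (Real.sin_pos_of_pos_of_lt_pi h h2).ne'
    positivity

/-- The component of `{Re cosh > -1}` that contains the real line. -/
def coshDomain : Set ℂ := {ξ | |ξ.im| < Real.pi ∧ -1 < (Complex.cosh ξ).re}

/-- The domain is star-shaped about 0: in `cosh (Re ξ) cos (Im ξ)`, contracting `ξ` decreases the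
first factor and increases the second, so the product stays above `-1`. -/
theorem isPreconnected_coshDomain : IsPreconnected coshDomain := by
  have h0 : (0 : ℂ) ∈ coshDomain := ⟨by simpa using Real.pi_pos, by simp⟩
  refine (StarConvex.isPathConnected (a := 0) ?_ h0).isConnected.isPreconnected
  rw [starConvex_zero_iff]
  rintro ξ ⟨h1, h2⟩ t ht0 ht1
  have him : (t • ξ).im = t * ξ.im := by simp
  have hre : (t • ξ).re = t * ξ.re := by simp
  have habs : |t * ξ.im| ≤ |ξ.im| := by
    rw [abs_mul, abs_of_nonneg ht0]
    exact mul_le_of_le_one_left (abs_nonneg _) ht1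
  refine ⟨by rw [him]; exact habs.trans_lt h1, ?_⟩
  rw [Complex.re_cosh] at h2 ⊢
  rw [him, hre]
  have hc : Real.cosh (t * ξ.re) ≤ Real.cosh ξ.re := by
    rw [Real.cosh_le_cosh, abs_mul, abs_of_nonneg ht0]
    exact mul_le_of_le_one_left (abs_nonneg _) ht1
  have hc0 := Real.cosh_pos (t * ξ.re)
  have hcos : Real.cos ξ.im ≤ Real.cos (t * ξ.im) := by
    rw [← Real.cos_abs ξ.im, ← Real.cos_abs (t * ξ.im)]
    exact Real.cos_le_cos_of_nonneg_of_le_pi (abs_nonneg _) h1.le habs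
  rcases le_total 0 (Real.cos (t * ξ.im)) with h | h
  · nlinarith
  · nlinarith [mul_nonneg (sub_nonneg.2 hc) (neg_nonneg.2 (hcos.trans h)),
      mul_nonneg hc0.le (sub_nonneg.2 hcos)]

section Stieltjes

variable {ρ : Measure ℝ} {m : ℝ}

/-- The product of the values of `f` at `u v` and `u / v` is a Laplace transform in `v + v⁻¹`, that
converges for arguments larger than `-2`. -/
def IsHyperbolicLaplace (f : ℝ → ℝ) : Prop :=
  ∀ u : ℝ, 0 < u → ∃ ν : Measure ℝ, (∀ᵐ x ∂ν, 0 ≤ x) ∧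
    (∀ w : ℝ, -2 < w → Integrable (fun x => Real.exp (-(x * w))) ν) ∧
    ∀ v : ℝ, 0 < v → f (u * v) * f (u / v) = ∫ x, Real.exp (-(x * (v + v⁻¹))) ∂ν

/-- On the real line this is the hypothesis with `v = e^ξ`. The left side continues because `|Im ξ|
< π` keeps `u e^(±ξ)` off the cut, the right side because `Re (2 cosh ξ) > -2` is in the range of
convergence. -/
theorem stieltjesTransform_mul_eq (hm : 0 < m) (hρ : ∀ᵐ h ∂ρ, 0 ≤ h)
    (hint : Integrable (fun h => (1 + h) ^ (-m)) ρ) {ν : Measure ℝ} {u : ℝ} (hu : 0 < u)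
    (hν : ∀ w : ℝ, -2 < w → Integrable (fun x => Real.exp (-(x * w))) ν)
    (hv : ∀ v : ℝ, 0 < v → (∫ h, (1 + u * v * h) ^ (-m) ∂ρ) * ∫ h, (1 + u / v * h) ^ (-m) ∂ρ =
      ∫ x, Real.exp (-(x * (v + v⁻¹))) ∂ν) {ξ : ℂ} (hξ : ξ ∈ coshDomain) :
    stieltjesTransform ρ m (u * Complex.exp ξ) * stieltjesTransform ρ m (u * Complex.exp (-ξ)) =
      complexMGF id ν (-(2 * Complex.cosh ξ)) := by
  have hopen : IsOpen coshDomain := by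
    have h1 : Continuous fun ξ : ℂ => |ξ.im| := by fun_prop
    have h2 : Continuous fun ξ : ℂ => (Complex.cosh ξ).re := by fun_prop
    exact (isOpen_lt h1 continuous_const).inter (isOpen_lt continuous_const h2)
  have hS := differentiableOn_stieltjesTransform hm hρ hint
  have hL : AnalyticOnNhd ℂ (fun ξ => stieltjesTransform ρ m (u * Complex.exp ξ) *
      stieltjesTransform ρ m (u * Complex.exp (-ξ))) coshDomain := by
    refine DifferentiableOn.analyticOnNhd (DifferentiableOn.mul ?_ ?_) hopen
    · exact hS.comp (by fun_prop) fun ξ hξ => ofReal_mul_exp_mem_slitPlane hu hξ.1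
    · exact hS.comp (by fun_prop) fun ξ hξ =>
        ofReal_mul_exp_mem_slitPlane hu (by simpa using hξ.1)
  have hR : AnalyticOnNhd ℂ (fun ξ => complexMGF id ν (-(2 * Complex.cosh ξ))) coshDomain := by
    have h1 : AnalyticOnNhd ℂ (complexMGF id ν) {z | z.re ∈ Set.Iio 2} :=
      analyticOnNhd_complexMGF.mono fun z hz => interior_maximal (fun t ht => by
        have := hν (-t) (by linarith [Set.mem_Iio.1 ht])
        refine (this.congr (Eventually.of_forall fun x => ?_))
        simp [mul_comm]) isOpen_Iio hz
    refine DifferentiableOn.analyticOnNhd ?_ hopen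
    refine h1.differentiableOn.comp (f := fun ξ => -(2 * Complex.cosh ξ)) (by fun_prop)
      fun ξ hξ => ?_
    have := hξ.2
    simp only [Set.mem_Iio, Set.mem_ofPred_eq, Complex.neg_re, Complex.mul_re, Complex.re_ofNat,
      Complex.im_ofNat]
    linarith
  refine hL.eqOn_of_preconnected_of_frequently_eq hR isPreconnected_coshDomain (z₀ := ((0 : ℝ) : ℂ))
    ⟨by simpa using Real.pi_pos, by simp⟩ ?_ hξ
  have h_real : ∃ᶠ x : ℝ in 𝓝[≠] 0, stieltjesTransform ρ m (u * Complex.exp x) *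
      stieltjesTransform ρ m (u * Complex.exp (-x)) =
      complexMGF id ν (-(2 * Complex.cosh x)) := by
    refine Eventually.frequently (Eventually.of_forall fun x => ?_)
    have e1 : (u : ℂ) * Complex.exp x = ((u * Real.exp x : ℝ) : ℂ) := by push_cast; rfl
    have e2 : (u : ℂ) * Complex.exp (-x) = ((u / Real.exp x : ℝ) : ℂ) := by
      rw [div_eq_mul_inv, ← Real.exp_neg]
      push_cast
      rfl
    have e3 : -(2 * Complex.cosh x) = ((-(Real.exp x + (Real.exp x)⁻¹) : ℝ) : ℂ) := by
      rw [← Real.exp_neg, ← Complex.ofReal_cosh, Real.cosh_eq]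
      push_cast
      ring
    rw [e1, e2, e3, stieltjesTransform_ofReal hρ (by positivity),
      stieltjesTransform_ofReal hρ (by positivity), ← Complex.ofReal_mul,
      hv _ (Real.exp_pos x), complexMGF_ofReal, mgf]
    congr 2
    funext y
    simp only [id]
    congr 1
    ring
  refine Tendsto.frequently ?_ h_real
  refine tendsto_nhdsWithin_iff.2 ⟨?_, ?_⟩
  · exact (Complex.continuous_ofReal.tendsto 0).mono_left nhdsWithin_le_nhds
  · filter_upwards [self_mem_nhdsWithin] with x hx
    simpa using hx

end Stieltjes

section Stieltjes

variable {ρ : Measure ℝ} {m : ℝ}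

theorem integrable_one_add_mul_rpow (hm : 0 < m) (hρ : ∀ᵐ h ∂ρ, 0 ≤ h)
    (hint : Integrable (fun h => (1 + h) ^ (-m)) ρ) {x : ℝ} (hx : 0 < x) :
    Integrable (fun h => (1 + x * h) ^ (-m)) ρ := by
  refine (hint.const_mul ((min 1 x) ^ (-m))).mono'
    (by fun_prop : Measurable fun h => (1 + x * h) ^ (-m)).aestronglyMeasurable ?_
  filter_upwards [hρ] with h hh
  have h0 : 0 < min 1 x := lt_min one_pos hx
  rw [Real.norm_of_nonneg (by positivity), ← Real.mul_rpow h0.le (by linarith)]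
  refine Real.rpow_le_rpow_of_nonpos (by positivity) ?_ (by linarith)
  nlinarith [min_le_left 1 x, min_le_right 1 x, mul_le_mul_of_nonneg_right (min_le_right 1 x) hh]

theorem integral_one_add_mul_rpow_pos (hm : 0 < m) (hρ : ∀ᵐ h ∂ρ, 0 ≤ h)
    (hint : Integrable (fun h => (1 + h) ^ (-m)) ρ) (hρ0 : ρ ≠ 0) {x : ℝ} (hx : 0 < x) :
    0 < ∫ h, (1 + x * h) ^ (-m) ∂ρ := by
  have hpos : ∀ᵐ h ∂ρ, 0 < (1 + x * h) ^ (-m) := by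
    filter_upwards [hρ] with h hh
    positivity
  have hnn : 0 ≤ ∫ h, (1 + x * h) ^ (-m) ∂ρ := integral_nonneg_of_ae (hpos.mono fun _ h => h.le)
  refine hnn.lt_of_ne' fun h0 => hρ0 ?_
  have h1 := (integral_eq_zero_iff_of_nonneg_ae (hpos.mono fun _ h => h.le)
    (integrable_one_add_mul_rpow hm hρ hint hx)).1 h0
  have h2 : ∀ᵐ h ∂ρ, False := by
    filter_upwards [hpos, h1] with h h3 h4
    exact h3.ne' h4
  simpa [ae_iff] using h2

theorem antitoneOn_integral_one_add_mul_rpow (hm : 0 < m) (hρ : ∀ᵐ h ∂ρ, 0 ≤ h)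
    (hint : Integrable (fun h => (1 + h) ^ (-m)) ρ) :
    AntitoneOn (fun x => ∫ h, (1 + x * h) ^ (-m) ∂ρ) (Set.Ioi 0) := by
  intro x hx y hy hxy
  refine integral_mono_ae (integrable_one_add_mul_rpow hm hρ hint hy)
    (integrable_one_add_mul_rpow hm hρ hint hx) ?_
  filter_upwards [hρ] with h hh
  have := Set.mem_Ioi.1 hx
  exact Real.rpow_le_rpow_of_nonpos (by positivity) (by gcongr) (by linarith)

/-- At `ξ = iθ` the two factors are complex conjugates, so `N θ = ∫ exp (-2 x cos θ) dν(x)`. It is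
positive, and monotone on each side of 0 because `cos` is. -/
theorem exists_norm_sq_stieltjesTransform (hm : 0 < m) (hρ : ∀ᵐ h ∂ρ, 0 ≤ h)
    (hint : Integrable (fun h => (1 + h) ^ (-m)) ρ) (hρ0 : ρ ≠ 0)
    (hH : IsHyperbolicLaplace fun x => ∫ h, (1 + x * h) ^ (-m) ∂ρ) {u : ℝ} (hu : 0 < u) :
    ∃ N : ℝ → ℝ, (∀ θ ∈ Set.Ioo (-Real.pi) Real.pi,
        ‖stieltjesTransform ρ m (u * Complex.exp (θ * Complex.I))‖ ^ 2 = N θ ∧ 0 < N θ) ∧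
      MonotoneOn N (Set.Ioo 0 Real.pi) ∧ AntitoneOn N (Set.Ioo (-Real.pi) 0) := by
  obtain ⟨ν, hν0, hνi, hν⟩ := hH u hu
  have hνne : NeZero ν := by
    refine ⟨fun h => ?_⟩
    have h1 := hν 1 one_pos
    rw [h, integral_zero_measure] at h1
    have h2 := integral_one_add_mul_rpow_pos hm hρ hint hρ0 hu
    simp only [mul_one, div_one] at h1
    exact (mul_pos h2 h2).ne' h1
  have hcos : ∀ θ ∈ Set.Ioo (-Real.pi) Real.pi, -1 < Real.cos θ := fun θ hθ => by
    rw [← Real.cos_pi, ← Real.cos_abs θ]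
    exact Real.cos_lt_cos_of_nonneg_of_le_pi (abs_nonneg _) le_rfl (abs_lt.2 hθ)
  have hmono : ∀ θ ∈ Set.Ioo (-Real.pi) Real.pi, ∀ ψ ∈ Set.Ioo (-Real.pi) Real.pi,
      Real.cos ψ ≤ Real.cos θ → ∫ x, Real.exp (-(x * (2 * Real.cos θ))) ∂ν ≤
        ∫ x, Real.exp (-(x * (2 * Real.cos ψ))) ∂ν := fun θ hθ ψ hψ h => by
    refine integral_mono_ae (hνi _ (by linarith [hcos θ hθ])) (hνi _ (by linarith [hcos ψ hψ])) ?_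
    filter_upwards [hν0] with x hx
    exact Real.exp_le_exp.2 (neg_le_neg (by gcongr))
  have hpi := Real.pi_pos
  refine ⟨fun θ => ∫ x, Real.exp (-(x * (2 * Real.cos θ))) ∂ν, fun θ hθ => ⟨?_, ?_⟩, ?_, ?_⟩
  · have hθ' : ((θ : ℂ) * Complex.I) ∈ coshDomain := by
      refine ⟨by simpa using abs_lt.2 hθ, ?_⟩
      rw [Complex.re_cosh]
      simpa using hcos θ hθ
    have h1 := stieltjesTransform_mul_eq hm hρ hint hu hνi hν hθ'
    have h2 : (u : ℂ) * Complex.exp (-(θ * Complex.I)) =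
        starRingEnd ℂ (u * Complex.exp (θ * Complex.I)) := by
      rw [map_mul, Complex.conj_ofReal, ← Complex.exp_conj, map_mul, Complex.conj_ofReal,
        Complex.conj_I, mul_neg]
    have h3 : -(2 * Complex.cosh (θ * Complex.I)) = ((-(2 * Real.cos θ) : ℝ) : ℂ) := by
      rw [Complex.cosh_mul_I]
      push_cast
      rfl
    rw [h2, stieltjesTransform_conj hρ (ofReal_mul_exp_mem_slitPlane hu hθ'.1), Complex.mul_conj,
      h3, complexMGF_ofReal, Complex.ofReal_inj, Complex.normSq_eq_norm_sq, mgf] at h1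
    rw [h1]
    congr 1
    funext x
    simp only [id]
    congr 1
    ring
  · exact integral_exp_pos (hνi _ (by linarith [hcos θ hθ]))
  · intro θ hθ ψ hψ h
    exact hmono θ ⟨by linarith [hθ.1], hθ.2⟩ ψ ⟨by linarith [hψ.1], hψ.2⟩
      (Real.cos_le_cos_of_nonneg_of_le_pi hθ.1.le hψ.2.le h)
  · intro θ hθ ψ hψ h
    refine hmono ψ ⟨hψ.1, by linarith [hψ.2]⟩ θ ⟨hθ.1, by linarith [hθ.2]⟩ ?_
    rw [← Real.cos_neg θ, ← Real.cos_neg ψ]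
    exact Real.cos_le_cos_of_nonneg_of_le_pi (by linarith [hψ.2]) (by linarith [hθ.1])
      (by linarith)

theorem stieltjesTransform_ne_zero (hm : 0 < m) (hρ : ∀ᵐ h ∂ρ, 0 ≤ h)
    (hint : Integrable (fun h => (1 + h) ^ (-m)) ρ) (hρ0 : ρ ≠ 0)
    (hH : IsHyperbolicLaplace fun x => ∫ h, (1 + x * h) ^ (-m) ∂ρ) {ζ : ℂ}
    (hζ : ζ ∈ Complex.slitPlane) : stieltjesTransform ρ m ζ ≠ 0 := by
  obtain ⟨N, h1, -, -⟩ := exists_norm_sq_stieltjesTransform hm hρ hint hρ0 hH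
    (norm_pos_iff.2 (Complex.slitPlane_ne_zero hζ))
  have h2 := h1 ζ.arg ⟨Complex.neg_pi_lt_arg ζ,
    (Complex.arg_le_pi ζ).lt_of_ne (Complex.mem_slitPlane_iff_arg.1 hζ).1⟩
  rw [Complex.norm_mul_exp_arg_mul_I] at h2
  intro h0
  rw [h0, norm_zero] at h2
  exact h2.2.ne (by linarith [h2.1])

/-- The derivative of `|Φ (|ζ| e^(iθ))|²` at `θ = arg ζ` is `2 |Φ(ζ)|² Im (-ζ Φ'(ζ) / Φ(ζ))`, so the
monotonicity of `N` fixes its sign. -/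
theorem im_mul_im_nonneg_stieltjesTransform (hm : 0 < m) (hρ : ∀ᵐ h ∂ρ, 0 ≤ h)
    (hint : Integrable (fun h => (1 + h) ^ (-m)) ρ) (hρ0 : ρ ≠ 0)
    (hH : IsHyperbolicLaplace fun x => ∫ h, (1 + x * h) ^ (-m) ∂ρ) {ζ : ℂ}
    (hζ : ζ ∈ Complex.slitPlane) :
    0 ≤ ζ.im * (-(ζ * deriv (stieltjesTransform ρ m) ζ / stieltjesTransform ρ m ζ)).im := by
  have hζ0 := Complex.slitPlane_ne_zero hζ
  obtain ⟨N, h1, hmono, hanti⟩ := exists_norm_sq_stieltjesTransform hm hρ hint hρ0 hH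
    (norm_pos_iff.2 hζ0)
  have harg : ζ.arg ∈ Set.Ioo (-Real.pi) Real.pi := ⟨Complex.neg_pi_lt_arg ζ,
    (Complex.arg_le_pi ζ).lt_of_ne (Complex.mem_slitPlane_iff_arg.1 hζ).1⟩
  have hne := stieltjesTransform_ne_zero hm hρ hint hρ0 hH hζ
  have hd : HasDerivAt (stieltjesTransform ρ m) (deriv (stieltjesTransform ρ m) ζ)
      (‖ζ‖ * Complex.exp (ζ.arg * Complex.I)) := by
    rw [Complex.norm_mul_exp_arg_mul_I]
    exact ((differentiableOn_stieltjesTransform hm hρ hint).differentiableAt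
      (Complex.isOpen_slitPlane.mem_nhds hζ)).hasDerivAt
  have hcurve : HasDerivAt (fun θ : ℝ => (‖ζ‖ : ℂ) * Complex.exp (θ * Complex.I))
      (ζ * Complex.I) ζ.arg := by
    have h2 : HasDerivAt (fun θ : ℂ => (‖ζ‖ : ℂ) * Complex.exp (θ * Complex.I))
        (‖ζ‖ * (Complex.exp (ζ.arg * Complex.I) * (1 * Complex.I))) (ζ.arg : ℂ) :=
      (((hasDerivAt_id _).mul_const Complex.I).cexp).const_mul _
    rw [one_mul, ← mul_assoc, Complex.norm_mul_exp_arg_mul_I] at h2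
    exact h2.comp_ofReal
  have hsq := (hd.comp ζ.arg hcurve).norm_sq
  have hN : HasDerivAt N (2 * inner ℝ (stieltjesTransform ρ m ζ)
      (deriv (stieltjesTransform ρ m) ζ * (ζ * Complex.I))) ζ.arg := by
    have h3 : (fun θ : ℝ => ‖(stieltjesTransform ρ m ∘
        fun θ : ℝ => (‖ζ‖ : ℂ) * Complex.exp (θ * Complex.I)) θ‖ ^ 2) =ᶠ[𝓝 ζ.arg] N := by
      filter_upwards [Ioo_mem_nhds harg.1 harg.2] with θ hθ
      exact (h1 θ hθ).1
    have h4 := hsq.congr_of_eventuallyEq h3.symm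
    rwa [Function.comp_apply, Complex.norm_mul_exp_arg_mul_I] at h4
  rw [Complex.inner] at hN
  have him : (-(ζ * deriv (stieltjesTransform ρ m) ζ / stieltjesTransform ρ m ζ)).im =
      (deriv (stieltjesTransform ρ m) ζ * (ζ * Complex.I) *
        starRingEnd ℂ (stieltjesTransform ρ m ζ)).re /
          Complex.normSq (stieltjesTransform ρ m ζ) := by
    have e : -(ζ * deriv (stieltjesTransform ρ m) ζ / stieltjesTransform ρ m ζ) =
        ((Complex.normSq (stieltjesTransform ρ m ζ))⁻¹ : ℝ) *
          -(deriv (stieltjesTransform ρ m) ζ * ζ * starRingEnd ℂ (stieltjesTransform ρ m ζ)) := by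
      rw [div_eq_mul_inv, Complex.inv_def]
      ring
    have e2 : deriv (stieltjesTransform ρ m) ζ * (ζ * Complex.I) *
        starRingEnd ℂ (stieltjesTransform ρ m ζ) = deriv (stieltjesTransform ρ m) ζ * ζ *
          starRingEnd ℂ (stieltjesTransform ρ m ζ) * Complex.I := by ring
    rw [e, e2, Complex.im_ofReal_mul, Complex.mul_I_re, Complex.neg_im, div_eq_inv_mul]
  have hns := Complex.normSq_pos.2 hne
  rw [him]
  rcases lt_trichotomy ζ.im 0 with h | h | h
  · have ha : ζ.arg ∈ Set.Ioo (-Real.pi) 0 := ⟨harg.1, Complex.arg_neg_iff.2 h⟩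
    have h5 := hanti.derivWithin_nonpos (x := ζ.arg)
    rw [derivWithin_of_isOpen isOpen_Ioo ha, hN.deriv] at h5
    exact mul_nonneg_of_nonpos_of_nonpos h.le (div_nonpos_of_nonpos_of_nonneg (by linarith) hns.le)
  · simp [h]
  · have ha : ζ.arg ∈ Set.Ioo 0 Real.pi := by
      refine ⟨(Complex.arg_nonneg_iff.2 h.le).lt_of_ne' fun h0 => ?_, harg.2⟩
      exact h.ne' (Complex.arg_eq_zero_iff.1 h0).2
    have h5 := hmono.derivWithin_nonneg (x := ζ.arg)
    rw [derivWithin_of_isOpen isOpen_Ioo ha, hN.deriv] at h5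
    exact mul_nonneg h.le (div_nonneg (by linarith) hns.le)

/-- The exponent is the integral from `2` to `2 + z` of `-Φ'/Φ`, that is, of the Pick function `-ζ
Φ'/Φ` divided by `ζ`. Nonnegativity on `(0, ∞)` holds because `Φ` decreases there. -/
theorem isLaplaceExponent_log_stieltjesTransform (hm : 0 < m) (hρ : ∀ᵐ h ∂ρ, 0 ≤ h)
    (hint : Integrable (fun h => (1 + h) ^ (-m)) ρ) (hρ0 : ρ ≠ 0)
    (hH : IsHyperbolicLaplace fun x => ∫ h, (1 + x * h) ^ (-m) ∂ρ) :
    IsLaplaceExponent fun z => Real.log (∫ h, (1 + 2 * h) ^ (-m) ∂ρ) -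
      Real.log (∫ h, (1 + (2 + z) * h) ^ (-m) ∂ρ) := by
  have hS := differentiableOn_stieltjesTransform hm hρ hint
  have hS' := hS.deriv Complex.isOpen_slitPlane
  have hne := fun ζ hζ => stieltjesTransform_ne_zero hm hρ hint hρ0 hH (ζ := ζ) hζ
  have hfpos := fun x hx => integral_one_add_mul_rpow_pos hm hρ hint hρ0 (x := x) hx
  have hfd : ∀ x : ℝ, 0 < x → HasDerivAt (fun x => ∫ h, (1 + x * h) ^ (-m) ∂ρ)
      (deriv (stieltjesTransform ρ m) x).re x := fun x hx => by
    have h1 := ((hS.differentiableAt (Complex.isOpen_slitPlane.mem_nhds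
      (Complex.ofReal_mem_slitPlane.2 hx))).hasDerivAt).real_of_complex
    refine h1.congr_of_eventuallyEq ?_
    filter_upwards [Ioi_mem_nhds hx] with y hy
    rw [stieltjesTransform_ofReal hρ (Set.mem_Ioi.1 hy).le, Complex.ofReal_re]
  have hre : ∀ x : ℝ, 0 < x →
      (-(x * deriv (stieltjesTransform ρ m) x / stieltjesTransform ρ m x)).re =
        x * -((deriv (stieltjesTransform ρ m) x).re / ∫ h, (1 + x * h) ^ (-m) ∂ρ) :=
    fun x hx => by
      rw [stieltjesTransform_ofReal hρ hx.le, Complex.neg_re, Complex.div_ofReal_re,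
        Complex.re_ofReal_mul]
      ring
  have key := isLaplaceExponent_integral_of_pick
    (g := fun ζ => -(ζ * deriv (stieltjesTransform ρ m) ζ / stieltjesTransform ρ m ζ))
    ((differentiableOn_id.mul hS').div hS hne).neg
    (fun ζ hζ => im_mul_im_nonneg_stieltjesTransform hm hρ hint hρ0 hH hζ) (fun x hx => ?_)
  · refine key.congr fun z hz => ?_
    have hle : (2 : ℝ) ≤ 2 + z := by linarith
    have hx : ∀ x ∈ Set.uIcc 2 (2 + z), 0 < x := fun x hx => by
      rw [Set.uIcc_of_le hle] at hx
      linarith [hx.1]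
    have e : ∀ x ∈ Set.uIcc 2 (2 + z),
        (-((x : ℂ) * deriv (stieltjesTransform ρ m) x / stieltjesTransform ρ m x)).re / x =
          -((deriv (stieltjesTransform ρ m) x).re / ∫ h, (1 + x * h) ^ (-m) ∂ρ) := fun x h => by
      rw [hre x (hx x h), mul_div_cancel_left₀ _ (hx x h).ne']
    rw [intervalIntegral.integral_congr e, intervalIntegral.integral_neg,
      intervalIntegral.integral_eq_sub_of_hasDerivAt
        (f := fun x => Real.log (∫ h, (1 + x * h) ^ (-m) ∂ρ))
        (fun x h => (hfd x (hx x h)).log (hfpos x (hx x h)).ne')]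
    · ring
    · refine ContinuousOn.intervalIntegrable (ContinuousOn.div ?_ ?_ fun x h =>
        (hfpos x (hx x h)).ne')
      · exact (continuousOn_re_comp_ofReal hS').mono hx
      · exact fun x h => (hfd x (hx x h)).continuousAt.continuousWithinAt
  · rw [hre x hx]
    have h5 := (antitoneOn_integral_one_add_mul_rpow hm hρ hint).derivWithin_nonpos (x := x)
    rw [derivWithin_of_isOpen isOpen_Ioi hx, (hfd x hx).deriv] at h5
    exact mul_nonneg hx.le (neg_nonneg.2 (div_nonpos_of_nonpos_of_nonneg h5 (hfpos x hx).le))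

end Stieltjes

/-! ### Infinite divisibility of `√(γ_t γ_s)`. -/

section StieltjesMellin

variable {A : ℝ → ℝ≥0∞} {m : ℝ}

theorem ae_withDensity_mulHaar_nonneg (A : ℝ → ℝ≥0∞) : ∀ᵐ h ∂(mulHaar.withDensity A), 0 ≤ h :=
  (withDensity_absolutelyContinuous mulHaar A).ae_le (ae_mulHaar_pos.mono fun _ h => h.le)

theorem lintegral_withDensity_one_add_mul_rpow (hA : Measurable A) (x : ℝ) :
    ∫⁻ h, ENNReal.ofReal ((1 + x * h) ^ (-m)) ∂(mulHaar.withDensity A) =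
      HypMixture.mellinConv A (fun y => ENNReal.ofReal ((1 + 1 * y) ^ (-m))) x := by
  rw [lintegral_withDensity_eq_lintegral_mul _ hA (by fun_prop), HypMixture.mellinConv]
  simp

theorem ofReal_integral_one_add_mul_rpow (hA : Measurable A) {x : ℝ} (hx : 0 < x)
    (hfin : HypMixture.mellinConv A (fun y => ENNReal.ofReal ((1 + 1 * y) ^ (-m))) x ≠ ⊤) :
    ENNReal.ofReal (∫ h, (1 + x * h) ^ (-m) ∂(mulHaar.withDensity A)) =
      HypMixture.mellinConv A (fun y => ENNReal.ofReal ((1 + 1 * y) ^ (-m))) x := by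
  rw [integral_eq_lintegral_of_nonneg_ae,
    lintegral_withDensity_one_add_mul_rpow hA, ENNReal.ofReal_toReal hfin]
  · filter_upwards [ae_withDensity_mulHaar_nonneg A] with h hh
    simp only [Pi.zero_apply]
    positivity
  · exact (by fun_prop : Measurable fun h => (1 + x * h) ^ (-m)).aestronglyMeasurable

theorem integrable_withDensity_one_add_rpow (hm : 0 < m) (hA : Measurable A)
    (hfin : HypMixture.mellinConv A (fun y => ENNReal.ofReal ((1 + 1 * y) ^ (-m))) 2 ≠ ⊤) :
    Integrable (fun h => (1 + h) ^ (-m)) (mulHaar.withDensity A) := by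
  rw [← lintegral_withDensity_one_add_mul_rpow hA] at hfin
  have h2 : Integrable (fun h => (1 + 2 * h) ^ (-m)) (mulHaar.withDensity A) := by
    refine ⟨(by fun_prop : Measurable fun h : ℝ => (1 + 2 * h) ^ (-m)).aestronglyMeasurable, ?_⟩
    rw [hasFiniteIntegral_iff_ofReal]
    · exact hfin.lt_top
    · filter_upwards [ae_withDensity_mulHaar_nonneg A] with h hh
      simp only [Pi.zero_apply]
      positivity
  refine (h2.const_mul ((1 / 2) ^ (-m))).mono'
    (by fun_prop : Measurable fun h : ℝ => (1 + h) ^ (-m)).aestronglyMeasurable ?_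
  filter_upwards [ae_withDensity_mulHaar_nonneg A] with h hh
  rw [Real.norm_of_nonneg (by positivity), ← Real.mul_rpow (by norm_num) (by positivity)]
  exact Real.rpow_le_rpow_of_nonpos (by positivity) (by linarith) (by linarith)

theorem isHyperbolicLaplace_of_growth {F : HypMixture A} {a : ℝ} (hF : F.Growth a)
    (hA : Measurable A) (hm : 0 < m)
    (hfin : ∀ x : ℝ, 0 < x →
      HypMixture.mellinConv A (fun y => ENNReal.ofReal ((1 + 1 * y) ^ (-m))) x ≠ ⊤) :
    IsHyperbolicLaplace fun x => ∫ h, (1 + x * h) ^ (-m) ∂(mulHaar.withDensity A) := by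
  intro u hu
  obtain ⟨G, hG⟩ := HypMixture.exists_onePlus_growth (c := 1) one_pos hm.le
  have hB : Measurable fun y : ℝ => ENNReal.ofReal ((1 + 1 * y) ^ (-m)) := by fun_prop
  have hne := fun w hw => HypMixture.lintegral_conv_mixing_ne_top hF hG hA hB hu (w := w) hw
    (hfin u hu)
  refine ⟨(F.conv G hA hB).mixing u, (F.conv G hA hB).ae_mixing_nonneg u,
    fun w hw => (integrable_exp_neg_mul_of_lintegral_ne_top (hne w hw)).congr
      (Eventually.of_forall fun x => by simp only [mul_neg, mul_comm]), fun v hv => ?_⟩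
  have hw : -2 < v + v⁻¹ := by
    have : 0 < v + v⁻¹ := by positivity
    linarith
  have h := (F.conv G hA hB).eq_lintegral u v hu hv
  rw [← HypMixture.lintegral_mixing, ← ofReal_integral_one_add_mul_rpow hA (mul_pos hu hv)
    (hfin _ (mul_pos hu hv)), ← ofReal_integral_one_add_mul_rpow hA (div_pos hu hv)
    (hfin _ (div_pos hu hv))] at h
  have hnn : ∀ x : ℝ, 0 < x → 0 ≤ ∫ h, (1 + x * h) ^ (-m) ∂(mulHaar.withDensity A) :=
    fun x hx => integral_nonneg_of_ae (by
      filter_upwards [ae_withDensity_mulHaar_nonneg A] with h hh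
      simp only [Pi.zero_apply]
      positivity)
  rw [integral_eq_lintegral_of_nonneg_ae (Eventually.of_forall fun x => (Real.exp_pos _).le)
    (by fun_prop), ← h, ← ENNReal.ofReal_mul (hnn _ (mul_pos hu hv)),
    ENNReal.toReal_ofReal (mul_nonneg (hnn _ (mul_pos hu hv)) (hnn _ (div_pos hu hv)))]

end StieltjesMellin

/-- The density, with respect to `dh / h`, of the Stieltjes representation of the Laplace transform
of `sqrtGammaDensity t s`. -/
noncomputable def sqrtGammaStieltjesDensity (t s h : ℝ) : ℝ≥0∞ :=
  ENNReal.ofReal (h ^ (t + s - |t - s|)) * ENNReal.ofReal ((1 + 4 * h) ^ (-(1 / 2 - |t - s|)))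

theorem measurable_sqrtGammaStieltjesDensity (t s : ℝ) :
    Measurable (sqrtGammaStieltjesDensity t s) := by
  unfold sqrtGammaStieltjesDensity
  fun_prop

theorem isProbabilityMeasure_sqrtGammaDensity {t s : ℝ} (ht : 0 < t) (hs : 0 < s) :
    IsProbabilityMeasure (measureWithDensityOnPos (sqrtGammaDensity t s)) := by
  have := isProbabilityMeasure_gammaMeasure ht one_pos
  have := isProbabilityMeasure_gammaMeasure hs one_pos
  rw [← map_sqrt_gamma_prod ht hs]
  exact Measure.isProbabilityMeasure_map (by fun_prop)

/-- Insert the convolution formula for `K_{t-s}` and integrate out `x`: this leaves `(2 + z +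
2h)^(-m)` with `m = t + s + |t - s|`, and `h ↦ 1 / (2h)` turns it into the Stieltjes kernel at `2 +
z`. The constant need not be explicit, as `z = 0` determines it. -/
theorem exists_lintegral_exp_neg_sqrtGammaDensity {t s : ℝ} (ht : 0 < t) (hs : 0 < s) :
    ∃ K : ℝ≥0∞, ∀ z : ℝ, 0 ≤ z →
      ∫⁻ x, ENNReal.ofReal (Real.exp (-(z * x))) ∂(measureWithDensityOnPos (sqrtGammaDensity t s)) =
        K * HypMixture.mellinConv (sqrtGammaStieltjesDensity t s)
          (fun y => ENNReal.ofReal ((1 + 1 * y) ^ (-(t + s + |t - s|)))) (2 + z) := by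
  have hGt := Real.Gamma_pos_of_pos ht
  have hGs := Real.Gamma_pos_of_pos hs
  have ha := abs_nonneg (t - s)
  set a := |t - s| with ha_def
  have hGa := Real.Gamma_pos_of_pos (show 0 < a + 1 / 2 by positivity)
  have hm : 0 < t + s + a := by positivity
  have hGm := Real.Gamma_pos_of_pos hm
  let C1 : ℝ≥0∞ := ENNReal.ofReal (4 / (Real.Gamma t * Real.Gamma s)) *
    ENNReal.ofReal (√Real.pi / Real.Gamma (a + 1 / 2) * 2 ^ (a - 1 / 2))
  let A0 : ℝ → ℝ≥0∞ := fun h => ENNReal.ofReal (h ^ (a + 1 / 2)) *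
    ENNReal.ofReal ((1 + 1 / 2 * h) ^ (-(1 / 2 - a)))
  have hA0 : Measurable A0 := by fun_prop
  refine ⟨C1 * ENNReal.ofReal (Real.Gamma (t + s + a) *
    ((1 / 2) ^ (a + 1 / 2) * 4 ^ (1 / 2 - a))), fun z hz => ?_⟩
  rw [lintegral_measureWithDensityOnPos (measurable_sqrtGammaDensity t s) (by fun_prop)]
  have step1 : ∀ x : ℝ, 0 < x → ENNReal.ofReal (x * sqrtGammaDensity t s x) *
      ENNReal.ofReal (Real.exp (-(z * x))) =
      C1 * ∫⁻ h, A0 h * ENNReal.ofReal (x ^ (t + s + a) * Real.exp (-((2 + z + 2 * h) * x)))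
        ∂mulHaar := fun x hx => by
    have e1 : ENNReal.ofReal (x * sqrtGammaDensity t s x) =
        ENNReal.ofReal (4 / (Real.Gamma t * Real.Gamma s)) * ENNReal.ofReal (x ^ (t + s)) *
          ENNReal.ofReal (besselK (t - s) (2 * x)) := by
      rw [← ENNReal.ofReal_mul (by positivity), ← ENNReal.ofReal_mul (by positivity),
        sqrtGammaDensity, Real.rpow_sub_one hx.ne']
      congr 1
      field_simp
    rw [e1, ← besselK_two_mul_eq_mellinConv hx, ← ha_def, HypMixture.mellinConv]
    have e2 : ∫⁻ h, A0 h * ENNReal.ofReal (x ^ (t + s + a) * Real.exp (-((2 + z + 2 * h) * x)))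
        ∂mulHaar = ENNReal.ofReal (x ^ (t + s)) * (ENNReal.ofReal (x ^ a) *
          ENNReal.ofReal (Real.exp (-(2 * x)))) * ENNReal.ofReal (Real.exp (-(z * x))) *
          ∫⁻ h, A0 h * ENNReal.ofReal (Real.exp (-(2 * (x * h)))) ∂mulHaar := by
      rw [← lintegral_const_mul _ (by fun_prop)]
      refine lintegral_congr fun h => ?_
      rw [mul_left_comm]
      congr 1
      rw [← ENNReal.ofReal_mul (by positivity), ← ENNReal.ofReal_mul (by positivity),
        ← ENNReal.ofReal_mul (by positivity), ← ENNReal.ofReal_mul (by positivity),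
        Real.rpow_add hx, show -((2 + z + 2 * h) * x) = -(2 * x) + -(z * x) + -(2 * (x * h)) by
          ring, Real.exp_add, Real.exp_add]
      congr 1
      ring
    rw [e2]
    simp only [C1, A0]
    ring
  rw [lintegral_mulHaar_congr step1, lintegral_const_mul _ (by fun_prop), mul_assoc C1,
    lintegral_lintegral_swap (by fun_prop)]
  congr 1
  have step2 : ∀ h : ℝ, 0 < h →
      ∫⁻ x, A0 h * ENNReal.ofReal (x ^ (t + s + a) * Real.exp (-((2 + z + 2 * h) * x))) ∂mulHaar =
      A0 h * ENNReal.ofReal (Real.Gamma (t + s + a) * (2 + z + 2 * h) ^ (-(t + s + a))) :=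
    fun h hh => by
      rw [lintegral_const_mul _ (by fun_prop), lintegral_mulHaar_rpow_mul_exp hm (by positivity)]
  rw [lintegral_mulHaar_congr step2, HypMixture.mellinConv,
    ← lintegral_const_mul _ (by unfold sqrtGammaStieltjesDensity; fun_prop),
    ← lintegral_mulHaar_const_div _ (show (0 : ℝ) < 1 / 2 by norm_num)]
  refine lintegral_mulHaar_congr fun h hh => ?_
  simp only [A0, sqrtGammaStieltjesDensity, ← ha_def]
  rw [← ENNReal.ofReal_mul (by positivity), ← ENNReal.ofReal_mul (by positivity),
    ← ENNReal.ofReal_mul (by positivity), ← ENNReal.ofReal_mul (by positivity),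
    ← ENNReal.ofReal_mul (by positivity)]
  congr 1
  have e1 : 1 + 1 / 2 * (1 / 2 / h) = (1 + 4 * h) * (4 * h)⁻¹ := by field_simp; ring
  have e2 : 2 + z + 2 * (1 / 2 / h) = (1 + 1 * ((2 + z) * h)) * h⁻¹ := by field_simp; ring
  have e3 : (1 / 2 / h) ^ (a + 1 / 2) = (1 / 2) ^ (a + 1 / 2) * h ^ (-(a + 1 / 2)) := by
    rw [Real.div_rpow (by norm_num) hh.le, Real.rpow_neg hh.le, div_eq_mul_inv]
  have e4 : ((4 * h)⁻¹) ^ (-(1 / 2 - a)) = 4 ^ (1 / 2 - a) * h ^ (1 / 2 - a) := by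
    rw [Real.inv_rpow (by positivity), Real.rpow_neg (by positivity), inv_inv,
      Real.mul_rpow (by norm_num) hh.le]
  have e5 : h⁻¹ ^ (-(t + s + a)) = h ^ (t + s + a) := by
    rw [Real.inv_rpow hh.le, Real.rpow_neg hh.le, inv_inv]
  have e6 : h ^ (t + s - a) = h ^ (-(a + 1 / 2)) * h ^ (1 / 2 - a) * h ^ (t + s + a) := by
    rw [← Real.rpow_add hh, ← Real.rpow_add hh]
    congr 1
    ring
  rw [e1, e2, e3, e6, Real.mul_rpow (x := 1 + 4 * h) (by positivity) (by positivity), e4,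
    Real.mul_rpow (x := 1 + 1 * ((2 + z) * h)) (by positivity) (by positivity), e5]
  ring

theorem isInfinitelyDivisibleLaw_sqrtGammaDensity {t s : ℝ} (ht : 0 < t) (hs : 0 < s)
    (hts : |t - s| ≤ 1 / 2) :
    IsInfinitelyDivisibleLaw (measureWithDensityOnPos (sqrtGammaDensity t s)) := by
  have hprob := isProbabilityMeasure_sqrtGammaDensity ht hs
  have hm : 0 < t + s + |t - s| := by positivity
  have hA := measurable_sqrtGammaStieltjesDensity t s
  obtain ⟨K, hK⟩ := exists_lintegral_exp_neg_sqrtGammaDensity ht hs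
  set m := t + s + |t - s| with hm_def
  set ρ := mulHaar.withDensity (sqrtGammaStieltjesDensity t s) with hρ_def
  -- At `z = 0` the total mass gives `1 = K Φ(2)`. This yields the finiteness of `Φ(2)`, the
  -- nonvanishing of `ρ` and the normalization.
  have hK2 := hK 0 le_rfl
  simp only [zero_mul, neg_zero, Real.exp_zero, ENNReal.ofReal_one, lintegral_one, measure_univ,
    add_zero] at hK2
  have hfin2 : HypMixture.mellinConv (sqrtGammaStieltjesDensity t s)
      (fun y => ENNReal.ofReal ((1 + 1 * y) ^ (-m))) 2 ≠ ⊤ := fun h => by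
    rw [h] at hK2
    rcases eq_or_ne K 0 with h0 | h0
    · simp [h0] at hK2
    · simp [ENNReal.mul_top h0] at hK2
  have hρ : ∀ᵐ h ∂ρ, 0 ≤ h := ae_withDensity_mulHaar_nonneg _
  have hint : Integrable (fun h => (1 + h) ^ (-m)) ρ :=
    integrable_withDensity_one_add_rpow hm hA hfin2
  have hfin : ∀ x : ℝ, 0 < x → HypMixture.mellinConv (sqrtGammaStieltjesDensity t s)
      (fun y => ENNReal.ofReal ((1 + 1 * y) ^ (-m))) x ≠ ⊤ := fun x hx => by
    rw [← lintegral_withDensity_one_add_mul_rpow hA]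
    have h1 := (integrable_one_add_mul_rpow hm hρ hint hx).2
    rw [hasFiniteIntegral_iff_ofReal] at h1
    · exact h1.ne
    · filter_upwards [hρ] with h hh
      simp only [Pi.zero_apply]
      positivity
  have hρ0 : ρ ≠ 0 := fun h0 => by
    rw [← lintegral_withDensity_one_add_mul_rpow hA, ← hρ_def, h0, lintegral_zero_measure,
      mul_zero] at hK2
    exact one_ne_zero hK2
  obtain ⟨H, hH⟩ := HypMixture.exists_onePlus_growth (c := 4) (by norm_num) (sub_nonneg.2 hts)
  have hHL : IsHyperbolicLaplace fun x => ∫ h, (1 + x * h) ^ (-m) ∂ρ :=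
    isHyperbolicLaplace_of_growth
      (F := (HypMixture.rpow (t + s - |t - s|)).mul H)
      (HypMixture.mul_growth (HypMixture.rpow_growth _) hH) hA hm hfin
  have hS := isLaplaceExponent_log_stieltjesTransform hm hρ hint hρ0 hHL
  have hfpos := fun x hx => integral_one_add_mul_rpow_pos hm hρ hint hρ0 (x := x) hx
  have hLT : HasLaplaceTransform (measureWithDensityOnPos (sqrtGammaDensity t s))
      fun z => (∫ h, (1 + (2 + z) * h) ^ (-m) ∂ρ) / ∫ h, (1 + 2 * h) ^ (-m) ∂ρ := by
    refine ⟨hprob, ?_, fun z hz => ?_⟩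
    · refine (withDensity_absolutelyContinuous _ _).ae_le ?_
      exact (ae_restrict_mem measurableSet_Ioi).mono fun x hx => (Set.mem_Ioi.1 hx).le
    · rw [integral_eq_lintegral_of_nonneg_ae (Eventually.of_forall fun x => (Real.exp_pos _).le)
        (by fun_prop), hK z hz, eq_div_iff (hfpos 2 two_pos).ne', ENNReal.toReal_mul,
        ← ofReal_integral_one_add_mul_rpow hA (by linarith) (hfin _ (by linarith)),
        ENNReal.toReal_ofReal (hfpos _ (by linarith)).le]
      rw [← ofReal_integral_one_add_mul_rpow hA two_pos hfin2] at hK2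
      have h3 := congrArg ENNReal.toReal hK2
      rw [ENNReal.toReal_mul, ENNReal.toReal_ofReal (hfpos 2 two_pos).le, ENNReal.toReal_one] at h3
      rw [mul_right_comm, ← h3, one_mul]
  refine ⟨hprob, fun n hn => ?_⟩
  have hn0 : (0 : ℝ) < n := by exact_mod_cast hn
  -- The transform is `Φ(2 + z) / Φ(2) = exp (-S z)`, so the law with transform `exp (-S z / n)` is
  -- an `n`-th convolution root.
  obtain ⟨ν, hν⟩ := hS (1 / n) (by positivity)
  refine ⟨ν, hν.isProbabilityMeasure, ((hν.convPower n).congr fun z hz => ?_).unique hLT⟩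
  rw [← Real.exp_nat_mul, ← mul_neg, neg_sub, ← mul_assoc, mul_one_div_cancel hn0.ne', one_mul,
    ← Real.log_div (hfpos _ (by linarith)).ne' (hfpos _ two_pos).ne',
    Real.exp_log (div_pos (hfpos _ (by linarith)) (hfpos _ two_pos))]


end

theorem mainTheorem4 {Ω : Type*} [MeasurableSpace Ω] (P : Measure Ω) [IsProbabilityMeasure P] :
    -- the density of the square root of a product of two independent gamma variables
    (∀ (t s : ℝ), 0 < t → 0 < s → ∀ (X Y : Ω → ℝ),
      HasLaw X (gammaMeasure t 1) P → HasLaw Y (gammaMeasure s 1) P → IndepFun X Y P →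
      P.map (fun o => √(X o * Y o)) = measureWithDensityOnPos
        (fun x => 4 * x ^ (t + s - 1) / (Real.Gamma t * Real.Gamma s) * besselK (t - s) (2 * x))) ∧
    -- it is hyperbolically completely monotone, and the law is infinitely divisible
    (∀ (t s : ℝ), 0 < t → 0 < s → |t - s| ≤ 1 / 2 → ∀ (X Y : Ω → ℝ),
      HasLaw X (gammaMeasure t 1) P → HasLaw Y (gammaMeasure s 1) P → IndepFun X Y P →
      HasHCMDensity (P.map (fun o => √(X o * Y o))) ∧
      IsInfinitelyDivisibleLaw (P.map (fun o => √(X o * Y o)))) ∧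
    -- the factorization of the positive stable variable of index 1/3
    (∀ (Z X Y : Ω → ℝ), AEMeasurable Z P → IsPositiveStableLaw (1 / 3) (P.map Z) →
      HasLaw X (gammaMeasure (1 / 3) 1) P → HasLaw Y (gammaMeasure (2 / 3) 1) P →
      IndepFun X Y P →
      IdentDistrib (fun o => 1 / √(Z o)) (fun o => 3 * √(3 * (X o * Y o))) P P) ∧
    -- its square root has a hyperbolically completely monotone density
    (∀ Z : Ω → ℝ, AEMeasurable Z P → IsPositiveStableLaw (1 / 3) (P.map Z) →
      HasHCMDensity (P.map (fun o => √(Z o)))) ∧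
    -- the function x ↦ 1 / (x^{4/3} + x^{2/3} + 1) is hyperbolically completely monotone
    IsHCM (cauchyTypeFun (1 / 3) (1 - 1 / 3)) ∧
    -- the square root of a product of two independent unit exponentials
    (∀ X Y : Ω → ℝ, HasLaw X (expMeasure 1) P → HasLaw Y (expMeasure 1) P → IndepFun X Y P →
      IsInfinitelyDivisibleLaw (P.map (fun o => √(X o * Y o)))) := by
  have hID : ∀ t s : ℝ, 0 < t → 0 < s → |t - s| ≤ 1 / 2 → ∀ X Y : Ω → ℝ,
      HasLaw X (gammaMeasure t 1) P → HasLaw Y (gammaMeasure s 1) P → IndepFun X Y P →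
      IsInfinitelyDivisibleLaw (P.map (fun o => √(X o * Y o))) := by
    intro t s ht hs hts X Y hX hY hXY
    rw [map_sqrt_mul_eq ht hs hX hY hXY]
    exact isInfinitelyDivisibleLaw_sqrtGammaDensity ht hs hts
  refine ⟨fun t s ht hs X Y hX hY hXY => map_sqrt_mul_eq ht hs hX hY hXY,
    fun t s ht hs hts X Y hX hY hXY => ⟨?_, hID t s ht hs hts X Y hX hY hXY⟩,
    fun Z X Y hZ hμ hX hY hXY => ?_, fun Z hZ hμ => ?_, isHCM_cauchyTypeFun_third,
    -- `expMeasure 1` unfolds to `gammaMeasure 1 1`.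
    fun X Y hX hY hXY => hID 1 1 one_pos one_pos (by norm_num) X Y hX hY hXY⟩
  · rw [map_sqrt_mul_eq ht hs hX hY hXY]
    exact ⟨_, measurable_sqrtGammaDensity t s, isHCM_sqrtGammaDensity ht hs hts, rfl⟩
  · have hg : Measurable fun z : ℝ => 1 / √z := by fun_prop
    have hh : Measurable fun p : ℝ × ℝ => 3 * √(3 * (p.1 * p.2)) := by fun_prop
    refine ⟨hg.comp_aemeasurable hZ,
      hh.comp_aemeasurable (hX.aemeasurable.prodMk hY.aemeasurable), ?_⟩
    have h1 := AEMeasurable.map_map_of_aemeasurable hg.aemeasurable hZ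
    have h2 := AEMeasurable.map_map_of_aemeasurable hh.aemeasurable
      (hX.aemeasurable.prodMk hY.aemeasurable)
    have h3 := (indepFun_iff_map_prod_eq_prod_map_map hX.aemeasurable hY.aemeasurable).1 hXY
    rw [hX.map_eq, hY.map_eq] at h3
    rw [h3] at h2
    exact h1.symm.trans ((map_inv_sqrt_of_stable_third hμ).trans h2)
  · have h1 := AEMeasurable.map_map_of_aemeasurable
      (show Measurable fun z : ℝ => √z by fun_prop).aemeasurable hZ
    have h2 := hasHCMDensity_map_sqrt_of_stable_third hμ
    rw [h1] at h2
    exact h2
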